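/- Throughout, manifolds are Hausdorff, finite-dimensional and without boundary, bundles have finite rank, everything is $C^\infty$, and repeated Greek and lower-case Latin indices are summed. Let $(E,[\![\cdot,\cdot]\!],\rho)$ be a Lie algebroid over an $n$-dimensional manifold $Q$, with projection $\tau:E\to Q$, let $k\ge 0$, let $M=\mathbb R^k\times(E\oplus\overset{k}{\cdots}\oplus E)$ with points $p=(t;q;e_1,\dots,e_k)$, $e_A\in E_q$, and let $\mathrm p:M\to Q$ be the projection. The Lagrangian prolongation $\mathcal T^E M\to M$ has fibres $\{(a,v)\in E_{\mathrm p(p)}\times T_pM:\rho(a)=T\mathrm p(v)\}$; it is a Lie algebroid with anchor $(a,v)\mapsto v$ and with the bracket whose $TM$-component is the Lie bracket of vector fields and whose $E$-component, for $\xi=(f^\alpha\, e_\alpha\circ\mathrm p,\ V)$, $\eta=(g^\alpha\, e_\alpha\circ\mathrm p,\ W)$ with a local frame $e_\alpha$ of $E$, is $f^\alpha g^\beta[\![e_\alpha,e_\beta]\!]\circ\mathrm p+(V(g^\alpha)-W(f^\alpha))\,e_\alpha\circ\mathrm p$. Let $d$ be its exterior differential: $df(a,v)=v(f)$ and $d\theta(\xi,\eta)=\rho(\xi)(\theta(\eta))-\rho(\eta)(\theta(\xi))-\theta([\![\xi,\eta]\!])$,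 where $\rho(\xi)$ denotes the vector field on $M$ given by $\xi$. Let $\mathcal Y^B(a,v)=v(t^B)$. For $a\in E_q$ let $(a)^{v_A}\in T_pM$ be the velocity at $s=0$ of $s\mapsto(t;q;e_1,\dots,e_A+sa,\dots,e_k)$; put $\widetilde S^A(a,v)=(0,(a)^{v_A})$ and $\widehat\Delta_A(p)=(0,(e_A)^{v_A})$. For a function $L:M\to\mathbb R$ let $\Theta_L^A=dL\circ\widetilde S^A$, $\Omega_L^A=-d\Theta_L^A$ and $E_L=\sum_A\rho(\widehat\Delta_A)L-L$. A chart $(q^i)$ of $Q$ and a local frame $(e_\alpha)$ of $E$ give local coordinates $(t^A,q^i,y^\alpha_A)$ on $M$, with $e_A=y^\alpha_A e_\alpha$, and functions $\rho^i_\alpha$, $\mathcal C^\gamma_{\alpha\beta}$ with $\rho(e_\alpha)=\rho^i_\alpha\,\partial/\partial q^i$ and $[\![e_\alpha,e_\beta]\!]=\mathcal C^\gamma_{\alpha\beta}e_\gamma$. $L$ is regular if the matrix $\big(\partial^2L/\partial y^\alpha_A\partial y^\beta_B\big)$ is everywhere non-singular. **Theorem.** Let $L:M\to\mathbb R$ be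 a regular Lagrangian and let $\xi_1,\dots,\xi_k$ be sections of $\mathcal T^EM\to M$ such that $$\mathcal Y^B(\xi_A)=\delta^B_A,\qquad \sum_{A=1}^k i_{\xi_A}\Omega_L^A=dE_L+\sum_{A=1}^k\frac{\partial L}{\partial t^A}\,\mathcal Y^A .$$ Then: 1. $\xi=(\xi_1,\dots,\xi_k)$ is a SOPDE, that is, $\widetilde S^A(\xi_A)=\widehat\Delta_A$ and $\mathcal Y^B(\xi_A)=\delta^B_A$ for all $A,B$. 2. Let $\Phi:T\mathbb R^k\to E$ be a morphism of Lie algebroids over $\phi:\mathbb R^k\to Q$ (a vector bundle map with $d^{T\mathbb R^k}(\Phi^*\omega)=\Phi^*(d^E\omega)$ for all forms $\omega$ on $E$ of all degrees), and let $\widetilde\Phi(t)=\big(t;\phi(t);\Phi(\tfrac{\partial}{\partial t^1}|_t),\dots,\Phi(\tfrac{\partial}{\partial t^k}|_t)\big)$ be its associated map $\mathbb R^k\to M$. If $\widetilde\Phi$ is an integral section of $\xi$, that is, $T_t\widetilde\Phi\big(\tfrac{\partial}{\partial t^A}|_t\big)=\rho(\xi_A)(\widetilde\Phi(t))$ for all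 $t$ and $A$, then $\widetilde\Phi$ is a solution of the Euler–Lagrange equations of field theories on Lie algebroids: it is smooth and, writing $\widetilde\Phi(t)=(t^A,\phi^i(t),\phi^\alpha_A(t))$ in any such local coordinates, with all functions of the points of $Q$ and $M$ taken at $\phi(t)$ and $\widetilde\Phi(t)$, $$\sum_{A=1}^k\frac{\partial}{\partial t^A}\Big(\frac{\partial L}{\partial y^\alpha_A}\Big|_{\widetilde\Phi(t)}\Big)=\rho^i_\alpha\frac{\partial L}{\partial q^i}-\sum_{A=1}^k\phi^\beta_A\,\mathcal C^\gamma_{\alpha\beta}\frac{\partial L}{\partial y^\gamma_A},$$ $$\frac{\partial\phi^i}{\partial t^A}=\phi^\alpha_A\,\rho^i_\alpha,\qquad 0=\frac{\partial\phi^\alpha_A}{\partial t^B}-\frac{\partial\phi^\alpha_B}{\partial t^A}+\mathcal C^\alpha_{\beta\gamma}\,\phi^\beta_B\,\phi^\gamma_A$$ for all $\alpha,i,A,B$. -/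

import Mathlib

set_option linter.unusedSectionVars false

open scoped Manifold ContDiff Bundle Topology
open Bundle

/-- The fibre at `q` of the Whitney sum `E ⊕ ⋯ ⊕ E` of `k` copies of `E`. -/
def WhitneySum {Q : Type*} (k : ℕ) (E : Q → Type*) (q : Q) : Type _ := Fin k → E q

namespace WhitneySum

section Algebra

variable {Q : Type*} {k : ℕ} {E : Q → Type*}

instance [∀ q, AddCommGroup (E q)] (q : Q) : AddCommGroup (WhitneySum k E q) :=
  inferInstanceAs (AddCommGroup (Fin k → E q))

instance [∀ q, AddCommGroup (E q)] [∀ q, Module ℝ (E q)] (q : Q) :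
    Module ℝ (WhitneySum k E q) :=
  inferInstanceAs (Module ℝ (Fin k → E q))

instance [∀ q, TopologicalSpace (E q)] (q : Q) : TopologicalSpace (WhitneySum k E q) :=
  inferInstanceAs (TopologicalSpace (Fin k → E q))

end Algebra

section Bundle

variable {Q : Type*} [TopologicalSpace Q] (k : ℕ)
  (F : Type*) [NormedAddCommGroup F] [NormedSpace ℝ F]
  (E : Q → Type*) [TopologicalSpace (TotalSpace F E)]

/-- The map `(q; e₁, …, e_k) ↦ (q, (e₁, …, e_k))` into `Q × E × ⋯ × E`. -/
def diag (p : TotalSpace (Fin k → F) (WhitneySum k E)) : Q × (Fin k → TotalSpace F E) :=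
  (p.1, fun A => ⟨p.1, p.2 A⟩)

/-- The Whitney sum carries the topology of a subspace of `Q × E × ⋯ × E`. -/
instance topologicalSpace : TopologicalSpace (TotalSpace (Fin k → F) (WhitneySum k E)) :=
  TopologicalSpace.induced (diag k F E) inferInstance

theorem isInducing_diag : Topology.IsInducing (diag k F E) := ⟨rfl⟩

variable [∀ q, AddCommGroup (E q)] [∀ q, Module ℝ (E q)] [∀ q, TopologicalSpace (E q)]
  [FiberBundle F E] [VectorBundle ℝ F E]

variable {k F E}

/-- The trivialization of the Whitney sum induced by a trivialization of `E`, acting on each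
summand. -/
noncomputable def triv (e : Trivialization F (π F E)) :
    Trivialization (Fin k → F) (π (Fin k → F) (WhitneySum k E)) where
  toFun p := (p.1, fun A => (e ⟨p.1, p.2 A⟩).2)
  invFun x := ⟨x.1, fun A => e.symm x.1 (x.2 A)⟩
  source := π (Fin k → F) (WhitneySum k E) ⁻¹' e.baseSet
  target := e.baseSet ×ˢ Set.univ
  map_source' _ h := ⟨h, Set.mem_univ _⟩
  map_target' _ h := h.1
  left_inv' := by
    rintro ⟨q, v⟩ (h : q ∈ e.baseSet)
    simp [h]
  right_inv' := by
    rintro ⟨q, v⟩ ⟨h : q ∈ e.baseSet, -⟩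
    simp [h]
  open_source := by
    have h : Continuous fun p : TotalSpace (Fin k → F) (WhitneySum k E) => p.1 :=
      continuous_fst.comp (isInducing_diag k F E).continuous
    exact e.open_baseSet.preimage h
  open_target := e.open_baseSet.prod isOpen_univ
  continuousOn_toFun := by
    have h := (isInducing_diag k F E).continuous
    refine (continuous_fst.comp h).continuousOn.prodMk (continuousOn_pi.2 fun A => ?_)
    refine continuous_snd.comp_continuousOn (e.continuousOn.comp
      ((continuous_apply A).comp (continuous_snd.comp h)).continuousOn ?_)
    intro p hp
    exact e.mem_source.2 hp
  continuousOn_invFun := by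
    rw [(isInducing_diag k F E).continuousOn_iff]
    refine continuous_fst.continuousOn.prodMk (continuousOn_pi.2 fun A => ?_)
    have : ContinuousOn (fun x : Q × (Fin k → F) => (x.1, x.2 A)) (e.baseSet ×ˢ Set.univ) := by
      fun_prop
    exact e.continuousOn_symm.comp this fun x hx => ⟨hx.1, Set.mem_univ _⟩
  baseSet := e.baseSet
  open_baseSet := e.open_baseSet
  source_eq := rfl
  target_eq := rfl
  proj_toFun _ _ := rfl

noncomputable instance fiberBundle : FiberBundle (Fin k → F) (WhitneySum k E) where
  totalSpaceMk_isInducing' b := by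
    rw [← (isInducing_diag k F E).of_comp_iff]
    exact Topology.isInducing_const_prod.2
      (.piMap (f := fun _ (v : E b) => TotalSpace.mk' F b v)
        fun _ => FiberBundle.totalSpaceMk_isInducing F E b)
  trivializationAtlas' := {e | ∃ (e₀ : Trivialization F (π F E)) (_ : MemTrivializationAtlas e₀),
    e = triv e₀}
  trivializationAt' b := triv (trivializationAt F E b)
  mem_baseSet_trivializationAt' b := FiberBundle.mem_baseSet_trivializationAt' b
  trivialization_mem_atlas' b := ⟨trivializationAt F E b, inferInstance, rfl⟩

instance (e : Trivialization F (π F E)) [MemTrivializationAtlas e] :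
    MemTrivializationAtlas (triv (k := k) e) where
  out := ⟨e, inferInstance, rfl⟩

instance (e : Trivialization F (π F E)) [e.IsLinear ℝ] : (triv (k := k) e).IsLinear ℝ where
  linear _ h :=
    ⟨fun v w => funext fun A => (e.linear ℝ h).map_add (v A) (w A),
     fun c v => funext fun A => (e.linear ℝ h).map_smul c (v A)⟩

/-- The linear map acting as `T` on each of the `k` components. -/
noncomputable def mapL (T : F →L[ℝ] F) : (Fin k → F) →L[ℝ] (Fin k → F) :=
  ContinuousLinearMap.pi fun A => T.comp (ContinuousLinearMap.proj A)

theorem mapL_eq (T : F →L[ℝ] F) : mapL (k := k) T =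
    ∑ A, (ContinuousLinearMap.single ℝ (fun _ : Fin k => F) A).comp
      (T.comp (ContinuousLinearMap.proj A)) := by
  ext v A
  simp [mapL, Finset.sum_apply, Pi.single_apply]

theorem coordChangeL_triv (e e' : Trivialization F (π F E)) [e.IsLinear ℝ] [e'.IsLinear ℝ]
    {b : Q} (hb : b ∈ e.baseSet ∩ e'.baseSet) :
    ((triv (k := k) e).coordChangeL ℝ (triv e') b : (Fin k → F) →L[ℝ] (Fin k → F)) =
      mapL (e.coordChangeL ℝ e' b : F →L[ℝ] F) := by
  refine ContinuousLinearMap.ext fun v => ?_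
  change (triv (k := k) e).coordChangeL ℝ (triv e') b v = fun A => e.coordChangeL ℝ e' b (v A)
  rw [(triv (k := k) e).coordChangeL_apply' (triv e') hb]
  funext A
  rw [e.coordChangeL_apply e' hb]
  rfl

instance vectorBundle : VectorBundle ℝ (Fin k → F) (WhitneySum k E) where
  trivialization_linear' := by
    rintro _ ⟨e, he, rfl⟩
    infer_instance
  continuousOn_coordChange' := by
    rintro _ _ ⟨e, he, rfl⟩ ⟨e', he', rfl⟩
    refine ContinuousOn.congr ?_ fun b hb => coordChangeL_triv e e' hb
    simp_rw [mapL_eq]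
    refine continuousOn_finsetSum _ fun A _ => ?_
    exact continuousOn_const.clm_comp
      ((continuousOn_coordChange ℝ e e').clm_comp continuousOn_const)

instance contMDiffVectorBundle {n : ℕ} [ChartedSpace (EuclideanSpace ℝ (Fin n)) Q]
    [ContMDiffVectorBundle ∞ F E (𝓡 n)] :
    ContMDiffVectorBundle ∞ (Fin k → F) (WhitneySum k E) (𝓡 n) where
  contMDiffOn_coordChangeL := by
    rintro _ _ ⟨e, he, rfl⟩ ⟨e', he', rfl⟩
    refine ContMDiffOn.congr ?_ fun b hb => coordChangeL_triv e e' hb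
    simp_rw [mapL_eq]
    refine contMDiffOn_finsetSum fun A _ => ?_
    exact contMDiffOn_const.clm_comp
      ((contMDiffOn_coordChangeL e e').clm_comp contMDiffOn_const)

end Bundle

end WhitneySum

/-- A Lie algebroid structure on the smooth real vector bundle `E → Q` (with typical fibre `F`)
over the `n`-dimensional manifold `Q`: a smooth bundle map `E → TQ` over the identity (the anchor)
and a real Lie bracket on the space of smooth sections which satisfies the Leibniz rule. -/
structure LieAlgebroid {n : ℕ} (Q : Type*) [TopologicalSpace Q]
    [ChartedSpace (EuclideanSpace ℝ (Fin n)) Q] [IsManifold (𝓡 n) ∞ Q]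
    (F : Type*) [NormedAddCommGroup F] [NormedSpace ℝ F]
    (E : Q → Type*) [TopologicalSpace (TotalSpace F E)]
    [∀ q, AddCommGroup (E q)] [∀ q, Module ℝ (E q)] [∀ q, TopologicalSpace (E q)]
    [FiberBundle F E] [VectorBundle ℝ F E] where
  /-- the anchor map -/
  anchor : ∀ q, E q →L[ℝ] TangentSpace (𝓡 n) q
  contMDiff_anchor : ContMDiff ((𝓡 n).prod 𝓘(ℝ, F)) (𝓡 n).tangent ∞
    (fun v : TotalSpace F E => (⟨v.1, anchor v.1 v.2⟩ : TangentBundle (𝓡 n) Q))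
  /-- the bracket of sections -/
  bracket : Cₛ^∞⟮𝓡 n; F, E⟯ → Cₛ^∞⟮𝓡 n; F, E⟯ → Cₛ^∞⟮𝓡 n; F, E⟯
  bracket_add : ∀ s t u, bracket s (t + u) = bracket s t + bracket s u
  bracket_smul : ∀ (c : ℝ) s t, bracket s (c • t) = c • bracket s t
  bracket_antisymm : ∀ s t, bracket s t = -bracket t s
  jacobi : ∀ s t u, bracket s (bracket t u) = bracket (bracket s t) u + bracket t (bracket s u)
  leibniz : ∀ (f : Q → ℝ) (hf : ContMDiff (𝓡 n) 𝓘(ℝ, ℝ) ∞ f) (s t : Cₛ^∞⟮𝓡 n; F, E⟯) (q : Q),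
    bracket s ⟨f • (t : ∀ q, E q), hf.smul_section t.contMDiff⟩ q =
      f q • bracket s t q + mvfderiv (𝓡 n) f q (anchor q (s q)) • t q

section TangentAlgebroid

variable {n : ℕ} (Q : Type*) [TopologicalSpace Q]
    [ChartedSpace (EuclideanSpace ℝ (Fin n)) Q] [IsManifold (𝓡 n) ∞ Q]

/-- The tangent bundle with the identity as anchor and the Lie bracket of vector fields. -/
noncomputable def tangentLieAlgebroid :
    LieAlgebroid (n := n) Q (EuclideanSpace ℝ (Fin n)) (TangentSpace (𝓡 n) : Q → Type) where
  anchor q := ContinuousLinearMap.id ℝ (TangentSpace (𝓡 n) q)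
  contMDiff_anchor := contMDiff_id
  bracket s t := ⟨VectorField.mlieBracket (𝓡 n) s t, by
    intro q
    have : IsManifold (𝓡 n) (((⊤ : ℕ∞) : ℕ∞ω) + 1) Q := ‹IsManifold (𝓡 n) ∞ Q›
    have : IsManifold (𝓡 n) (minSmoothness ℝ 3) Q := by
      rw [minSmoothness_of_isRCLikeNormedField]; infer_instance
    exact ContMDiffAt.mlieBracket_vectorField (m := ⊤) (n := ⊤) (s.contMDiff q) (t.contMDiff q)
      (by simp [minSmoothness_of_isRCLikeNormedField])⟩
  bracket_add s t u := by
    have : IsManifold (𝓡 n) (minSmoothness ℝ 2) Q := by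
      rw [minSmoothness_of_isRCLikeNormedField]; infer_instance
    ext q : 1
    exact VectorField.mlieBracket_add_right t.mdifferentiableAt u.mdifferentiableAt
  bracket_smul c s t := by
    have : IsManifold (𝓡 n) (minSmoothness ℝ 2) Q := by
      rw [minSmoothness_of_isRCLikeNormedField]; infer_instance
    ext q : 1
    exact VectorField.mlieBracket_const_smul_right t.mdifferentiableAt
  bracket_antisymm s t := by
    ext q : 1
    exact VectorField.mlieBracket_swap_apply
  jacobi s t u := by
    have : IsManifold (𝓡 n) (minSmoothness ℝ 3) Q := by
      rw [minSmoothness_of_isRCLikeNormedField]; infer_instance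
    have h : minSmoothness ℝ 2 ≤ ∞ := by
      rw [minSmoothness_of_isRCLikeNormedField]; exact ENat.LEInfty.out
    ext q : 1
    exact VectorField.leibniz_identity_mlieBracket_apply (s.contMDiff.of_le h q)
      (t.contMDiff.of_le h q) (u.contMDiff.of_le h q)
  leibniz f hf s t q := by
    have : IsManifold (𝓡 n) (minSmoothness ℝ 2) Q := by
      rw [minSmoothness_of_isRCLikeNormedField]; infer_instance
    refine (VectorField.mlieBracket_smul_right ((hf q).mdifferentiableAt (by simp))
      t.mdifferentiableAt).trans ?_
    rw [add_comm]
    rfl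

end TangentAlgebroid

namespace LieAlgebroid

variable {n : ℕ} {Q : Type*} [TopologicalSpace Q]
    [ChartedSpace (EuclideanSpace ℝ (Fin n)) Q] [IsManifold (𝓡 n) ∞ Q]
    {F : Type*} [NormedAddCommGroup F] [NormedSpace ℝ F]
    {E : Q → Type*} [TopologicalSpace (TotalSpace F E)]
    [∀ q, AddCommGroup (E q)] [∀ q, Module ℝ (E q)] [∀ q, TopologicalSpace (E q)]
    [FiberBundle F E] [VectorBundle ℝ F E]
    (LA : LieAlgebroid (n := n) Q F E)

/-- The bracket at `q` of two local sections `s`, `t` of `E` defined near `q`: the value at `q` of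
the bracket of any global smooth sections that agree with `s` and `t` near `q` (and `0` if `s` or
`t` is not smooth near `q`). -/
noncomputable def localBracket (s t : ∀ q, E q) (q : Q) : E q :=
  open Classical in
  if h : ∃ S T : Cₛ^∞⟮𝓡 n; F, E⟯, (∀ᶠ q' in 𝓝 q, S q' = s q') ∧ (∀ᶠ q' in 𝓝 q, T q' = t q') then
    LA.bracket h.choose h.choose_spec.choose q
  else 0

section Locality

variable [T2Space Q]

theorem bracket_eq_zero_right {s t : Cₛ^∞⟮𝓡 n; F, E⟯} {q : Q} (ht : ∀ᶠ q' in 𝓝 q, t q' = 0) :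
    LA.bracket s t q = 0 := by
  obtain ⟨f, -, hf⟩ := (SmoothBumpFunction.nhds_basis_support (I := 𝓡 n)
    (c := q) ht).mem_iff.1 ht
  have h0 : (⟨(f : Q → ℝ) • (t : ∀ q, E q), f.contMDiff.smul_section t.contMDiff⟩ :
      Cₛ^∞⟮𝓡 n; F, E⟯) = 0 := by
    ext q'
    change f q' • t q' = 0
    by_cases h : q' ∈ Function.support f
    · rw [show t q' = 0 from hf h, smul_zero]
    · rw [Function.notMem_support.1 h, zero_smul]
  have h := LA.leibniz f f.contMDiff s t q
  have hz : LA.bracket s 0 = 0 := by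
    have := LA.bracket_smul 0 s 0
    simpa using this
  rw [h0, hz, f.eq_one, one_smul, show t q = 0 from ht.self_of_nhds, smul_zero, add_zero] at h
  exact h.symm

theorem bracket_congr {s s' t t' : Cₛ^∞⟮𝓡 n; F, E⟯} {q : Q} (hs : ∀ᶠ q' in 𝓝 q, s q' = s' q')
    (ht : ∀ᶠ q' in 𝓝 q, t q' = t' q') : LA.bracket s t q = LA.bracket s' t' q := by
  have key : ∀ {s t t' : Cₛ^∞⟮𝓡 n; F, E⟯}, (∀ᶠ q' in 𝓝 q, t q' = t' q') →
      LA.bracket s t q = LA.bracket s t' q := by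
    intro s t t' h
    have h1 := LA.bracket_add s t' (t - t')
    rw [add_sub_cancel] at h1
    have h2 := LA.bracket_eq_zero_right (s := s) (t := t - t') (q := q)
      (h.mono fun q' hq' => by simp [hq'])
    rw [h1, ContMDiffSection.coe_add, Pi.add_apply, h2, add_zero]
  rw [key ht, LA.bracket_antisymm s, LA.bracket_antisymm s', ContMDiffSection.coe_neg,
    ContMDiffSection.coe_neg, Pi.neg_apply, Pi.neg_apply, key hs]

theorem localBracket_eq {s t : ∀ q, E q} {S T : Cₛ^∞⟮𝓡 n; F, E⟯} {q : Q}
    (hS : ∀ᶠ q' in 𝓝 q, S q' = s q') (hT : ∀ᶠ q' in 𝓝 q, T q' = t q') :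
    LA.localBracket s t q = LA.bracket S T q := by
  have h : ∃ S T : Cₛ^∞⟮𝓡 n; F, E⟯,
    (∀ᶠ q' in 𝓝 q, S q' = s q') ∧ (∀ᶠ q' in 𝓝 q, T q' = t q') := ⟨S, T, hS, hT⟩
  rw [localBracket, dif_pos h]
  refine LA.bracket_congr ?_ ?_
  · filter_upwards [hS, h.choose_spec.choose_spec.1] with q' h1 h2 using h2.trans h1.symm
  · filter_upwards [hT, h.choose_spec.choose_spec.2] with q' h1 h2 using h2.trans h1.symm

theorem exists_section_eq {s : ∀ q, E q} {u : Set Q} (hu : IsOpen u) {q : Q} (hq : q ∈ u)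
    (hs : ContMDiffOn (𝓡 n) ((𝓡 n).prod 𝓘(ℝ, F)) ∞ (fun q => TotalSpace.mk' F q (s q)) u) :
    ∃ S : Cₛ^∞⟮𝓡 n; F, E⟯, ∀ᶠ q' in 𝓝 q, S q' = s q' := by
  have hu' := hu.mem_nhds hq
  obtain ⟨f, -, hf⟩ := (SmoothBumpFunction.nhds_basis_tsupport (I := 𝓡 n) q).mem_iff.1 hu'
  refine ⟨⟨_, f.contMDiff.contMDiffOn.smul_section_of_tsupport hu hf hs⟩, ?_⟩
  filter_upwards [f.eventuallyEq_one] with q' hq'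
  change f q' • s q' = s q'
  rw [hq', Pi.one_apply, one_smul]

/-- The derivative of a function along the vector field given by a section. -/
noncomputable def lieDeriv (s : ∀ q, E q) (f : Q → ℝ) (q : Q) : ℝ :=
  mvfderiv (𝓡 n) f q (LA.anchor q (s q))

theorem contMDiff_mvfderiv_anchor {f : Q → ℝ} (hf : ContMDiff (𝓡 n) 𝓘(ℝ, ℝ) ∞ f) :
    ContMDiff ((𝓡 n).prod 𝓘(ℝ, F)) 𝓘(ℝ, ℝ) ∞
      (fun v : TotalSpace F E => mvfderiv (𝓡 n) f v.1 (LA.anchor v.1 v.2)) := by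
  have h1 := (hf.contMDiff_tangentMap (m := ∞) le_rfl).comp LA.contMDiff_anchor
  exact (contMDiff_snd_tangentBundle_modelSpace ℝ 𝓘(ℝ, ℝ)).comp h1

theorem contMDiff_lieDeriv {f : Q → ℝ} (hf : ContMDiff (𝓡 n) 𝓘(ℝ, ℝ) ∞ f)
    (s : Cₛ^∞⟮𝓡 n; F, E⟯) : ContMDiff (𝓡 n) 𝓘(ℝ, ℝ) ∞ (LA.lieDeriv s f) :=
  (LA.contMDiff_mvfderiv_anchor hf).comp s.contMDiff


/-- The product `f s` of a smooth function and a smooth section. -/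
noncomputable def fsmul {f : Q → ℝ} (hf : ContMDiff (𝓡 n) 𝓘(ℝ, ℝ) ∞ f) (s : Cₛ^∞⟮𝓡 n; F, E⟯) :
    Cₛ^∞⟮𝓡 n; F, E⟯ :=
  ⟨f • (s : ∀ q, E q), hf.smul_section s.contMDiff⟩

theorem bracket_fsmul {f : Q → ℝ} (hf : ContMDiff (𝓡 n) 𝓘(ℝ, ℝ) ∞ f)
    (s t : Cₛ^∞⟮𝓡 n; F, E⟯) :
    LA.bracket s (fsmul hf t) =
      fsmul hf (LA.bracket s t) + fsmul (LA.contMDiff_lieDeriv hf s) t := by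
  ext q
  exact LA.leibniz f hf s t q

theorem lieDeriv_bracket_of_ne {f : Q → ℝ} (hf : ContMDiff (𝓡 n) 𝓘(ℝ, ℝ) ∞ f)
    (s t u : Cₛ^∞⟮𝓡 n; F, E⟯) {q : Q} (hu : u q ≠ 0) :
    LA.lieDeriv (LA.bracket s t) f q =
      LA.lieDeriv s (LA.lieDeriv t f) q - LA.lieDeriv t (LA.lieDeriv s f) q := by
  have h := LA.jacobi s t (fsmul hf u)
  have hj := LA.jacobi s t u
  simp only [bracket_fsmul, LA.bracket_add] at h
  have h := congrArg (fun S : Cₛ^∞⟮𝓡 n; F, E⟯ => S q) h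
  have hj := congrArg (fun S : Cₛ^∞⟮𝓡 n; F, E⟯ => S q) hj
  simp only [ContMDiffSection.coe_add, Pi.add_apply] at h hj
  simp only [fsmul, ContMDiffSection.coeFn_mk, Pi.smul_apply', hj, smul_add] at h
  have h2 : (LA.lieDeriv (LA.bracket s t) f q - (LA.lieDeriv s (LA.lieDeriv t f) q -
      LA.lieDeriv t (LA.lieDeriv s f) q)) • u q = 0 := by
    rw [← sub_eq_zero] at h
    rw [← neg_eq_zero, ← h]
    module
  exact sub_eq_zero.1 ((smul_eq_zero.1 h2).resolve_right hu)

/-- The anchor is compatible with brackets. -/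
theorem lieDeriv_bracket {f : Q → ℝ} (hf : ContMDiff (𝓡 n) 𝓘(ℝ, ℝ) ∞ f)
    (s t : Cₛ^∞⟮𝓡 n; F, E⟯) {q : Q}
    (ht : t q = 0 → ∀ᶠ q' in 𝓝 q, t q' = 0) :
    LA.lieDeriv (LA.bracket s t) f q =
      LA.lieDeriv s (LA.lieDeriv t f) q - LA.lieDeriv t (LA.lieDeriv s f) q := by
  by_cases h1 : s q = 0
  · by_cases h2 : t q = 0
    · have : LA.bracket s t q = 0 := LA.bracket_eq_zero_right (ht h2)
      simp [lieDeriv, this, h1, h2]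
    · exact LA.lieDeriv_bracket_of_ne hf s t t h2
  · exact LA.lieDeriv_bracket_of_ne hf s t s h1

end Locality

section Prolongation

variable {BP : Type*} [NormedAddCommGroup BP] [NormedSpace ℝ BP]
    {HP : Type*} [TopologicalSpace HP] (IP : ModelWithCorners ℝ BP HP)
    {P : Type*} [TopologicalSpace P] [ChartedSpace HP P] [IsManifold IP ∞ P]
    (pr : P → Q)

/-- The fibre at `p` of the prolongation of the Lie algebroid `E` over `pr : P → Q`:
the pairs `(a, v) ∈ E_{pr(p)} × T_p P` with `ρ(a) = Tpr(v)`. -/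
noncomputable def Prolongation (p : P) : Submodule ℝ (E (pr p) × TangentSpace IP p) :=
  LinearMap.eqLocus
    ((LA.anchor (pr p)).toLinearMap ∘ₗ LinearMap.fst ℝ (E (pr p)) (TangentSpace IP p))
    ((mfderiv IP (𝓡 n) pr p).toLinearMap ∘ₗ LinearMap.snd ℝ (E (pr p)) (TangentSpace IP p))

/-- Smooth sections of the prolongation of `E` over `pr : P → Q`. -/
structure ProlongationSection where
  toFun : ∀ p, LA.Prolongation IP pr p
  contMDiff_fst : ContMDiff IP ((𝓡 n).prod 𝓘(ℝ, F)) ∞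
    (fun p => (⟨pr p, (toFun p).1.1⟩ : TotalSpace F E))
  contMDiff_snd : ContMDiff IP IP.tangent ∞
    (fun p => (⟨p, (toFun p).1.2⟩ : TangentBundle IP P))

variable {IP pr} {LA}

namespace ProlongationSection

/-- The first component of a section, a section of `E` along `pr`. -/
def fst (ξ : LA.ProlongationSection IP pr) (p : P) : E (pr p) := (ξ.toFun p).1.1

/-- The anchor `ρ^pr(ξ)` of a section, a vector field on `P`. -/
def snd (ξ : LA.ProlongationSection IP pr) (p : P) : TangentSpace IP p := (ξ.toFun p).1.2

theorem anchor_fst (ξ : LA.ProlongationSection IP pr) (p : P) :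
    LA.anchor (pr p) (ξ.fst p) = mfderiv IP (𝓡 n) pr p (ξ.snd p) := (ξ.toFun p).2

/-- The components near `p` of `ξ.fst` in the trivialization of `E` at `pr p`. -/
noncomputable def coord (ξ : LA.ProlongationSection IP pr) (p p' : P) : F :=
  (trivializationAt F E (pr p) ⟨pr p', ξ.fst p'⟩).2

end ProlongationSection

/-- The section of `E` near `q` which has constant component `x` in the trivialization at `q`. -/
noncomputable def constSection (E : Q → Type*) [TopologicalSpace (TotalSpace F E)]
    [∀ q, AddCommGroup (E q)] [∀ q, Module ℝ (E q)] [∀ q, TopologicalSpace (E q)]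
    [FiberBundle F E] [VectorBundle ℝ F E] (q : Q) (x : F) (q' : Q) : E q' :=
  (trivializationAt F E q).symmL ℝ q' x

/-- The `E`-component at `p` of the bracket of two sections `ξ`, `η` of the prolongation. If
`ξ.fst = ∑ fᵃ (sₐ ∘ pr)` and `η.fst = ∑ gᵇ (s_b ∘ pr)` for a local frame `sₐ` of `E`, it is
`∑ fᵃ gᵇ ⟦sₐ, s_b⟧ + ∑ (ρ(ξ) gᵇ - ρ(η) fᵇ) s_b`; here with the frames of a trivialization. -/
noncomputable def bracketFst (ξ η : LA.ProlongationSection IP pr) (p : P) : E (pr p) :=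
  LA.localBracket (constSection E (pr p) (ξ.coord p p)) (constSection E (pr p) (η.coord p p)) (pr p) +
    (trivializationAt F E (pr p)).symmL ℝ (pr p)
      (mvfderiv IP (η.coord p) p (ξ.snd p) - mvfderiv IP (ξ.coord p) p (η.snd p))

section Mem

variable [T2Space Q] [ContMDiffVectorBundle ∞ F E (𝓡 n)]

theorem contMDiffOn_constSection (q : Q) (x : F) :
    ContMDiffOn (𝓡 n) ((𝓡 n).prod 𝓘(ℝ, F)) ∞
      (fun q' => TotalSpace.mk' F q' (constSection E q x q')) (trivializationAt F E q).baseSet := by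
  rw [(trivializationAt F E q).contMDiffOn_section_baseSet_iff]
  refine (contMDiffOn_const (c := x)).congr fun q' hq' => ?_
  simp [constSection, hq', Trivialization.symmL_apply]

variable [CompleteSpace BP]

theorem contMDiff_mvfderiv {Y : ∀ p : P, TangentSpace IP p}
    (hY : ContMDiff IP IP.tangent ∞ (fun p => (⟨p, Y p⟩ : TangentBundle IP P)))
    {f : P → ℝ} (hf : ContMDiff IP 𝓘(ℝ, ℝ) ∞ f) :
    ContMDiff IP 𝓘(ℝ, ℝ) ∞ (fun p => mvfderiv IP f p (Y p)) :=
  (contMDiff_snd_tangentBundle_modelSpace ℝ 𝓘(ℝ, ℝ)).comp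
    ((hf.contMDiff_tangentMap (m := ∞) le_rfl).comp hY)

theorem mlieBracket_leibniz {X U : ∀ p : P, TangentSpace IP p}
    (hU : ContMDiff IP IP.tangent ∞ (fun p => (⟨p, U p⟩ : TangentBundle IP P)))
    {f : P → ℝ} (hf : ContMDiff IP 𝓘(ℝ, ℝ) ∞ f) :
    VectorField.mlieBracket IP X (f • U) =
      (fun p => mvfderiv IP f p (X p)) • U + f • VectorField.mlieBracket IP X U := by
  have : IsManifold IP (minSmoothness ℝ 2) P := by
    rw [minSmoothness_of_isRCLikeNormedField]; infer_instance
  funext p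
  exact VectorField.mlieBracket_smul_right ((hf p).mdifferentiableAt (by simp))
    ((hU p).mdifferentiableAt (by simp))

theorem contMDiff_mlieBracket {X Y : ∀ p : P, TangentSpace IP p}
    (hX : ContMDiff IP IP.tangent ∞ (fun p => (⟨p, X p⟩ : TangentBundle IP P)))
    (hY : ContMDiff IP IP.tangent ∞ (fun p => (⟨p, Y p⟩ : TangentBundle IP P))) :
    ContMDiff IP IP.tangent ∞
      (fun p => (⟨p, VectorField.mlieBracket IP X Y p⟩ : TangentBundle IP P)) := by
  intro p
  have : IsManifold IP (((⊤ : ℕ∞) : ℕ∞ω) + 1) P := ‹IsManifold IP ∞ P›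
  have : IsManifold IP (minSmoothness ℝ 3) P := by
    rw [minSmoothness_of_isRCLikeNormedField]; infer_instance
  exact ContMDiffAt.mlieBracket_vectorField (m := ⊤) (n := ⊤) (hX p) (hY p)
    (by simp [minSmoothness_of_isRCLikeNormedField])

theorem mvfderiv_mlieBracket_of_ne {X Y U : ∀ p : P, TangentSpace IP p}
    (hX : ContMDiff IP IP.tangent ∞ (fun p => (⟨p, X p⟩ : TangentBundle IP P)))
    (hY : ContMDiff IP IP.tangent ∞ (fun p => (⟨p, Y p⟩ : TangentBundle IP P)))
    (hU : ContMDiff IP IP.tangent ∞ (fun p => (⟨p, U p⟩ : TangentBundle IP P)))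
    {f : P → ℝ} (hf : ContMDiff IP 𝓘(ℝ, ℝ) ∞ f) {p : P} (hp : U p ≠ 0) :
    mvfderiv IP f p (VectorField.mlieBracket IP X Y p) =
      mvfderiv IP (fun p' => mvfderiv IP f p' (Y p')) p (X p) -
      mvfderiv IP (fun p' => mvfderiv IP f p' (X p')) p (Y p) := by
  have : IsManifold IP (minSmoothness ℝ 2) P := by
    rw [minSmoothness_of_isRCLikeNormedField]; infer_instance
  have : IsManifold IP (minSmoothness ℝ 3) P := by
    rw [minSmoothness_of_isRCLikeNormedField]; infer_instance
  have h2 : minSmoothness ℝ 2 ≤ ∞ := by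
    rw [minSmoothness_of_isRCLikeNormedField]; exact ENat.LEInfty.out
  have hfU : ContMDiff IP IP.tangent ∞ (fun p => (⟨p, (f • U) p⟩ : TangentBundle IP P)) :=
    hf.smul_section hU
  have hj := VectorField.leibniz_identity_mlieBracket (hX.of_le h2) (hY.of_le h2) (hU.of_le h2)
  have h := VectorField.leibniz_identity_mlieBracket (hX.of_le h2) (hY.of_le h2) (hfU.of_le h2)
  have key : ∀ {V W : ∀ p : P, TangentSpace IP p},
      ContMDiff IP IP.tangent ∞ (fun p => (⟨p, V p⟩ : TangentBundle IP P)) →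
      ContMDiff IP IP.tangent ∞ (fun p => (⟨p, W p⟩ : TangentBundle IP P)) →
      VectorField.mlieBracket IP V (VectorField.mlieBracket IP W (f • U)) =
        ((fun p => mvfderiv IP (fun p' => mvfderiv IP f p' (W p')) p (V p)) • U +
        (fun p => mvfderiv IP f p (W p)) • VectorField.mlieBracket IP V U) +
        ((fun p => mvfderiv IP f p (V p)) • VectorField.mlieBracket IP W U +
        f • VectorField.mlieBracket IP V (VectorField.mlieBracket IP W U)) := by
    intro V W hV hW
    have hWf := contMDiff_mvfderiv hW hf
    have hWU := contMDiff_mlieBracket hW hU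
    rw [mlieBracket_leibniz hU hf, ← mlieBracket_leibniz hU hWf, ← mlieBracket_leibniz hWU hf]
    funext p
    exact VectorField.mlieBracket_add_right
      (((hWf.smul_section hU) p).mdifferentiableAt (by simp))
      (((hf.smul_section hWU) p).mdifferentiableAt (by simp))
  rw [key hX hY, key hY hX, mlieBracket_leibniz hU hf] at h
  have h := congrFun h p
  have hj := congrFun hj p
  simp only [Pi.add_apply, Pi.smul_apply'] at h hj
  rw [hj, smul_add] at h
  have h2 : (mvfderiv IP f p (VectorField.mlieBracket IP X Y p) -
      (mvfderiv IP (fun p' => mvfderiv IP f p' (Y p')) p (X p) -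
      mvfderiv IP (fun p' => mvfderiv IP f p' (X p')) p (Y p))) • U p = 0 := by
    rw [← sub_eq_zero] at h
    rw [← neg_eq_zero, ← h]
    module
  exact sub_eq_zero.1 ((smul_eq_zero.1 h2).resolve_right hp)

/-- `[X, Y] f = X (Y f) - Y (X f)`. -/
theorem mvfderiv_mlieBracket {X Y : ∀ p : P, TangentSpace IP p}
    (hX : ContMDiff IP IP.tangent ∞ (fun p => (⟨p, X p⟩ : TangentBundle IP P)))
    (hY : ContMDiff IP IP.tangent ∞ (fun p => (⟨p, Y p⟩ : TangentBundle IP P)))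
    {f : P → ℝ} (hf : ContMDiff IP 𝓘(ℝ, ℝ) ∞ f) (p : P) :
    mvfderiv IP f p (VectorField.mlieBracket IP X Y p) =
      mvfderiv IP (fun p' => mvfderiv IP f p' (Y p')) p (X p) -
      mvfderiv IP (fun p' => mvfderiv IP f p' (X p')) p (Y p) := by
  by_cases h1 : X p = 0
  · by_cases h2 : Y p = 0
    · have : VectorField.mlieBracket IP X Y p = 0 := by
        rw [← VectorField.mlieBracketWithin_univ]
        exact VectorField.mlieBracketWithin_eq_zero_of_eq_zero h1 h2
      simp [this, h1, h2]
    · exact mvfderiv_mlieBracket_of_ne hX hY hY hf h2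
  · exact mvfderiv_mlieBracket_of_ne hX hY hX hf h1


/-- Derivative at `p`, in the direction `v`, of `p' ↦ ρ(η p') f`. -/
theorem mvfderiv_fst (hpr : ContMDiff IP (𝓡 n) ∞ pr) (η : LA.ProlongationSection IP pr)
    {f : Q → ℝ} (hf : ContMDiff (𝓡 n) 𝓘(ℝ, ℝ) ∞ f) (p : P) (v : TangentSpace IP p) :
    mvfderiv IP (fun p' => mvfderiv (𝓡 n) f (pr p') (LA.anchor (pr p') (η.fst p'))) p v =
      mvfderiv (𝓡 n) (LA.lieDeriv (constSection E (pr p) (η.coord p p)) f) (pr p)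
        (mfderiv IP (𝓡 n) pr p v) +
      mvfderiv (𝓡 n) f (pr p) (LA.anchor (pr p)
        ((trivializationAt F E (pr p)).symmL ℝ (pr p) (mvfderiv IP (η.coord p) p v))) := by
  set e := trivializationAt F E (pr p) with he
  have hq : pr p ∈ e.baseSet := mem_baseSet_trivializationAt F E (pr p)
  let h : Q × F → ℝ := fun z => mvfderiv (𝓡 n) f z.1 (LA.anchor z.1 (e.symmL ℝ z.1 z.2))
  let g : P → Q × F := fun p' => (pr p', η.coord p p')
  have hcoord : MDifferentiableAt IP 𝓘(ℝ, F) (η.coord p) p := by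
    have h1 : ContMDiffAt ((𝓡 n).prod 𝓘(ℝ, F)) ((𝓡 n).prod 𝓘(ℝ, F)) ∞ e
        (⟨pr p, η.fst p⟩ : TotalSpace F E) :=
      e.contMDiffOn.contMDiffAt (e.open_source.mem_nhds (e.mem_source.2 hq))
    have h2 := h1.comp p η.contMDiff_fst.contMDiffAt
    exact (contMDiffAt_snd.comp p h2).mdifferentiableAt (by simp)
  have hh : MDifferentiableAt ((𝓡 n).prod 𝓘(ℝ, F)) 𝓘(ℝ, ℝ) h (g p) := by
    have hm : (g p) ∈ e.target := e.mem_target.2 hq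
    have h1 := (e.contMDiffOn_symm (IB := 𝓡 n) (n := ∞)).contMDiffAt (e.open_target.mem_nhds hm)
    have h2 := (LA.contMDiff_mvfderiv_anchor hf).contMDiffAt.comp (g p) h1
    refine (h2.congr_of_eventuallyEq ?_).mdifferentiableAt (by simp)
    filter_upwards [e.open_target.mem_nhds hm] with z hz
    have hz1 : z.1 ∈ e.baseSet := e.mem_target.1 hz
    have : e.toOpenPartialHomeomorph.symm z =
        (⟨z.1, e.symmL ℝ z.1 z.2⟩ : TotalSpace F E) := by
      rw [e.symmL_apply hz1]
      exact (e.mk_symm hz1 z.2).symm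
    exact (congrArg (fun v : TotalSpace F E =>
      mvfderiv (𝓡 n) f v.1 (LA.anchor v.1 v.2)) this).symm
  have hg : MDifferentiableAt IP ((𝓡 n).prod 𝓘(ℝ, F)) g p :=
    ((hpr p).mdifferentiableAt (by simp)).prodMk hcoord
  have hev : (fun p' => mvfderiv (𝓡 n) f (pr p') (LA.anchor (pr p') (η.fst p'))) =ᶠ[𝓝 p]
      h ∘ g := by
    filter_upwards [hpr.continuous.continuousAt.preimage_mem_nhds
      (e.open_baseSet.mem_nhds hq)] with p' hp'
    have hp' : pr p' ∈ e.baseSet := hp'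
    simp only [Function.comp_apply, h, g, ProlongationSection.coord, ← he]
    rw [e.symmL_apply hp', e.symm_apply_apply_mk hp']
  have h1 : mfderiv IP 𝓘(ℝ, ℝ)
      (fun p' => mvfderiv (𝓡 n) f (pr p') (LA.anchor (pr p') (η.fst p'))) p v =
      mfderiv ((𝓡 n).prod 𝓘(ℝ, F)) 𝓘(ℝ, ℝ) h (g p)
        (mfderiv IP ((𝓡 n).prod 𝓘(ℝ, F)) g p v) := by
    rw [hev.mfderiv_eq, mfderiv_comp p hh hg]
    rfl
  have h3 : mfderiv IP ((𝓡 n).prod 𝓘(ℝ, F)) g p =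
      (mfderiv IP (𝓡 n) pr p).prod (mfderiv IP 𝓘(ℝ, F) (η.coord p) p) :=
    ((hpr p).mdifferentiableAt (by simp)).mfderiv_prod hcoord
  have h4 : mfderiv 𝓘(ℝ, F) 𝓘(ℝ, ℝ) (fun z : F => h ((g p).1, z)) (g p).2 =
      ((mvfderiv (𝓡 n) f (pr p)).comp (LA.anchor (pr p))).comp (e.symmL ℝ (pr p)) := by
    rw [mfderiv_eq_fderiv]
    exact (((mvfderiv (𝓡 n) f (pr p)).comp (LA.anchor (pr p))).comp
      (e.symmL ℝ (pr p))).fderiv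
  have h2 := mfderiv_prod_eq_add_apply (v := mfderiv IP ((𝓡 n).prod 𝓘(ℝ, F)) g p v) hh
  rw [h4] at h2
  change mfderiv IP 𝓘(ℝ, ℝ)
      (fun p' => mvfderiv (𝓡 n) f (pr p') (LA.anchor (pr p') (η.fst p'))) p v = _
  rw [h1]
  refine h2.trans ?_
  rw [h3]
  rfl

/-- The bracket of two sections of the prolongation takes values in the prolongation. -/
theorem bracket_mem (hpr : ContMDiff IP (𝓡 n) ∞ pr) (ξ η : LA.ProlongationSection IP pr) (p : P) :
    (bracketFst ξ η p, VectorField.mlieBracket IP ξ.snd η.snd p) ∈ LA.Prolongation IP pr p := by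
  set q := pr p with hq
  set e := trivializationAt F E q with he
  have hqe : q ∈ e.baseSet := mem_baseSet_trivializationAt F E q
  obtain ⟨S, hS⟩ := exists_section_eq (E := E) e.open_baseSet hqe
    (contMDiffOn_constSection (n := n) q (ξ.coord p p))
  obtain ⟨T, hT⟩ := exists_section_eq (E := E) e.open_baseSet hqe
    (contMDiffOn_constSection (n := n) q (η.coord p p))
  have hSq : S q = ξ.fst p := by
    rw [hS.self_of_nhds]
    simp only [constSection, ProlongationSection.coord, ← he, ← hq]
    rw [e.symmL_apply hqe, e.symm_apply_apply_mk hqe]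
  have hTq : T q = η.fst p := by
    rw [hT.self_of_nhds]
    simp only [constSection, ProlongationSection.coord, ← he, ← hq]
    rw [e.symmL_apply hqe, e.symm_apply_apply_mk hqe]
  have hT0 : T q = 0 → ∀ᶠ q' in 𝓝 q, T q' = 0 := by
    intro h0
    have h1 : η.coord p p = 0 := by
      have : η.coord p p = e.continuousLinearMapAt ℝ q (η.fst p) := by
        rw [e.continuousLinearMapAt_apply (R := ℝ), e.linearMapAt_apply, if_pos hqe]
        rfl
      rw [this, ← hTq, h0, map_zero]
    filter_upwards [hT] with q' hq'
    rw [hq', h1, constSection, map_zero]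
  -- both sides act in the same way on functions
  have key : ∀ f : Q → ℝ, ContMDiff (𝓡 n) 𝓘(ℝ, ℝ) ∞ f →
      mvfderiv (𝓡 n) f q (LA.anchor q (bracketFst ξ η p)) =
      mvfderiv (𝓡 n) f q (mfderiv IP (𝓡 n) pr p (VectorField.mlieBracket IP ξ.snd η.snd p)) := by
    intro f hf
    have hfp : ContMDiff IP 𝓘(ℝ, ℝ) ∞ (f ∘ pr) := hf.comp hpr
    have hchain : ∀ (p' : P) (v : TangentSpace IP p'),
        mvfderiv IP (f ∘ pr) p' v = mvfderiv (𝓡 n) f (pr p') (mfderiv IP (𝓡 n) pr p' v) := by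
      intro p' v
      change mfderiv IP 𝓘(ℝ, ℝ) (f ∘ pr) p' v = _
      rw [mfderiv_comp p' ((hf _).mdifferentiableAt (by simp))
        ((hpr p').mdifferentiableAt (by simp))]
      rfl
    rw [← hchain, mvfderiv_mlieBracket (X := ξ.snd) (Y := η.snd)
      ξ.contMDiff_snd η.contMDiff_snd hfp]
    simp only [hchain]
    have hξ : ∀ p', mfderiv IP (𝓡 n) pr p' (ξ.snd p') = LA.anchor (pr p') (ξ.fst p') :=
      fun p' => (ξ.anchor_fst p').symm
    have hη : ∀ p', mfderiv IP (𝓡 n) pr p' (η.snd p') = LA.anchor (pr p') (η.fst p') :=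
      fun p' => (η.anchor_fst p').symm
    have e1 : (fun p' => mvfderiv (𝓡 n) f (pr p') (mfderiv IP (𝓡 n) pr p' (η.snd p'))) =
        fun p' => mvfderiv (𝓡 n) f (pr p') (LA.anchor (pr p') (η.fst p')) :=
      funext fun p' => by rw [hη]
    have e2 : (fun p' => mvfderiv (𝓡 n) f (pr p') (mfderiv IP (𝓡 n) pr p' (ξ.snd p'))) =
        fun p' => mvfderiv (𝓡 n) f (pr p') (LA.anchor (pr p') (ξ.fst p')) :=
      funext fun p' => by rw [hξ]
    have hb := LA.lieDeriv_bracket hf S T hT0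
    have hcongr : ∀ {s s' : ∀ q, E q}, (∀ᶠ q' in 𝓝 q, s q' = s' q') →
        mvfderiv (𝓡 n) (LA.lieDeriv s' f) q = mvfderiv (𝓡 n) (LA.lieDeriv s f) q := by
      intro s s' h
      have : LA.lieDeriv s' f =ᶠ[𝓝 q] LA.lieDeriv s f := by
        filter_upwards [h] with q' hq'
        simp only [lieDeriv, hq']
      simp only [mvfderiv, this.mfderiv_eq]
      rw [this.self_of_nhds]
    rw [e1, e2, mvfderiv_fst hpr η hf p, mvfderiv_fst hpr ξ hf p, hξ, hη]
    have hcS : mvfderiv (𝓡 n) (LA.lieDeriv (constSection E (pr p) (ξ.coord p p)) f) (pr p) =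
        mvfderiv (𝓡 n) (LA.lieDeriv S f) (pr p) := hcongr hS
    have hcT : mvfderiv (𝓡 n) (LA.lieDeriv (constSection E (pr p) (η.coord p p)) f) (pr p) =
        mvfderiv (𝓡 n) (LA.lieDeriv T f) (pr p) := hcongr hT
    rw [hcS, hcT]
    have hbr : bracketFst ξ η p = LA.bracket S T q + e.symmL ℝ q
        (mvfderiv IP (η.coord p) p (ξ.snd p) - mvfderiv IP (ξ.coord p) p (η.snd p)) := by
      rw [bracketFst, LA.localBracket_eq hS hT]
    rw [hbr, map_add, map_add, map_sub, map_sub, map_sub]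
    change LA.lieDeriv (LA.bracket S T) f q + _ = _
    rw [hb]
    simp only [lieDeriv, hSq, hTq, ← hq]
    ring
  -- functions separate tangent vectors
  obtain ⟨b⟩ : Nonempty (SmoothBumpFunction (𝓡 n) q) := inferInstance
  change LA.anchor q (bracketFst ξ η p) =
    mfderiv IP (𝓡 n) pr p (VectorField.mlieBracket IP ξ.snd η.snd p)
  have hinv := isInvertible_mfderiv_extChartAt (I := 𝓡 n) (mem_extChartAt_source (I := 𝓡 n) q)
  have hinj : Function.Injective (mfderiv (𝓡 n) 𝓘(ℝ, EuclideanSpace ℝ (Fin n))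
      (extChartAt (𝓡 n) q) q) := by
    obtain ⟨M, hM⟩ := hinv
    rw [← hM]
    exact M.injective
  apply hinj
  have hsm : ContMDiff (𝓡 n) 𝓘(ℝ, EuclideanSpace ℝ (Fin n)) ∞
      (fun x => b x • extChartAt (𝓡 n) q x) := by
    refine b.contMDiff_smul ?_
    have := contMDiffOn_extChartAt (I := 𝓡 n) (x := q) (n := ∞)
    exact this
  have hloc : extChartAt (𝓡 n) q =ᶠ[𝓝 q] (fun x => b x • extChartAt (𝓡 n) q x) := by
    filter_upwards [b.eventuallyEq_one] with x hx
    rw [hx, Pi.one_apply, one_smul]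
  have hcomp : ∀ (i : Fin n) (w : TangentSpace (𝓡 n) q),
      (show EuclideanSpace ℝ (Fin n) from mfderiv (𝓡 n) 𝓘(ℝ, EuclideanSpace ℝ (Fin n))
        (extChartAt (𝓡 n) q) q w) i =
      mvfderiv (𝓡 n) (fun x => (b x • extChartAt (𝓡 n) q x) i) q w := by
    intro i w
    have h1 := (EuclideanSpace.proj i : EuclideanSpace ℝ (Fin n) →L[ℝ] ℝ).hasMFDerivAt.comp q
      ((hsm q).mdifferentiableAt (by simp)).hasMFDerivAt
    have h2 := h1.mfderiv
    rw [hloc.mfderiv_eq]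
    exact (congrArg (fun l : TangentSpace (𝓡 n) q →L[ℝ] ℝ => l w) h2).symm
  refine PiLp.ext fun i => ?_
  refine (hcomp i _).trans ((key _ ?_).trans (hcomp i _).symm)
  exact (EuclideanSpace.proj i : EuclideanSpace ℝ (Fin n) →L[ℝ] ℝ).contMDiff.comp hsm

end Mem
end Prolongation
end LieAlgebroid

/-! ### Differential forms and morphisms of Lie algebroids -/

namespace LieAlgebroid

section Forms

variable {n : ℕ} {Q : Type*} [TopologicalSpace Q]
    [ChartedSpace (EuclideanSpace ℝ (Fin n)) Q] [IsManifold (𝓡 n) ∞ Q]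
    {F : Type*} [NormedAddCommGroup F] [NormedSpace ℝ F]
    {E : Q → Type*} [TopologicalSpace (TotalSpace F E)]
    [∀ q, AddCommGroup (E q)] [∀ q, Module ℝ (E q)] [∀ q, TopologicalSpace (E q)]
    [FiberBundle F E] [VectorBundle ℝ F E]

/-- A family `w` of alternating `l`-forms on the fibres of `E` is a smooth section of `⋀ˡ E*`:
its values on smooth sections are smooth functions. -/
def IsSmoothForm (n : ℕ) {Q : Type*} [TopologicalSpace Q]
    [ChartedSpace (EuclideanSpace ℝ (Fin n)) Q]
    (F : Type*) [NormedAddCommGroup F] [NormedSpace ℝ F]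
    {E : Q → Type*} [TopologicalSpace (TotalSpace F E)]
    [∀ q, AddCommGroup (E q)] [∀ q, Module ℝ (E q)] [∀ q, TopologicalSpace (E q)]
    [FiberBundle F E] {l : ℕ} (w : ∀ q, (E q) [⋀^Fin l]→ₗ[ℝ] ℝ) : Prop :=
  ∀ σ : Fin l → Cₛ^∞⟮𝓡 n; F, E⟯, ContMDiff (𝓡 n) 𝓘(ℝ, ℝ) ∞ (fun q => w q (fun i => σ i q))

/-- The exterior derivative `(dw)(σ₀, …, σ_l)` of an `l`-form `w` on a Lie algebroid, evaluated on
sections, at the point `q`: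
`∑ᵢ (-1)ⁱ ρ(σᵢ)(w(…, σ̂ᵢ, …)) + ∑_{i<j} (-1)ⁱ⁺ʲ w(⟦σᵢ, σⱼ⟧, …, σ̂ᵢ, …, σ̂ⱼ, …)`.
In the second sum `j = i.succAbove j'`. -/
noncomputable def extDeriv (LA : LieAlgebroid (n := n) Q F E) :
    ∀ {l : ℕ}, (∀ q, (E q) [⋀^Fin l]→ₗ[ℝ] ℝ) → (Fin (l + 1) → Cₛ^∞⟮𝓡 n; F, E⟯) → Q → ℝ
  | 0, w, σ, q => LA.lieDeriv (σ 0) (fun q' => w q' ![]) q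
  | l + 1, w, σ, q =>
    ∑ i : Fin (l + 2), (-1) ^ (i : ℕ) *
        LA.lieDeriv (σ i) (fun q' => w q' (fun j => σ (i.succAbove j) q')) q +
      ∑ i : Fin (l + 2), ∑ j' : Fin (l + 1),
        if i < i.succAbove j' then
          (-1) ^ ((i : ℕ) + (i.succAbove j' : ℕ)) *
            w q (Matrix.vecCons (LA.bracket (σ i) (σ (i.succAbove j')) q)
              (fun m : Fin l => σ (i.succAbove (j'.succAbove m)) q))
        else 0

variable {n' : ℕ} {Q' : Type*} [TopologicalSpace Q']
    [ChartedSpace (EuclideanSpace ℝ (Fin n')) Q'] [IsManifold (𝓡 n') ∞ Q']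
    {F' : Type*} [NormedAddCommGroup F'] [NormedSpace ℝ F']
    {E' : Q' → Type*} [TopologicalSpace (TotalSpace F' E')]
    [∀ q, AddCommGroup (E' q)] [∀ q, Module ℝ (E' q)] [∀ q, TopologicalSpace (E' q)]
    [FiberBundle F' E'] [VectorBundle ℝ F' E']

/-- A smooth vector bundle map `Φ : E → E'` over `φ : Q → Q'` is a morphism of Lie algebroids if
`d(Φ^* w) = Φ^*(d' w)` for all forms `w` of all degrees on `E'`. The value of `Φ^*(d' w)` at `q` on
the vectors `σᵢ(q)` is computed with sections `σ'ᵢ` of `E'` that extend the vectors `Φ(σᵢ(q))`. -/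
structure IsMorphism (LA : LieAlgebroid (n := n) Q F E) (LA' : LieAlgebroid (n := n') Q' F' E')
    (φ : Q → Q') (Φ : ∀ q, E q →ₗ[ℝ] E' (φ q)) : Prop where
  contMDiff : ContMDiff ((𝓡 n).prod 𝓘(ℝ, F)) ((𝓡 n').prod 𝓘(ℝ, F')) ∞
    (fun v : TotalSpace F E => (⟨φ v.1, Φ v.1 v.2⟩ : TotalSpace F' E'))
  extDeriv_pullback : ∀ (l : ℕ) (w : ∀ q', (E' q') [⋀^Fin l]→ₗ[ℝ] ℝ), IsSmoothForm n' F' w →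
    ∀ (q : Q) (σ : Fin (l + 1) → Cₛ^∞⟮𝓡 n; F, E⟯) (σ' : Fin (l + 1) → Cₛ^∞⟮𝓡 n'; F', E'⟯),
      (∀ i, σ' i (φ q) = Φ q (σ i q)) →
      LA.extDeriv (fun q => (w (φ q)).compLinearMap (Φ q)) σ q = LA'.extDeriv w σ' (φ q)

end Forms

/-! ### Calculus on the prolongation -/

section ProlongationCalculus

variable {n : ℕ} {Q : Type*} [TopologicalSpace Q] [T2Space Q]
    [ChartedSpace (EuclideanSpace ℝ (Fin n)) Q] [IsManifold (𝓡 n) ∞ Q]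
    {F : Type*} [NormedAddCommGroup F] [NormedSpace ℝ F]
    {E : Q → Type*} [TopologicalSpace (TotalSpace F E)]
    [∀ q, AddCommGroup (E q)] [∀ q, Module ℝ (E q)] [∀ q, TopologicalSpace (E q)]
    [FiberBundle F E] [VectorBundle ℝ F E] [ContMDiffVectorBundle ∞ F E (𝓡 n)]
    {LA : LieAlgebroid (n := n) Q F E}
    {BP : Type*} [NormedAddCommGroup BP] [NormedSpace ℝ BP] [CompleteSpace BP]
    {HP : Type*} [TopologicalSpace HP] {IP : ModelWithCorners ℝ BP HP}
    {P : Type*} [TopologicalSpace P] [ChartedSpace HP P] [IsManifold IP ∞ P]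
    {pr : P → Q}

/-- The bracket `⟦ξ, η⟧` of two sections of the prolongation, at the point `p`. -/
noncomputable def prolBracket (hpr : ContMDiff IP (𝓡 n) ∞ pr) (ξ η : LA.ProlongationSection IP pr)
    (p : P) : LA.Prolongation IP pr p :=
  ⟨(bracketFst ξ η p, VectorField.mlieBracket IP ξ.snd η.snd p), bracket_mem hpr ξ η p⟩

/-- The differential of a function on `P` as a `1`-section of the dual of the prolongation:
`(df)_p (a, v) = v(f)`. -/
noncomputable def prolD (f : P → ℝ) {p : P} (x : LA.Prolongation IP pr p) : ℝ :=
  mvfderiv IP f p x.1.2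

/-- The exterior differential of a `1`-section of the dual of the prolongation:
`(dθ)(ξ, η) = ρ(ξ)(θ(η)) - ρ(η)(θ(ξ)) - θ(⟦ξ, η⟧)`. -/
noncomputable def prolD₁ (hpr : ContMDiff IP (𝓡 n) ∞ pr) (θ : ∀ p, LA.Prolongation IP pr p → ℝ)
    (ξ η : LA.ProlongationSection IP pr) (p : P) : ℝ :=
  prolD (fun p' => θ p' (η.toFun p')) (ξ.toFun p) -
    prolD (fun p' => θ p' (ξ.toFun p')) (η.toFun p) - θ p (prolBracket hpr ξ η p)

end ProlongationCalculus

end LieAlgebroid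

/-! ### The phase space -/

/-- The phase space `ℝᵏ × (E ⊕ ⋯ ⊕ E)`; its points are `(t; q; e₁, …, e_k)` with `e_A ∈ E_q`. -/
abbrev PhaseSpace (k : ℕ) (F : Type*) {Q : Type*} (E : Q → Type*) : Type _ :=
  EuclideanSpace ℝ (Fin k) × TotalSpace (Fin k → F) (WhitneySum k E)

/-- The model with corners of the phase space. -/
noncomputable abbrev phaseModel (k n : ℕ) (F : Type*) [NormedAddCommGroup F] [NormedSpace ℝ F] :
    ModelWithCorners ℝ
      (EuclideanSpace ℝ (Fin k) × (EuclideanSpace ℝ (Fin n) × (Fin k → F)))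
      (ModelProd (EuclideanSpace ℝ (Fin k)) (ModelProd (EuclideanSpace ℝ (Fin n)) (Fin k → F))) :=
  (𝓡 k).prod ((𝓡 n).prod 𝓘(ℝ, Fin k → F))

namespace PhaseSpace

section Basic

variable {k : ℕ} {F : Type*} {Q : Type*} {E : Q → Type*}

/-- The projection `(t; q; e₁, …, e_k) ↦ q`. -/
def proj (p : PhaseSpace k F E) : Q := p.2.1

/-- The element `e_A` of `E` at the point `(t; q; e₁, …, e_k)`. -/
def comp (p : PhaseSpace k F E) (A : Fin k) : E p.proj := p.2.2 A

/-- The point `(t; q; e₁, …, e_k)`. -/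
def point (t : EuclideanSpace ℝ (Fin k)) (q : Q) (e : Fin k → E q) : PhaseSpace k F E := (t, ⟨q, e⟩)

/-- The point `(t; q; e₁, …, e_A + s a, …, e_k)`, where `p = (t; q; e₁, …, e_k)`. -/
def vshift [∀ q, AddCommGroup (E q)] [∀ q, Module ℝ (E q)] (p : PhaseSpace k F E) (A : Fin k)
    (a : E p.proj) (s : ℝ) : PhaseSpace k F E :=
  point p.1 p.proj (fun B => if B = A then p.comp B + s • a else p.comp B)

theorem vshift_zero [∀ q, AddCommGroup (E q)] [∀ q, Module ℝ (E q)] (p : PhaseSpace k F E)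
    (A : Fin k) (a : E p.proj) : p.vshift A a 0 = p := by
  simp only [vshift, zero_smul, add_zero, ite_self]
  rfl

/-- `∂L/∂t^A` (with fixed `(q; e₁, …, e_k)`). -/
noncomputable def derivT (L : PhaseSpace k F E → ℝ) (A : Fin k) (p : PhaseSpace k F E) : ℝ :=
  deriv (fun s : ℝ => L (point (p.1 + s • EuclideanSpace.single A 1) p.proj p.comp)) 0

/-- The derivative of `L` at `p = (t; q; e₁, …, e_k)` in the direction `a ∈ E_q` of the variable
`e_A`. For `a = e_α` in a local basis this is `∂L/∂y^α_A`. -/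
noncomputable def derivY [∀ q, AddCommGroup (E q)] [∀ q, Module ℝ (E q)]
    (L : PhaseSpace k F E → ℝ) (A : Fin k) (p : PhaseSpace k F E) (a : E p.proj) : ℝ :=
  deriv (fun s : ℝ => L (p.vshift A a s)) 0

/-- `L` is regular: in every basis of the fibre, the matrix `(∂²L/∂y^α_A∂y^β_B)` is non-singular at
every point. -/
def IsRegular [∀ q, AddCommGroup (E q)] [∀ q, Module ℝ (E q)]
    (L : PhaseSpace k F E → ℝ) : Prop :=
  ∀ (p : PhaseSpace k F E) (m : ℕ) (b : Module.Basis (Fin m) ℝ (E p.proj)),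
    (Matrix.of fun x y : Fin k × Fin m =>
      deriv (fun s : ℝ => derivY L y.1 (p.vshift x.1 (b x.2) s) (b y.2)) 0).det ≠ 0

end Basic

section Smooth

variable {n k : ℕ} {Q : Type*} [TopologicalSpace Q]
    [ChartedSpace (EuclideanSpace ℝ (Fin n)) Q] [IsManifold (𝓡 n) ∞ Q]
    {F : Type*} [NormedAddCommGroup F] [NormedSpace ℝ F]
    {E : Q → Type*} [TopologicalSpace (TotalSpace F E)]
    [∀ q, AddCommGroup (E q)] [∀ q, Module ℝ (E q)] [∀ q, TopologicalSpace (E q)]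
    [FiberBundle F E] [VectorBundle ℝ F E]

theorem contMDiff_proj : ContMDiff (phaseModel k n F) (𝓡 n) ∞ (proj : PhaseSpace k F E → Q) :=
  ContMDiff.comp (Bundle.contMDiff_proj (WhitneySum k E)) contMDiff_snd

/-- The tangent vector `(a)^{v_A}` at `p = (t; q; e₁, …, e_k)`: the velocity at `s = 0` of the curve
`s ↦ (t; q; e₁, …, e_A + s a, …, e_k)`. -/
noncomputable def vliftVec (p : PhaseSpace k F E) (A : Fin k) (a : E p.proj) :
    TangentSpace (phaseModel k n F) p :=
  mfderiv 𝓘(ℝ, ℝ) (phaseModel k n F) (p.vshift A a) 0 (1 : ℝ)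

theorem mfderiv_proj_vliftVec (p : PhaseSpace k F E) (A : Fin k) (a : E p.proj) :
    mfderiv (phaseModel k n F) (𝓡 n) (proj : PhaseSpace k F E → Q) p (vliftVec p A a) = 0 := by
  by_cases h : MDifferentiableAt 𝓘(ℝ, ℝ) (phaseModel k n F) (p.vshift A a) 0
  · have h1 := mfderiv_comp (I'' := 𝓡 n) 0
      ((contMDiff_proj (k := k) (n := n) (F := F) (E := E) (p.vshift A a 0)).mdifferentiableAt
        (by simp)) h
    have h2 : (proj ∘ p.vshift A a : ℝ → Q) = fun _ => p.proj := rfl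
    rw [h2, mfderiv_const] at h1
    have h3 : ∀ p' : PhaseSpace k F E, p' = p → ∀ v,
        mfderiv (phaseModel k n F) (𝓡 n) (proj : PhaseSpace k F E → Q) p v =
        mfderiv (phaseModel k n F) (𝓡 n) (proj : PhaseSpace k F E → Q) p' v := by
      rintro _ rfl v
      rfl
    exact (h3 _ (vshift_zero p A a) _).trans (congrArg (fun l => l (1 : ℝ)) h1).symm
  · rw [vliftVec, mfderiv_zero_of_not_mdifferentiableAt h]
    exact map_zero _

end Smooth

end PhaseSpace

/-! ### The Lagrangian formalism -/

namespace LieAlgebroid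

open PhaseSpace

section Lagrangian

variable {n k : ℕ} {Q : Type*} [TopologicalSpace Q]
    [ChartedSpace (EuclideanSpace ℝ (Fin n)) Q] [IsManifold (𝓡 n) ∞ Q]
    {F : Type*} [NormedAddCommGroup F] [NormedSpace ℝ F]
    {E : Q → Type*} [TopologicalSpace (TotalSpace F E)]
    [∀ q, AddCommGroup (E q)] [∀ q, Module ℝ (E q)] [∀ q, TopologicalSpace (E q)]
    [FiberBundle F E] [VectorBundle ℝ F E] [ContMDiffVectorBundle ∞ F E (𝓡 n)]
    (LA : LieAlgebroid (n := n) Q F E)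

/-- The fibre at `p` of the Lagrangian prolongation `𝒯^E(ℝᵏ × (E ⊕ ⋯ ⊕ E))`. -/
noncomputable abbrev LagProlongation (p : PhaseSpace k F E) :
    Submodule ℝ (E p.proj × TangentSpace (phaseModel k n F) p) :=
  LA.Prolongation (phaseModel k n F) (proj : PhaseSpace k F E → Q) p

/-- The `A`th vertical lift `(0, (a)^{v_A})` of `a ∈ E_q` to `p = (t; q; e₁, …, e_k)`. -/
noncomputable def vlift (p : PhaseSpace k F E) (A : Fin k) (a : E p.proj) : LA.LagProlongation p :=
  ⟨(0, vliftVec p A a), ((LA.anchor p.proj).map_zero).trans (mfderiv_proj_vliftVec p A a).symm⟩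

/-- The `1`-sections `𝒴^B`: `𝒴^B(a, v) = v(t^B)`. -/
noncomputable def dt {LA : LieAlgebroid (n := n) Q F E} (B : Fin k) {p : PhaseSpace k F E}
    (x : LA.LagProlongation p) : ℝ :=
  prolD (fun p' : PhaseSpace k F E => p'.1 B) x

/-- The `A`th vertical endomorphism, `(a, v) ↦ (0, (a)^{v_A})`. -/
noncomputable def vertEndo (A : Fin k) {p : PhaseSpace k F E} (x : LA.LagProlongation p) :
    LA.LagProlongation p :=
  LA.vlift p A x.1.1

/-- The `A`th Liouville section, `(t; q; e₁, …, e_k) ↦ (0, (e_A)^{v_A})`. -/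
noncomputable def liouville (A : Fin k) (p : PhaseSpace k F E) : LA.LagProlongation p :=
  LA.vlift p A (p.comp A)

/-- The Poincaré-Cartan `1`-sections `Θ_L^A = dL ∘ S^A`. -/
noncomputable def theta (L : PhaseSpace k F E → ℝ) (A : Fin k) (p : PhaseSpace k F E)
    (x : LA.LagProlongation p) : ℝ :=
  prolD L (LA.vertEndo A x)

/-- The energy function `E_L = ∑_A ρ(Δ_A) L - L`. -/
noncomputable def energy (L : PhaseSpace k F E → ℝ) (p : PhaseSpace k F E) : ℝ :=
  ∑ A, prolD L (LA.liouville A p) - L p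

/-- Smooth sections of the Lagrangian prolongation. -/
abbrev LagSection (k : ℕ) : Type _ :=
  LA.ProlongationSection (phaseModel k n F) (proj : PhaseSpace k F E → Q)

/-- `ξ = (ξ₁, …, ξ_k)` is a second order partial differential equation. -/
def IsSOPDE (ξ : Fin k → LA.LagSection k) : Prop :=
  (∀ A p, LA.vertEndo A ((ξ A).toFun p) = LA.liouville A p) ∧
    ∀ A B p, dt B ((ξ A).toFun p) = if A = B then 1 else 0

/-- `η : ℝᵏ → ℝᵏ × (E ⊕ ⋯ ⊕ E)` is an integral section of `ξ = (ξ₁, …, ξ_k)`: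
`Tη(∂/∂t^A) = ρ(ξ_A) ∘ η`. -/
def IsIntegralSection (ξ : Fin k → LA.LagSection k)
    (η : EuclideanSpace ℝ (Fin k) → PhaseSpace k F E) : Prop :=
  MDifferentiable (𝓡 k) (phaseModel k n F) η ∧
    ∀ t A, mfderiv (𝓡 k) (phaseModel k n F) η t (EuclideanSpace.single A (1 : ℝ)) =
      (ξ A).snd (η t)

/-- The map `t ↦ (t; Φ(∂/∂t^1), …, Φ(∂/∂t^k))` associated with a bundle map `Φ : Tℝᵏ → E` over
`φ : ℝᵏ → Q`. -/
noncomputable def assocMap (φ : EuclideanSpace ℝ (Fin k) → Q)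
    (Φ : ∀ t, TangentSpace (𝓡 k) t →ₗ[ℝ] E (φ t)) (t : EuclideanSpace ℝ (Fin k)) :
    PhaseSpace k F E :=
  point t (φ t) (fun A => Φ t (EuclideanSpace.single A (1 : ℝ)))

/-- The coefficient `ρ^i_α` of the anchor in a chart `χ` of `Q`, for the section `s = e_α`. -/
noncomputable def anchorCoeff (χ : OpenPartialHomeomorph Q (EuclideanSpace ℝ (Fin n)))
    (s : ∀ q, E q) (i : Fin n) (q : Q) : ℝ :=
  (show EuclideanSpace ℝ (Fin n) from
    mfderiv (𝓡 n) 𝓘(ℝ, EuclideanSpace ℝ (Fin n)) χ q (LA.anchor q (s q))) i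

section Frame

variable {m : ℕ} {e : Fin m → ∀ q, E q} {U : Set Q} (he : IsLocalFrameOn (𝓡 n) F ∞ e U)

/-- The structure function `C^γ_{αβ}` in a local frame: `⟦e_α, e_β⟧ = C^γ_{αβ} e_γ`. -/
noncomputable def structCoeff (α β γ : Fin m) (q : Q) : ℝ :=
  he.coeff γ q (LA.localBracket (e α) (e β) q)

/-- The fibre coordinate `y^α_A` of `p = (t; q; e₁, …, e_k)`, the `α`th component of `e_A`. -/
noncomputable def coordY (α : Fin m) (A : Fin k) (p : PhaseSpace k F E) : ℝ :=
  he.coeff α p.proj (p.comp A)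

/-- `∂L/∂q^i` in the coordinates `(t^A, q^i, y^α_A)` given by a chart of `Q` and a local frame. -/
noncomputable def derivQ (χ : OpenPartialHomeomorph Q (EuclideanSpace ℝ (Fin n)))
    (L : PhaseSpace k F E → ℝ) (i : Fin n) (p : PhaseSpace k F E) : ℝ :=
  deriv (fun s : ℝ =>
    let q := χ.symm (χ p.proj + s • EuclideanSpace.single i 1)
    L (point p.1 q (fun A => ∑ α, coordY he α A p • e α q))) 0

end Frame

/-- The partial derivative `∂g/∂t^A`. -/
noncomputable def partialT (A : Fin k) (g : EuclideanSpace ℝ (Fin k) → ℝ)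
    (t : EuclideanSpace ℝ (Fin k)) : ℝ :=
  lineDeriv ℝ g t (EuclideanSpace.single A 1)

/-- `η(t) = (t, φ^i(t), φ^α_A(t))` is a solution of the Euler-Lagrange equations of field theories
on the Lie algebroid: the equations hold in all local coordinates, given by a chart `χ` of `Q` and a
local frame `e` of `E` over an open subset `U` of the domain of `χ`. -/
structure IsEulerLagrangeSolution (L : PhaseSpace k F E → ℝ)
    (η : EuclideanSpace ℝ (Fin k) → PhaseSpace k F E) : Prop where
  contMDiff : ContMDiff (𝓡 k) (phaseModel k n F) ∞ η
  fst_eq : ∀ t, (η t).1 = t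
  eulerLagrange : ∀ χ ∈ IsManifold.maximalAtlas (𝓡 n) ∞ Q, ∀ U : Set Q, IsOpen U → U ⊆ χ.source →
    ∀ (m : ℕ) (e : Fin m → ∀ q, E q) (he : IsLocalFrameOn (𝓡 n) F ∞ e U),
    ∀ t, (η t).proj ∈ U → ∀ α : Fin m,
      ∑ A, partialT A (fun t' => derivY L A (η t') (e α (η t').proj)) t =
        ∑ i, LA.anchorCoeff χ (e α) i (η t).proj * derivQ he χ L i (η t) -
          ∑ A, ∑ β, ∑ γ, coordY he β A (η t) * LA.structCoeff he α β γ (η t).proj *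
            derivY L A (η t) (e γ (η t).proj)
  anchor : ∀ χ ∈ IsManifold.maximalAtlas (𝓡 n) ∞ Q, ∀ U : Set Q, IsOpen U → U ⊆ χ.source →
    ∀ (m : ℕ) (e : Fin m → ∀ q, E q) (he : IsLocalFrameOn (𝓡 n) F ∞ e U),
    ∀ t, (η t).proj ∈ U → ∀ (i : Fin n) (A : Fin k),
      partialT A (fun t' => χ (η t').proj i) t =
        ∑ α, coordY he α A (η t) * LA.anchorCoeff χ (e α) i (η t).proj
  zeroCurvature : ∀ U : Set Q, IsOpen U →
    ∀ (m : ℕ) (e : Fin m → ∀ q, E q) (he : IsLocalFrameOn (𝓡 n) F ∞ e U),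
    ∀ t, (η t).proj ∈ U → ∀ (α : Fin m) (A B : Fin k),
      0 = partialT B (fun t' => coordY he α A (η t')) t -
          partialT A (fun t' => coordY he α B (η t')) t +
          ∑ β, ∑ γ, LA.structCoeff he β γ α (η t).proj * coordY he β B (η t) * coordY he γ A (η t)

section FieldEquation

variable [T2Space Q] [FiniteDimensional ℝ F]

/-- The Poincaré-Cartan `2`-sections `Ω_L^A = -dΘ_L^A`, evaluated on sections. -/
noncomputable def omega (L : PhaseSpace k F E → ℝ) (A : Fin k) (ξ η : LA.LagSection k)
    (p : PhaseSpace k F E) : ℝ :=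
  have : CompleteSpace F := FiniteDimensional.complete ℝ F;
  -prolD₁ PhaseSpace.contMDiff_proj (LA.theta L A) ξ η p

/-- The geometric Euler-Lagrange equations:
`𝒴^B(ξ_A) = δ^B_A` and `∑_A i_{ξ_A} Ω_L^A = dE_L + ∑_A ∂L/∂t^A 𝒴^A`. -/
structure IsGeometricSolution (L : PhaseSpace k F E → ℝ) (ξ : Fin k → LA.LagSection k) : Prop where
  dt_eq : ∀ A B p, dt B ((ξ A).toFun p) = if A = B then 1 else 0
  field_eq : ∀ (η : LA.LagSection k) (p : PhaseSpace k F E),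
    ∑ A, LA.omega L A (ξ A) η p =
      prolD (LA.energy L) (η.toFun p) + ∑ A, derivT L A p * dt A (η.toFun p)

end FieldEquation

end Lagrangian

end LieAlgebroid

/-! Over a fixed $(t,q)$ a trivialization identifies the points of the phase space with $y\in F^k$
(`ofCoord`), and $L$ becomes a smooth function $l(y)$. The value $\Theta_L^A(a,v)$ depends on $a$
only: it is the derivative of $L$ in the slot $A$ along $a$. On the fibre $E_L=Dl(y)\,y-l(y)$.

Second order property. Test the field equation with a section $\eta$ whose first component vanishes
and whose vector at the point is the vertical lift of $x$ in slot $B$. Then $\Theta_L^A(\eta)=0$,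
and the first component of $[\![\xi_A,\eta]\!]$ is minus the derivative along $\eta$ of the fibre
components $c_A$ of $\xi_A$. The terms containing $Dc_A$ cancel, so $\Omega_L^A(\xi_A,\eta)$ is
$D^2l(y)$ on $x$ in slot $B$ and $c_A$ in slot $A$ (`omega_vertical`). The right-hand side is
$D^2l(y)$ on $x$ in slot $B$ and $y$. Hence $c-y$ lies in the kernel of the Hessian, and regularity
gives $c=y$ (`IsRegular.eq_zero`, `IsGeometricSolution.fst_eq_comp`).

Euler-Lagrange equations. Now $\sum_A\Theta_L^A(\xi_A)=E_L+L$. At $p=(t;q;e_1,\dots,e_k)$ choose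
sections $Y_A$ of $E$ with $Y_A(q)=e_A$, and test with $\eta$ whose first component is a section $T$
near $q$ and whose vector at $p$ is tangent to $q'\mapsto(t;q';Y_1(q'),\dots,Y_k(q'))$. The first
component of $[\![\xi_A,\eta]\!]$ at $p$ is then $[\![Y_A,T]\!](q)$ (`bracketFst_lift`), the
differential of $E_L$ cancels, and what remains is
$\sum_A\rho(\xi_A)(\Theta_L^A(\eta))=\rho(\eta)(L)+\sum_A\Theta_L^A([\![Y_A,T]\!])$
(`IsGeometricSolution.sum_mvfderiv_eq`). With $T=e_\alpha$ and $Y_A$ of constant coefficients in the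
frame this is the coordinate equation, since $\rho(\xi_A)$ acts as $\partial/\partial t^A$ along an
integral section.

The anchor equation is the defining condition of the prolongation read along the integral section.
The zero curvature equation involves neither $L$ nor $\xi$: it is compatibility of $\Phi$ with $d$
on the dual frame. All tests need global sections, which are made with bump functions on $Q$
(`exists_lagSection`). -/

namespace WhitneySum

/-! ### Smooth maps into the Whitney sum -/

section Smooth

variable {n k : ℕ} {Q : Type*} [TopologicalSpace Q]
    [ChartedSpace (EuclideanSpace ℝ (Fin n)) Q] [IsManifold (𝓡 n) ∞ Q]
    {F : Type*} [NormedAddCommGroup F] [NormedSpace ℝ F]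
    {E : Q → Type*} [TopologicalSpace (TotalSpace F E)]
    [∀ q, AddCommGroup (E q)] [∀ q, Module ℝ (E q)] [∀ q, TopologicalSpace (E q)]
    [FiberBundle F E] [VectorBundle ℝ F E]
    {BM : Type*} [NormedAddCommGroup BM] [NormedSpace ℝ BM]
    {HM : Type*} [TopologicalSpace HM] {IM : ModelWithCorners ℝ BM HM}
    {M : Type*} [TopologicalSpace M] [ChartedSpace HM M]

/-- The trivializations of the Whitney sum act summand by summand, so smoothness can be tested in
each copy of $E$. -/
theorem contMDiffAt_iff {f : M → TotalSpace (Fin k → F) (WhitneySum k E)} {x : M} :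
    ContMDiffAt IM ((𝓡 n).prod 𝓘(ℝ, Fin k → F)) ∞ f x ↔
      ContMDiffAt IM (𝓡 n) ∞ (fun x => (f x).1) x ∧
        ∀ A, ContMDiffAt IM ((𝓡 n).prod 𝓘(ℝ, F)) ∞
          (fun x => (⟨(f x).1, (f x).2 A⟩ : TotalSpace F E)) x := by
  rw [contMDiffAt_totalSpace]
  refine and_congr_right fun h => ?_
  rw [contMDiffAt_pi_space]
  refine forall_congr' fun A => ?_
  rw [contMDiffAt_totalSpace]
  exact ⟨fun h' => ⟨h, h'⟩, fun h' => h'.2⟩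

end Smooth

end WhitneySum

/-! ### Sections along maps and derivatives with parameters -/

section AlongMaps

variable {n : ℕ} {Q : Type*} [TopologicalSpace Q]
    [ChartedSpace (EuclideanSpace ℝ (Fin n)) Q]
    {F : Type*} [NormedAddCommGroup F] [NormedSpace ℝ F]
    {E : Q → Type*} [TopologicalSpace (TotalSpace F E)]
    [∀ q, AddCommGroup (E q)] [∀ q, Module ℝ (E q)] [∀ q, TopologicalSpace (E q)]
    [FiberBundle F E] [VectorBundle ℝ F E]
    {BM : Type*} [NormedAddCommGroup BM] [NormedSpace ℝ BM]
    {HM : Type*} [TopologicalSpace HM] {IM : ModelWithCorners ℝ BM HM}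
    {M : Type*} [TopologicalSpace M] [ChartedSpace HM M]

/-- Sums `u + c v` of smooth sections along a map are smooth. -/
theorem contMDiffAt_add_smul_along {g : M → Q} {u v : ∀ x, E (g x)} {c : M → ℝ} {x : M}
    (hu : ContMDiffAt IM ((𝓡 n).prod 𝓘(ℝ, F)) ∞ (fun x => (⟨g x, u x⟩ : TotalSpace F E)) x)
    (hv : ContMDiffAt IM ((𝓡 n).prod 𝓘(ℝ, F)) ∞ (fun x => (⟨g x, v x⟩ : TotalSpace F E)) x)
    (hc : ContMDiffAt IM 𝓘(ℝ, ℝ) ∞ c x) :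
    ContMDiffAt IM ((𝓡 n).prod 𝓘(ℝ, F)) ∞
      (fun x => (⟨g x, u x + c x • v x⟩ : TotalSpace F E)) x := by
  rw [contMDiffAt_totalSpace] at hu hv ⊢
  refine ⟨hu.1, (hu.2.add (hc.smul hv.2)).congr_of_eventuallyEq ?_⟩
  filter_upwards [hu.1.continuousAt.preimage_mem_nhds
    ((trivializationAt F E (g x)).open_baseSet.mem_nhds
      (mem_baseSet_trivializationAt F E (g x)))] with x' hx'
  have hl := (trivializationAt F E (g x)).linear ℝ (b := g x') hx'
  exact (hl.map_add _ _).trans (congrArg _ (hl.map_smul _ _))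

theorem contMDiffAt_deriv_param [IsManifold IM ∞ M] {G : M × ℝ → ℝ} {x : M}
    (hG : ContMDiffAt (IM.prod 𝓘(ℝ, ℝ)) 𝓘(ℝ, ℝ) ∞ G (x, 0)) :
    ContMDiffAt IM 𝓘(ℝ, ℝ) ∞ (fun x => deriv (fun s => G (x, s)) 0) x := by
  have h := ContMDiffAt.mfderiv (m := ∞) (n := ∞) (I := 𝓘(ℝ, ℝ)) (I' := 𝓘(ℝ, ℝ))
    (fun x s => G (x, s)) (fun _ => (0 : ℝ)) hG contMDiffAt_const (by simp)
  simp only [mfderiv_eq_fderiv] at h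
  -- The variable $s$ and the value of $G$ lie in vector spaces, so no coordinate change of the
  -- tangent bundles enters.
  erw [inTangentCoordinates_model_space] at h
  exact h.clm_apply (contMDiffAt_const (c := (1 : ℝ)))

end AlongMaps

/-! ### Vertical shifts, fibre derivatives and fibre coordinates -/

namespace PhaseSpace

section Vertical

variable {n k : ℕ} {Q : Type*} [TopologicalSpace Q]
    [ChartedSpace (EuclideanSpace ℝ (Fin n)) Q] [IsManifold (𝓡 n) ∞ Q]
    {F : Type*} [NormedAddCommGroup F] [NormedSpace ℝ F]
    {E : Q → Type*} [TopologicalSpace (TotalSpace F E)]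
    [∀ q, AddCommGroup (E q)] [∀ q, Module ℝ (E q)] [∀ q, TopologicalSpace (E q)]
    [FiberBundle F E] [VectorBundle ℝ F E]
    {BM : Type*} [NormedAddCommGroup BM] [NormedSpace ℝ BM]
    {HM : Type*} [TopologicalSpace HM] {IM : ModelWithCorners ℝ BM HM}
    {M : Type*} [TopologicalSpace M] [ChartedSpace HM M]

theorem contMDiffAt_comp {g : M → PhaseSpace k F E} {x : M}
    (hg : ContMDiffAt IM (phaseModel k n F) ∞ g x) (A : Fin k) :
    ContMDiffAt IM ((𝓡 n).prod 𝓘(ℝ, F)) ∞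
      (fun x => (⟨(g x).proj, (g x).comp A⟩ : TotalSpace F E)) x :=
  (WhitneySum.contMDiffAt_iff.1 hg.snd).2 A

theorem contMDiffAt_vshift {g : M → PhaseSpace k F E} {b : ∀ x, E (g x).proj} {c : M → ℝ} {x : M}
    (hg : ContMDiffAt IM (phaseModel k n F) ∞ g x)
    (hb : ContMDiffAt IM ((𝓡 n).prod 𝓘(ℝ, F)) ∞ (fun x => (⟨(g x).proj, b x⟩ : TotalSpace F E)) x)
    (hc : ContMDiffAt IM 𝓘(ℝ, ℝ) ∞ c x) (A : Fin k) :
    ContMDiffAt IM (phaseModel k n F) ∞ (fun x => (g x).vshift A (b x) (c x)) x := by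
  refine hg.fst.prodMk (WhitneySum.contMDiffAt_iff.2 ⟨(contMDiff_proj _).comp x hg, fun B => ?_⟩)
  by_cases h : B = A
  · subst h
    simpa [vshift, point] using contMDiffAt_add_smul_along (contMDiffAt_comp hg B) hb hc
  · simpa [vshift, point, h] using! contMDiffAt_comp hg B

theorem contMDiff_vshift (p : PhaseSpace k F E) (A : Fin k) (a : E p.proj) :
    ContMDiff 𝓘(ℝ, ℝ) (phaseModel k n F) ∞ (p.vshift A a) := fun s =>
  contMDiffAt_vshift (x := s) (M := ℝ) (IM := 𝓘(ℝ, ℝ)) (g := fun _ => p) (b := fun _ => a) (c := id)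
    contMDiffAt_const contMDiffAt_const contMDiffAt_id A

/-- The fibre derivative is a derivative at $s=0$ of a function jointly smooth in $s$ and the
parameter. The direction may vary with the parameter, as needed for $\Theta_L^A(\eta)$ and for the
energy. -/
theorem contMDiffAt_derivY [IsManifold IM ∞ M] {L : PhaseSpace k F E → ℝ}
    (hL : ContMDiff (phaseModel k n F) 𝓘(ℝ, ℝ) ∞ L)
    {g : M → PhaseSpace k F E} {b : ∀ x, E (g x).proj} {x : M}
    (hg : ContMDiffAt IM (phaseModel k n F) ∞ g x)
    (hb : ContMDiffAt IM ((𝓡 n).prod 𝓘(ℝ, F)) ∞ (fun x => (⟨(g x).proj, b x⟩ : TotalSpace F E)) x)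
    (A : Fin k) :
    ContMDiffAt IM 𝓘(ℝ, ℝ) ∞ (fun x => derivY L A (g x) (b x)) x := by
  have h1 : ContMDiffAt (IM.prod 𝓘(ℝ, ℝ)) IM ∞ (Prod.fst : M × ℝ → M) (x, 0) := contMDiffAt_fst
  refine contMDiffAt_deriv_param (G := fun z => L ((g z.1).vshift A (b z.1) z.2)) ?_
  refine (hL _).comp _ (contMDiffAt_vshift (g := fun z : M × ℝ => g z.1) (b := fun z => b z.1)
    (c := fun z => z.2) ?_ ?_ contMDiffAt_snd A)
  · exact ContMDiffAt.comp (x, (0 : ℝ)) hg h1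
  · exact ContMDiffAt.comp (x, (0 : ℝ)) (g := fun x => (⟨(g x).proj, b x⟩ : TotalSpace F E)) hb h1

/-- The derivative along a vertical lift. -/
theorem mvfderiv_vliftVec {f : PhaseSpace k F E → ℝ} {p : PhaseSpace k F E}
    (hf : MDifferentiableAt (phaseModel k n F) 𝓘(ℝ, ℝ) f p) (A : Fin k) (a : E p.proj) :
    mvfderiv (phaseModel k n F) f p (vliftVec p A a) = derivY f A p a := by
  have h0 := vshift_zero p A a
  have hf' : MDifferentiableAt (phaseModel k n F) 𝓘(ℝ, ℝ) f (p.vshift A a 0) := by rwa [h0]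
  have h1 := mfderiv_comp (0 : ℝ) hf' ((contMDiff_vshift (n := n) p A a 0).mdifferentiableAt (by simp))
  -- The point `p.vshift A a 0` equals `p` only propositionally; `h3` moves the derivative from one
  -- base point to the other.
  have h3 : ∀ p' : PhaseSpace k F E, p' = p → ∀ v,
      mfderiv (phaseModel k n F) 𝓘(ℝ, ℝ) f p v = mfderiv (phaseModel k n F) 𝓘(ℝ, ℝ) f p' v := by
    rintro _ rfl v
    rfl
  refine (h3 _ h0 _).trans ?_
  refine (congrArg (fun l => l (1 : ℝ)) h1).symm.trans ?_
  rw [mfderiv_eq_fderiv]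
  rfl

theorem derivY_zero (f : PhaseSpace k F E → ℝ) (A : Fin k) (p : PhaseSpace k F E) :
    derivY f A p 0 = 0 := by
  have : (fun s : ℝ => f (p.vshift A 0 s)) = fun _ => f p := by
    funext s
    have h : p.vshift A 0 s = p.vshift A 0 0 := by simp [vshift]
    rw [h, vshift_zero]
  rw [derivY, this, deriv_const]

variable (E) in
/-- The points of the phase space over `(t, q)`, in the fibre coordinates given by the
trivialization of `E` at `q`. -/
noncomputable def ofCoord (t : EuclideanSpace ℝ (Fin k)) (q : Q) (y : Fin k → F) :
    PhaseSpace k F E :=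
  point t q (fun A => (trivializationAt F E q).symmL ℝ q (y A))

/-- Reduces every question on a single fibre to calculus in the vector space `Fin k → F`. -/
theorem exists_eq_ofCoord (p : PhaseSpace k F E) : ∃ t q y, p = ofCoord E t q y := by
  refine ⟨p.1, p.proj, fun A => (trivializationAt F E p.proj ⟨p.proj, p.comp A⟩).2, ?_⟩
  have h : ∀ A, (trivializationAt F E p.proj).symmL ℝ p.proj
      (trivializationAt F E p.proj ⟨p.proj, p.comp A⟩).2 = p.comp A := fun A => by
    rw [Trivialization.symmL_apply _ (mem_baseSet_trivializationAt F E p.proj),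
      Trivialization.symm_apply_apply_mk _ (mem_baseSet_trivializationAt F E p.proj)]
  simp only [ofCoord, h]
  rfl

/-- Stated for the fibre parts alone: replacing these under `derivY` does not disturb the type of
its last argument, which depends on the base point. -/
theorem vshift_ofCoord_fibre (q : Q) (y : Fin k → F) (A : Fin k)
    (x : F) (s : ℝ) :
    (fun B => if B = A then (trivializationAt F E q).symmL ℝ q (y B) +
        s • (trivializationAt F E q).symmL ℝ q x else (trivializationAt F E q).symmL ℝ q (y B)) =
      fun B => (trivializationAt F E q).symmL ℝ q ((y + s • (Pi.single A x : Fin k → F)) B) := by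
  funext B
  by_cases h : B = A
  · subst h
    simp
  · simp [h]

theorem vshift_ofCoord (t : EuclideanSpace ℝ (Fin k)) (q : Q) (y : Fin k → F) (A : Fin k) (x : F)
    (s : ℝ) : (ofCoord E t q y).vshift A ((trivializationAt F E q).symmL ℝ q x) s =
      ofCoord E t q (y + s • (Pi.single A x : Fin k → F)) :=
  congrArg (point t q) (vshift_ofCoord_fibre (E := E) q y A x s)

theorem contMDiff_ofCoord (t : EuclideanSpace ℝ (Fin k)) (q : Q) :
    ContMDiff 𝓘(ℝ, Fin k → F) (phaseModel k n F) ∞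
      (fun y : Fin k → F => ofCoord E t q y) := by
  intro y
  refine contMDiffAt_const.prodMk (WhitneySum.contMDiffAt_iff.2 ⟨contMDiffAt_const, fun A => ?_⟩)
  rw [contMDiffAt_totalSpace]
  refine ⟨contMDiffAt_const, ?_⟩
  have : ContMDiff 𝓘(ℝ, Fin k → F) 𝓘(ℝ, F) ∞ (fun y : Fin k → F => y A) :=
    (ContinuousLinearMap.proj (R := ℝ) (φ := fun _ : Fin k => F) A).contMDiff
  refine (this y).congr_of_eventuallyEq (Filter.Eventually.of_forall fun y' => ?_)
  have hq := mem_baseSet_trivializationAt F E q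
  change (trivializationAt F E q ⟨q, (trivializationAt F E q).symmL ℝ q (y' A)⟩).2 = y' A
  rw [Trivialization.symmL_apply _ hq, Trivialization.apply_mk_symm _ hq]

/-- A vertical shift is a straight line in the fibre coordinates, so `derivY` is a directional
derivative of $l$. -/
theorem derivY_ofCoord {f : PhaseSpace k F E → ℝ} {t : EuclideanSpace ℝ (Fin k)} {q : Q}
    {y : Fin k → F} (hf : DifferentiableAt ℝ (fun y : Fin k → F => f (ofCoord E t q y)) y) (A : Fin k) (x : F) :
    derivY f A (ofCoord E t q y) ((trivializationAt F E q).symmL ℝ q x) =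
      fderiv ℝ (fun y : Fin k → F => f (ofCoord E t q y)) y (Pi.single A x : Fin k → F) := by
  unfold derivY
  simp only [vshift_ofCoord]
  exact hf.lineDeriv_eq_fderiv

theorem contDiff_comp_ofCoord {f : PhaseSpace k F E → ℝ}
    (hf : ContMDiff (phaseModel k n F) 𝓘(ℝ, ℝ) ∞ f) (t : EuclideanSpace ℝ (Fin k)) (q : Q) :
    ContDiff ℝ ∞ (fun y : Fin k → F => f (ofCoord E t q y)) :=
  (hf.comp (contMDiff_ofCoord t q)).contDiff

end Vertical

end PhaseSpace

/-! ### Charts of the phase space and the projection -/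

namespace PhaseSpace

section Charts

variable {n k : ℕ} {Q : Type*} [TopologicalSpace Q]
    [ChartedSpace (EuclideanSpace ℝ (Fin n)) Q] [IsManifold (𝓡 n) ∞ Q]
    {F : Type*} [NormedAddCommGroup F] [NormedSpace ℝ F]
    {E : Q → Type*} [TopologicalSpace (TotalSpace F E)]
    [∀ q, AddCommGroup (E q)] [∀ q, Module ℝ (E q)] [∀ q, TopologicalSpace (E q)]
    [FiberBundle F E] [VectorBundle ℝ F E]

/-- Chart domains are full preimages of open subsets of $Q$. For this reason cut-off functions on
$Q$, pulled back by the projection, are enough on the phase space. -/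
theorem mem_chartAt_source_iff {p p' : PhaseSpace k F E} :
    p' ∈ (chartAt (ModelProd (EuclideanSpace ℝ (Fin k))
      (ModelProd (EuclideanSpace ℝ (Fin n)) (Fin k → F))) p).source ↔
      p'.proj ∈ (chartAt (EuclideanSpace ℝ (Fin n)) p.proj).source ∧
        p'.proj ∈ (trivializationAt F E p.proj).baseSet := by
  have h : p'.2 ∈ (trivializationAt (Fin k → F) (WhitneySum k E) p.2.proj).source ↔
      p'.proj ∈ (trivializationAt F E p.proj).baseSet := Iff.rfl
  rw [prodChartedSpace_chartAt, OpenPartialHomeomorph.prod_source, Set.mem_prod,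
    FiberBundle.chartedSpace_chartAt, OpenPartialHomeomorph.trans_source, Set.mem_inter_iff]
  refine ⟨fun h' => ⟨h'.2.2.1, h.1 h'.2.1⟩, fun h' => ⟨Set.mem_univ _, h.2 h'.2, h'.1, Set.mem_univ _⟩⟩

theorem extChartAt_apply_proj (p p' : PhaseSpace k F E) :
    (extChartAt (phaseModel k n F) p p').2.1 =
      extChartAt (𝓡 n) p.proj p'.proj := by
  rw [extChartAt_prod, PartialEquiv.prod_coe, FiberBundle.extChartAt]
  rfl

variable [ContMDiffVectorBundle ∞ F E (𝓡 n)]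

/-- The projection to `Q` in the trivializations of the tangent bundles given by charts. -/
theorem continuousLinearMapAt_mfderiv_proj {p p' : PhaseSpace k F E}
    (hp' : p' ∈ (chartAt (ModelProd (EuclideanSpace ℝ (Fin k))
      (ModelProd (EuclideanSpace ℝ (Fin n)) (Fin k → F))) p).source)
    (u : TangentSpace (phaseModel k n F) p') :
    (trivializationAt (EuclideanSpace ℝ (Fin n)) (TangentSpace (𝓡 n)) p.proj).continuousLinearMapAt
        ℝ p'.proj (mfderiv (phaseModel k n F) (𝓡 n) (proj : PhaseSpace k F E → Q) p' u) =
      ((trivializationAt (EuclideanSpace ℝ (Fin k) × (EuclideanSpace ℝ (Fin n) × (Fin k → F)))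
        (TangentSpace (phaseModel k n F)) p).continuousLinearMapAt ℝ p' u).2.1 := by
  have hq : p'.proj ∈ (chartAt (EuclideanSpace ℝ (Fin n)) p.proj).source :=
    (mem_chartAt_source_iff.1 hp').1
  rw [TangentBundle.continuousLinearMapAt_trivializationAt hp',
    TangentBundle.continuousLinearMapAt_trivializationAt hq]
  let pr₂ : EuclideanSpace ℝ (Fin k) × (EuclideanSpace ℝ (Fin n) × (Fin k → F)) →L[ℝ]
      EuclideanSpace ℝ (Fin n) :=
    (ContinuousLinearMap.fst ℝ _ _).comp (ContinuousLinearMap.snd ℝ _ _)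
  -- In charts the projection is the linear map `pr₂`, which is its own derivative.
  have h1 : (extChartAt (𝓡 n) p.proj) ∘ (proj : PhaseSpace k F E → Q) =
      pr₂ ∘ extChartAt (phaseModel k n F) p := by
    funext x
    exact (extChartAt_apply_proj p x).symm
  have h2 := mfderiv_comp p' (mdifferentiableAt_extChartAt (I := 𝓡 n) hq)
    ((contMDiff_proj (k := k) (n := n) (F := F) (E := E) p').mdifferentiableAt (by simp))
  have h3 := mfderiv_comp p' (pr₂.mdifferentiableAt) (mdifferentiableAt_extChartAt
    (I := phaseModel k n F) hp')
  rw [h1, h3] at h2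
  have h4 := congrArg (fun l => l u) h2
  rw [ContinuousLinearMap.mfderiv_eq] at h4
  exact h4.symm

end Charts

end PhaseSpace

/-! ### Global test sections of the prolongation -/

namespace LieAlgebroid

open PhaseSpace

section TestSections

variable {n k : ℕ} {Q : Type*} [TopologicalSpace Q]
    [ChartedSpace (EuclideanSpace ℝ (Fin n)) Q] [IsManifold (𝓡 n) ∞ Q]
    {F : Type*} [NormedAddCommGroup F] [NormedSpace ℝ F]
    {E : Q → Type*} [TopologicalSpace (TotalSpace F E)]
    [∀ q, AddCommGroup (E q)] [∀ q, Module ℝ (E q)] [∀ q, TopologicalSpace (E q)]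
    [FiberBundle F E] [VectorBundle ℝ F E]
    [T2Space Q] [ContMDiffVectorBundle ∞ F E (𝓡 n)]
    (LA : LieAlgebroid (n := n) Q F E)

/-- Every vector of the prolongation whose first component is the value of a section `T` of `E` is
the value of a section of the prolongation whose first component is the section along the
projection given by `f T`, where `f = 1` near the base point. -/
theorem exists_lagSection (T : Cₛ^∞⟮𝓡 n; F, E⟯) (p : PhaseSpace k F E)
    (v : TangentSpace (phaseModel k n F) p)
    (hv : LA.anchor p.proj (T p.proj) =
      mfderiv (phaseModel k n F) (𝓡 n) (proj : PhaseSpace k F E → Q) p v) :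
    ∃ (η : LA.LagSection k) (f : Q → ℝ), (∀ᶠ q in 𝓝 p.proj, f q = 1) ∧
      (∀ p' : PhaseSpace k F E, η.fst p' = f p'.proj • T p'.proj) ∧ η.snd p = v := by
  set e := trivializationAt (EuclideanSpace ℝ (Fin n)) (TangentSpace (𝓡 n)) p.proj with he
  set e' := trivializationAt (EuclideanSpace ℝ (Fin k) × (EuclideanSpace ℝ (Fin n) × (Fin k → F)))
    (TangentSpace (phaseModel k n F)) p with he'
  set O : Set Q := (chartAt (EuclideanSpace ℝ (Fin n)) p.proj).source ∩
    (trivializationAt F E p.proj).baseSet with hO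
  have hOo : IsOpen O := (chartAt (EuclideanSpace ℝ (Fin n)) p.proj).open_source.inter
    (trivializationAt F E p.proj).open_baseSet
  have hpO : p.proj ∈ O := ⟨mem_chart_source _ _, mem_baseSet_trivializationAt F E _⟩
  obtain ⟨f, -, hf⟩ := (SmoothBumpFunction.nhds_basis_tsupport (I := 𝓡 n)
    p.proj).mem_iff.1 (hOo.mem_nhds hpO)
  have hmem : ∀ p' : PhaseSpace k F E, p'.proj ∈ O ↔
      p' ∈ (chartAt (ModelProd (EuclideanSpace ℝ (Fin k))
        (ModelProd (EuclideanSpace ℝ (Fin n)) (Fin k → F))) p).source :=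
    fun p' => mem_chartAt_source_iff.symm
  have hbase : ∀ p' : PhaseSpace k F E, p'.proj ∈ O → p' ∈ e'.baseSet := fun p' h => by
    rw [he', TangentBundle.trivializationAt_baseSet]
    exact (hmem p').1 h
  let r : Q → EuclideanSpace ℝ (Fin n) := fun q => e.continuousLinearMapAt ℝ q (LA.anchor q (T q))
  let w := e'.continuousLinearMapAt ℝ p v
  -- In the chart at `p` the $t$- and fibre components are frozen at those of `v`; the component
  -- along $Q$ is the one that $\rho(T)$ dictates. This keeps the pair $(T,W)$ in the prolongation
  -- over all of `O`.
  let W : ∀ p' : PhaseSpace k F E, TangentSpace (phaseModel k n F) p' := fun p' =>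
    e'.symmL ℝ p' (w.1, (r p'.proj, w.2.2))
  have hW : ∀ p' : PhaseSpace k F E, p'.proj ∈ O → LA.anchor p'.proj (T p'.proj) =
      mfderiv (phaseModel k n F) (𝓡 n) (proj : PhaseSpace k F E → Q) p' (W p') := by
    intro p' hp'
    have hb : p'.proj ∈ e.baseSet := by
      rw [he, TangentBundle.trivializationAt_baseSet]
      exact hp'.1
    have hinj : Function.Injective (e.continuousLinearMapAt ℝ p'.proj) := fun a b hab => by
      rw [← e.symmL_continuousLinearMapAt (R := ℝ) hb a, hab,
        e.symmL_continuousLinearMapAt (R := ℝ) hb b]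
    apply hinj
    refine Eq.trans ?_ (continuousLinearMapAt_mfderiv_proj ((hmem p').1 hp') (W p')).symm
    change r p'.proj = (e'.continuousLinearMapAt ℝ p' (e'.symmL ℝ p' _)).2.1
    rw [e'.continuousLinearMapAt_symmL (R := ℝ) (hbase p' hp')]
  have hWp : W p = v := by
    have h1 : w.2.1 = r p.proj := by
      have := continuousLinearMapAt_mfderiv_proj ((hmem p).1 hpO) v
      rw [← hv] at this
      exact this.symm
    have h2 : (w.1, (r p.proj, w.2.2)) = w := by rw [← h1]
    change e'.symmL ℝ p (w.1, (r p.proj, w.2.2)) = v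
    rw [h2]
    exact e'.symmL_continuousLinearMapAt (R := ℝ) (hbase p hpO) v
  have hr : ContMDiffOn (𝓡 n) 𝓘(ℝ, EuclideanSpace ℝ (Fin n)) ∞ r O := by
    have h1 : ContMDiff (𝓡 n) (𝓡 n).tangent ∞
        (fun q => (⟨q, LA.anchor q (T q)⟩ : TangentBundle (𝓡 n) Q)) :=
      LA.contMDiff_anchor.comp T.contMDiff
    have hsub : O ⊆ e.baseSet := fun q hq => by
      rw [he, TangentBundle.trivializationAt_baseSet]
      exact hq.1
    have h2 := (e.contMDiffOn_section_iff (IB := 𝓡 n) (n := ∞)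
      (s := fun q => LA.anchor q (T q)) hOo hsub).1 h1.contMDiffOn
    refine h2.congr fun q hq => ?_
    simp only [r]
    rw [e.continuousLinearMapAt_apply (R := ℝ), e.linearMapAt_apply, if_pos (hsub hq)]
  have hWs : ContMDiffOn (phaseModel k n F) (phaseModel k n F).tangent ∞
      (fun p' => (⟨p', W p'⟩ : TangentBundle (phaseModel k n F) (PhaseSpace k F E)))
      (proj ⁻¹' O) := by
    have hPO : IsOpen ((proj : PhaseSpace k F E → Q) ⁻¹' O) :=
      hOo.preimage (PhaseSpace.contMDiff_proj (n := n)).continuous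
    refine (e'.contMDiffOn_section_iff hPO hbase).2 ?_
    have h3 : ContMDiffOn (phaseModel k n F)
        𝓘(ℝ, EuclideanSpace ℝ (Fin k) × (EuclideanSpace ℝ (Fin n) × (Fin k → F))) ∞
        (fun p' : PhaseSpace k F E => (w.1, (r p'.proj, w.2.2))) (proj ⁻¹' O) := by
      refine contMDiffOn_const.prodMk_space (ContMDiffOn.prodMk_space ?_ contMDiffOn_const)
      exact hr.comp (PhaseSpace.contMDiff_proj (n := n)).contMDiffOn fun _ h => h
    refine h3.congr fun p' hp' => ?_
    simp only [W]
    rw [e'.symmL_apply (hbase p' hp'), e'.apply_mk_symm (hbase p' hp')]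
  have hsnd : ContMDiff (phaseModel k n F) (phaseModel k n F).tangent ∞
      (fun p' => (⟨p', ((fun x : PhaseSpace k F E => f x.proj) • W) p'⟩ :
        TangentBundle (phaseModel k n F) (PhaseSpace k F E))) := by
    refine ContMDiffOn.smul_section_of_tsupport
      (f.contMDiff.comp PhaseSpace.contMDiff_proj).contMDiffOn
      (hOo.preimage (PhaseSpace.contMDiff_proj (n := n)).continuous) ?_ hWs
    exact (tsupport_comp_subset_preimage _ (PhaseSpace.contMDiff_proj (n := n)).continuous).trans
      (Set.preimage_mono hf)
  refine ⟨⟨fun p' => ⟨(f p'.proj • T p'.proj, f p'.proj • W p'), ?_⟩, ?_, hsnd⟩, f,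
    f.eventuallyEq_one, fun _ => rfl, ?_⟩
  · change LA.anchor p'.proj (f p'.proj • T p'.proj) =
      mfderiv (phaseModel k n F) (𝓡 n) (proj : PhaseSpace k F E → Q) p' (f p'.proj • W p')
    rw [map_smul, map_smul]
    by_cases h : p'.proj ∈ O
    · rw [hW p' h]
    -- Outside `O` nothing is known about `W`, but there the cut-off kills both components.
    · have : f p'.proj = 0 := image_eq_zero_of_notMem_tsupport fun h' => h (hf h')
      rw [this, zero_smul, zero_smul]
  · exact ContMDiff.comp (f.contMDiff.smul_section T.contMDiff) PhaseSpace.contMDiff_proj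
  · change f p.proj • W p = v
    rw [f.eq_one, one_smul, hWp]

end TestSections

end LieAlgebroid

/-! ### Poincaré-Cartan sections and energy through fibre derivatives -/

namespace LieAlgebroid

open PhaseSpace

section Lagrangian

variable {n k : ℕ} {Q : Type*} [TopologicalSpace Q]
    [ChartedSpace (EuclideanSpace ℝ (Fin n)) Q] [IsManifold (𝓡 n) ∞ Q]
    {F : Type*} [NormedAddCommGroup F] [NormedSpace ℝ F]
    {E : Q → Type*} [TopologicalSpace (TotalSpace F E)]
    [∀ q, AddCommGroup (E q)] [∀ q, Module ℝ (E q)] [∀ q, TopologicalSpace (E q)]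
    [FiberBundle F E] [VectorBundle ℝ F E]
    [ContMDiffVectorBundle ∞ F E (𝓡 n)]
    (LA : LieAlgebroid (n := n) Q F E)

theorem theta_eq_derivY {L : PhaseSpace k F E → ℝ}
    (hL : ContMDiff (phaseModel k n F) 𝓘(ℝ, ℝ) ∞ L) (A : Fin k) (p : PhaseSpace k F E)
    (x : LA.LagProlongation p) : LA.theta L A p x = derivY L A p x.1.1 :=
  mvfderiv_vliftVec ((hL p).mdifferentiableAt (by simp)) A x.1.1

theorem energy_eq {L : PhaseSpace k F E → ℝ}
    (hL : ContMDiff (phaseModel k n F) 𝓘(ℝ, ℝ) ∞ L) :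
    LA.energy L = fun p => ∑ A, derivY L A p (p.comp A) - L p := by
  funext p
  exact congrArg (· - L p) (Finset.sum_congr rfl fun A _ =>
    mvfderiv_vliftVec ((hL p).mdifferentiableAt (by simp)) A (p.comp A))

variable {LA}

theorem contMDiff_derivY_fst {L : PhaseSpace k F E → ℝ}
    (hL : ContMDiff (phaseModel k n F) 𝓘(ℝ, ℝ) ∞ L) (A : Fin k) (ξ : LA.LagSection k) :
    ContMDiff (phaseModel k n F) 𝓘(ℝ, ℝ) ∞ (fun p => derivY L A p (ξ.fst p)) := fun p =>
  contMDiffAt_derivY (M := PhaseSpace k F E) (IM := phaseModel k n F) (x := p)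
    (g := fun p => p) (b := fun p => ξ.fst p) hL contMDiffAt_id (ξ.contMDiff_fst p) A

theorem contMDiff_derivY_comp {L : PhaseSpace k F E → ℝ}
    (hL : ContMDiff (phaseModel k n F) 𝓘(ℝ, ℝ) ∞ L) (A : Fin k) :
    ContMDiff (phaseModel k n F) 𝓘(ℝ, ℝ) ∞
      (fun p : PhaseSpace k F E => derivY L A p (p.comp A)) := fun p =>
  contMDiffAt_derivY (M := PhaseSpace k F E) (IM := phaseModel k n F) (x := p)
    (g := fun p => p) (b := fun p => p.comp A) hL contMDiffAt_id
    (contMDiffAt_comp (g := fun p : PhaseSpace k F E => p) (IM := phaseModel k n F) (x := p)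
      contMDiffAt_id A) A

theorem contMDiff_energy {L : PhaseSpace k F E → ℝ}
    (hL : ContMDiff (phaseModel k n F) 𝓘(ℝ, ℝ) ∞ L) :
    ContMDiff (phaseModel k n F) 𝓘(ℝ, ℝ) ∞ (LA.energy L) := by
  rw [energy_eq LA hL]
  exact (contMDiff_finsetSum fun A _ => contMDiff_derivY_comp hL A).sub hL

theorem contMDiffAt_coord (ξ : LA.LagSection k) (p : PhaseSpace k F E) :
    ContMDiffAt (phaseModel k n F) 𝓘(ℝ, F) ∞ (ξ.coord p) p :=
  (contMDiffAt_totalSpace.1 (ξ.contMDiff_fst p)).2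

theorem symmL_coord (ξ : LA.LagSection k) (p : PhaseSpace k F E) :
    (trivializationAt F E p.proj).symmL ℝ p.proj (ξ.coord p p) = ξ.fst p := by
  have hq := mem_baseSet_trivializationAt F E p.proj
  rw [(trivializationAt F E p.proj).symmL_apply (R := ℝ) hq]
  exact (trivializationAt F E p.proj).symm_apply_apply_mk hq _

section Omega

variable [T2Space Q] [FiniteDimensional ℝ F]

theorem omega_eq {L : PhaseSpace k F E → ℝ}
    (hL : ContMDiff (phaseModel k n F) 𝓘(ℝ, ℝ) ∞ L) (A : Fin k) (ξ η : LA.LagSection k)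
    (p : PhaseSpace k F E) : LA.omega L A ξ η p =
      -(mvfderiv (phaseModel k n F) (fun p' => derivY L A p' (η.fst p')) p (ξ.snd p) -
        mvfderiv (phaseModel k n F) (fun p' => derivY L A p' (ξ.fst p')) p (η.snd p) -
        derivY L A p (bracketFst ξ η p)) := by
  simp only [omega, prolD₁, theta_eq_derivY LA hL]
  rfl

/-- The zero section is a global extension of the second argument, and the local bracket does not
depend on the extension. -/
theorem localBracket_constSection_zero (q : Q) (x : F) :
    LA.localBracket (constSection E q x) (constSection E q (0 : F)) q = 0 := by
  obtain ⟨S, hS⟩ := exists_section_eq (E := E) (trivializationAt F E q).open_baseSet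
    (mem_baseSet_trivializationAt F E q) (contMDiffOn_constSection (n := n) q x)
  have h0 : ∀ᶠ q' in 𝓝 q, (0 : Cₛ^∞⟮𝓡 n; F, E⟯) q' = constSection E q (0 : F) q' :=
    Filter.Eventually.of_forall fun q' => (map_zero _).symm
  rw [LA.localBracket_eq hS h0]
  exact LA.bracket_eq_zero_right (Filter.Eventually.of_forall fun _ => rfl)

/-- For a section `η` of the prolongation with vanishing first component, the bracket `⟦ξ, η⟧` is
minus the derivative of `ξ` along `η`. -/
theorem bracketFst_of_fst_eq_zero (ξ η : LA.LagSection k) (hη : ∀ p, η.fst p = 0)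
    (p : PhaseSpace k F E) : bracketFst ξ η p =
      -(trivializationAt F E p.proj).symmL ℝ p.proj
        (mvfderiv (phaseModel k n F) (ξ.coord p) p (η.snd p)) := by
  have h1 : η.coord p p = 0 := by
    have hq := mem_baseSet_trivializationAt F E p.proj
    have := ((trivializationAt F E p.proj).linear ℝ hq).map_zero
    rw [ProlongationSection.coord, hη]
    exact this
  have h2 : η.coord p =ᶠ[𝓝 p] fun _ => 0 := by
    filter_upwards [(PhaseSpace.contMDiff_proj (n := n) (k := k) (F := F) (E := E)
      ).continuous.continuousAt.preimage_mem_nhds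
      ((trivializationAt F E p.proj).open_baseSet.mem_nhds
        (mem_baseSet_trivializationAt F E p.proj))] with p' hp'
    have := ((trivializationAt F E p.proj).linear ℝ hp').map_zero
    rw [ProlongationSection.coord, hη]
    exact this
  have h3 : mvfderiv (phaseModel k n F) (η.coord p) p (ξ.snd p) = 0 := by
    have h := h2.mfderiv_eq (I := phaseModel k n F) (I' := 𝓘(ℝ, F))
    rw [mfderiv_const] at h
    exact congrArg (fun l => l (ξ.snd p)) h
  rw [bracketFst, h1, localBracket_constSection_zero, h3, zero_sub, zero_add, map_neg]

end Omega

end Lagrangian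

end LieAlgebroid

/-! ### Vertical lifts in fibre coordinates and the Hessian -/

namespace PhaseSpace

section Vertical

variable {n k : ℕ} {Q : Type*} [TopologicalSpace Q]
    [ChartedSpace (EuclideanSpace ℝ (Fin n)) Q] [IsManifold (𝓡 n) ∞ Q]
    {F : Type*} [NormedAddCommGroup F] [NormedSpace ℝ F]
    {E : Q → Type*} [TopologicalSpace (TotalSpace F E)]
    [∀ q, AddCommGroup (E q)] [∀ q, Module ℝ (E q)] [∀ q, TopologicalSpace (E q)]
    [FiberBundle F E] [VectorBundle ℝ F E]

/-- The curve defining the vertical lift is the image of the line $y+s\,x$ in slot $A$, so the lift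
is the push-forward of a coordinate vector. Derivatives along vertical lifts thereby become ordinary
Fréchet derivatives. -/
theorem vliftVec_ofCoord (t : EuclideanSpace ℝ (Fin k)) (q : Q) (y : Fin k → F) (A : Fin k)
    (x : F) : (vliftVec (ofCoord E t q y) A ((trivializationAt F E q).symmL ℝ q x) :
      TangentSpace (phaseModel k n F) (ofCoord E t q y)) =
      mfderiv 𝓘(ℝ, Fin k → F) (phaseModel k n F) (fun y : Fin k → F => ofCoord E t q y) y
        (Pi.single A x : Fin k → F) := by
  have h1 : (ofCoord E t q y).vshift A ((trivializationAt F E q).symmL ℝ q x) =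
      (fun y : Fin k → F => ofCoord E t q y) ∘ fun s : ℝ => y + s • (Pi.single A x : Fin k → F) :=
    funext fun s => vshift_ofCoord t q y A x s
  have h2 : HasDerivAt (fun s : ℝ => y + s • (Pi.single A x : Fin k → F)) (Pi.single A x) 0 := by
    simpa using ((hasDerivAt_id (0 : ℝ)).smul_const (Pi.single A x : Fin k → F)).const_add y
  have h3 := mfderiv_comp_apply_of_eq (I := 𝓘(ℝ, ℝ)) (I' := 𝓘(ℝ, Fin k → F))
    (I'' := phaseModel k n F) (0 : ℝ)
    ((contMDiff_ofCoord (n := n) (F := F) (E := E) t q y).mdifferentiableAt (by simp))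
    h2.differentiableAt.mdifferentiableAt (by simp) (1 : ℝ)
  unfold vliftVec
  rw [h1]
  refine h3.trans ?_
  rw [mfderiv_eq_fderiv]
  congr 1
  exact h2.deriv

theorem mvfderiv_vliftVec_ofCoord {G : Type*} [NormedAddCommGroup G] [NormedSpace ℝ G]
    {t : EuclideanSpace ℝ (Fin k)} {q : Q} {y : Fin k → F} {f : PhaseSpace k F E → G}
    (hf : MDifferentiableAt (phaseModel k n F) 𝓘(ℝ, G) f (ofCoord E t q y)) (A : Fin k) (x : F) :
    mvfderiv (phaseModel k n F) f (ofCoord E t q y)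
      (vliftVec (ofCoord E t q y) A ((trivializationAt F E q).symmL ℝ q x)) =
      fderiv ℝ (fun y : Fin k → F => f (ofCoord E t q y)) y (Pi.single A x : Fin k → F) := by
  rw [vliftVec_ofCoord, ← mfderiv_eq_fderiv]
  exact (mfderiv_comp_apply (I := 𝓘(ℝ, Fin k → F)) (I' := phaseModel k n F) (I'' := 𝓘(ℝ, G)) y hf
    ((contMDiff_ofCoord (n := n) (F := F) (E := E) t q y).mdifferentiableAt (by simp)) _).symm

/-- The Hessian of a regular Lagrangian in the fibre directions is nondegenerate. -/
theorem IsRegular.eq_zero [FiniteDimensional ℝ F] {L : PhaseSpace k F E → ℝ} (hreg : IsRegular L)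
    (hL : ContMDiff (phaseModel k n F) 𝓘(ℝ, ℝ) ∞ L) (t : EuclideanSpace ℝ (Fin k)) (q : Q)
    (y u : Fin k → F)
    (hu : ∀ A x, fderiv ℝ (fderiv ℝ (fun y : Fin k → F => L (ofCoord E t q y))) y
      (Pi.single A x : Fin k → F) u = 0) : u = 0 := by
  set l : (Fin k → F) → ℝ := fun y => L (ofCoord E t q y) with hl
  have hls : ContDiff ℝ ∞ l := contDiff_comp_ofCoord hL t q
  have hl1 : Differentiable ℝ l := hls.differentiable (by simp)
  have hl2 : Differentiable ℝ (fderiv ℝ l) :=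
    (hls.fderiv_right (m := ∞) (by simp)).differentiable (by simp)
  let b := Module.finBasis ℝ F
  let e := (trivializationAt F E q).continuousLinearEquivAt ℝ q
    (mem_baseSet_trivializationAt F E q)
  -- Regularity is used for the basis of $E_q$ carried over from a basis of $F$ by the
  -- trivialization; in it the matrix consists of values of $D^2l(y)$.
  have hdet := hreg (ofCoord E t q y) _ (b.map e.symm.toLinearEquiv)
  have hb : ∀ a, b.map e.symm.toLinearEquiv a = (trivializationAt F E q).symmL ℝ q (b a) :=
    fun a => (b.map_apply e.symm.toLinearEquiv a).trans
      (by rw [Trivialization.symmL_apply _ (mem_baseSet_trivializationAt F E q)]; rfl)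
  have hH : ∀ z z' : Fin k × Fin (Module.finrank ℝ F),
      deriv (fun s : ℝ => derivY L z'.1 ((ofCoord E t q y).vshift z.1
        (b.map e.symm.toLinearEquiv z.2) s) (b.map e.symm.toLinearEquiv z'.2)) 0 =
      fderiv ℝ (fderiv ℝ l) y (Pi.single z.1 (b z.2) : Fin k → F)
        (Pi.single z'.1 (b z'.2) : Fin k → F) := by
    intro z z'
    have h1 : ∀ s : ℝ, derivY L z'.1 ((ofCoord E t q y).vshift z.1
        (b.map e.symm.toLinearEquiv z.2) s) (b.map e.symm.toLinearEquiv z'.2) =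
        fderiv ℝ l (y + s • (Pi.single z.1 (b z.2) : Fin k → F))
          (Pi.single z'.1 (b z'.2) : Fin k → F) := by
      intro s
      have h2 := congrArg (fun f : Fin k → E q => derivY L z'.1 (point t q f)
        ((trivializationAt F E q).symmL ℝ q (b z'.2))) (vshift_ofCoord_fibre (E := E) q y z.1 (b z.2) s)
      have h3 := derivY_ofCoord (E := E) (t := t) (q := q) (f := L)
        (hl1 (y + s • (Pi.single z.1 (b z.2) : Fin k → F))) z'.1 (b z'.2)
      rw [hb z.2, hb z'.2]
      exact h2.trans h3
    simp only [h1]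
    have h4 : DifferentiableAt ℝ (fun y' => fderiv ℝ l y' (Pi.single z'.1 (b z'.2) : Fin k → F)) y :=
      (hl2 y).clm_apply (differentiableAt_const _)
    refine h4.lineDeriv_eq_fderiv.trans ?_
    rw [fderiv_clm_apply (hl2 y) (differentiableAt_const _)]
    simp
  -- The coordinates of $u$ form a kernel vector: row `z` of the product is $D^2l(y)$ on the basis
  -- vector with index `z` and $u$.
  have hv := Matrix.eq_zero_of_mulVec_eq_zero hdet
    (v := fun z : Fin k × Fin (Module.finrank ℝ F) => b.repr (u z.1) z.2) <| by
      funext z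
      rw [Matrix.mulVec, dotProduct]
      refine (Finset.sum_congr rfl fun z' _ => congrArg (· * b.repr (u z'.1) z'.2)
        (hH z z')).trans (Eq.trans ?_ (hu z.1 (b z.2)))
      rw [Fintype.sum_prod_type]
      have hsum : u = ∑ A, ∑ a, b.repr (u A) a • (Pi.single A (b a) : Fin k → F) := by
        have : ∀ A, ∑ a, b.repr (u A) a • (Pi.single A (b a) : Fin k → F) = Pi.single A (u A) := by
          intro A
          have := congrArg (LinearMap.single ℝ (fun _ : Fin k => F) A) (b.sum_repr (u A))
          rw [map_sum] at this
          simpa only [map_smul] using! this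
        simp only [this]
        exact (Finset.univ_sum_single u).symm
      conv_rhs => rw [hsum]
      simp only [map_sum, map_smul, smul_eq_mul, mul_comm]
  funext A
  apply b.repr.injective
  ext a
  simpa using congrFun hv (A, a)

end Vertical

end PhaseSpace

/-! ### The second order property -/

namespace LieAlgebroid

open PhaseSpace

section SecondOrder

variable {n k : ℕ} {Q : Type*} [TopologicalSpace Q]
    [ChartedSpace (EuclideanSpace ℝ (Fin n)) Q] [IsManifold (𝓡 n) ∞ Q]
    {F : Type*} [NormedAddCommGroup F] [NormedSpace ℝ F]
    {E : Q → Type*} [TopologicalSpace (TotalSpace F E)]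
    [∀ q, AddCommGroup (E q)] [∀ q, Module ℝ (E q)] [∀ q, TopologicalSpace (E q)]
    [FiberBundle F E] [VectorBundle ℝ F E]
    [ContMDiffVectorBundle ∞ F E (𝓡 n)] [T2Space Q] [FiniteDimensional ℝ F]
    {LA : LieAlgebroid (n := n) Q F E}

/-- Here $\Omega_L^A(\xi,\eta)=\rho(\eta)(\Theta_L^A(\xi))+\Theta_L^A([\![\xi,\eta]\!])$, because
$\Theta_L^A(\eta)=0$. Differentiating $Dl(y)$ on $c(y)$ in slot $A$ gives a Hessian term and a term
with $Dc$; the bracket contributes the negative of the latter. -/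
theorem omega_vertical {L : PhaseSpace k F E → ℝ}
    (hL : ContMDiff (phaseModel k n F) 𝓘(ℝ, ℝ) ∞ L) (ξ η : LA.LagSection k) (A B : Fin k)
    (t : EuclideanSpace ℝ (Fin k)) (q : Q) (y : Fin k → F) (x : F) (hη : ∀ p, η.fst p = 0)
    (hη' : η.snd (ofCoord E t q y) =
      vliftVec (ofCoord E t q y) B ((trivializationAt F E q).symmL ℝ q x)) :
    LA.omega L A ξ η (ofCoord E t q y) =
      fderiv ℝ (fderiv ℝ (fun y : Fin k → F => L (ofCoord E t q y))) y
        (Pi.single B x : Fin k → F)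
        (Pi.single A (ξ.coord (ofCoord E t q y) (ofCoord E t q y)) : Fin k → F) := by
  set l : (Fin k → F) → ℝ := fun y => L (ofCoord E t q y) with hl
  have hls : ContDiff ℝ ∞ l := contDiff_comp_ofCoord hL t q
  have hl1 : Differentiable ℝ l := hls.differentiable (by simp)
  have hl2 : Differentiable ℝ (fderiv ℝ l) :=
    (hls.fderiv_right (m := ∞) (by simp)).differentiable (by simp)
  let c : (Fin k → F) → F := fun y' => ξ.coord (ofCoord E t q y) (ofCoord E t q y')
  have hc : DifferentiableAt ℝ c y :=
    mdifferentiableAt_iff_differentiableAt.1 (((contMDiffAt_coord ξ (ofCoord E t q y)).comp y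
      (contMDiff_ofCoord (n := n) (F := F) (E := E) t q y)).mdifferentiableAt (by simp))
  have hfst : ∀ y', ξ.fst (ofCoord E t q y') = (trivializationAt F E q).symmL ℝ q (c y') :=
    fun y' => (symmL_coord ξ (ofCoord E t q y')).symm
  have h0 : (fun p' => derivY L A p' (η.fst p')) = fun _ => 0 := by
    funext p'
    rw [hη, derivY_zero]
  have h1 : ∀ y', derivY L A (ofCoord E t q y') (ξ.fst (ofCoord E t q y')) =
      fderiv ℝ l y' (Pi.single A (c y') : Fin k → F) := by
    intro y'
    rw [hfst]
    exact derivY_ofCoord (hl1 y') A (c y')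
  have h2 : mvfderiv (phaseModel k n F) (ξ.coord (ofCoord E t q y)) (ofCoord E t q y)
      (η.snd (ofCoord E t q y)) = fderiv ℝ c y (Pi.single B x : Fin k → F) := by
    rw [hη']
    exact mvfderiv_vliftVec_ofCoord
      ((contMDiffAt_coord ξ (ofCoord E t q y)).mdifferentiableAt (by simp)) B x
  have h3 : derivY L A (ofCoord E t q y) (bracketFst ξ η (ofCoord E t q y)) =
      - fderiv ℝ l y (Pi.single A (fderiv ℝ c y (Pi.single B x : Fin k → F)) : Fin k → F) := by
    rw [bracketFst_of_fst_eq_zero ξ η hη, h2, ← map_neg]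
    refine (derivY_ofCoord (hl1 y) A _).trans ?_
    rw [Pi.single_neg, map_neg]
  have h4 : mvfderiv (phaseModel k n F) (fun p' => derivY L A p' (ξ.fst p')) (ofCoord E t q y)
      (η.snd (ofCoord E t q y)) =
      fderiv ℝ (fun y' => fderiv ℝ l y' (Pi.single A (c y') : Fin k → F)) y
        (Pi.single B x : Fin k → F) := by
    rw [hη', mvfderiv_vliftVec_ofCoord
      ((contMDiff_derivY_fst hL A ξ _).mdifferentiableAt (by simp))]
    simp only [h1]
  have h5 : HasFDerivAt (fun y' => (Pi.single A (c y') : Fin k → F))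
      ((ContinuousLinearMap.single ℝ (fun _ : Fin k => F) A).comp (fderiv ℝ c y)) y :=
    (ContinuousLinearMap.single ℝ (fun _ : Fin k => F) A).hasFDerivAt.comp y hc.hasFDerivAt
  rw [omega_eq hL, h0, mvfderiv_const, h3, h4, ((hl2 y).hasFDerivAt.clm_apply h5).fderiv]
  simp [c]

/-- The first components of a geometric solution for a regular Lagrangian are the tautological
ones. -/
theorem IsGeometricSolution.fst_eq_comp {L : PhaseSpace k F E → ℝ}
    (hL : ContMDiff (phaseModel k n F) 𝓘(ℝ, ℝ) ∞ L) (hreg : PhaseSpace.IsRegular L)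
    {ξ : Fin k → LA.LagSection k} (hξ : LA.IsGeometricSolution L ξ) (A : Fin k)
    (p : PhaseSpace k F E) : (ξ A).fst p = p.comp A := by
  obtain ⟨t, q, y, rfl⟩ := exists_eq_ofCoord p
  set l : (Fin k → F) → ℝ := fun y => L (ofCoord E t q y) with hl
  have hls : ContDiff ℝ ∞ l := contDiff_comp_ofCoord hL t q
  have hl1 : Differentiable ℝ l := hls.differentiable (by simp)
  have hl2 : Differentiable ℝ (fderiv ℝ l) :=
    (hls.fderiv_right (m := ∞) (by simp)).differentiable (by simp)
  let c : Fin k → F := fun A => (ξ A).coord (ofCoord E t q y) (ofCoord E t q y)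
  have hsingle : ∀ u : Fin k → F, ∑ A, (Pi.single A (u A) : Fin k → F) = u := fun u =>
    Finset.univ_sum_single u
  -- The Liouville terms add up to $Dl(y')$ on $y'$, since $y'$ is the sum of its slots.
  have henergy : ∀ y', LA.energy L (ofCoord E t q y') = fderiv ℝ l y' y' - l y' := by
    intro y'
    rw [energy_eq LA hL]
    change ∑ A, derivY L A (ofCoord E t q y') ((ofCoord E t q y').comp A) - l y' = _
    conv_rhs => rw [← hsingle y', map_sum, hsingle]
    congr 1
    exact Finset.sum_congr rfl fun A _ => derivY_ofCoord (hl1 y') A (y' A)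
  have key : c - y = 0 := by
    refine hreg.eq_zero hL t q y _ fun B x => ?_
    -- Starting from the zero section of $E$, the test section has zero first component everywhere,
    -- not only at the point.
    obtain ⟨η, f, -, hη, hη'⟩ := LA.exists_lagSection (0 : Cₛ^∞⟮𝓡 n; F, E⟯) (ofCoord E t q y)
      (vliftVec (ofCoord E t q y) B ((trivializationAt F E q).symmL ℝ q x))
      (((LA.anchor _).map_zero).trans (mfderiv_proj_vliftVec _ B _).symm)
    have hη0 : ∀ p, η.fst p = 0 := fun p => (hη p).trans (smul_zero _)
    have h := hξ.field_eq η (ofCoord E t q y)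
    -- The fibre curve keeps $t$ fixed, so the terms with $\partial L/\partial t^A$ drop out.
    have hdt : ∀ A, dt A (η.toFun (ofCoord E t q y)) = 0 := by
      intro A
      have h1 := mvfderiv_vliftVec_ofCoord (n := n) (E := E) (t := t) (q := q) (y := y)
        (f := fun p' : PhaseSpace k F E => p'.1 A) ?_ B x
      · change mvfderiv (phaseModel k n F) (fun p' : PhaseSpace k F E => p'.1 A) (ofCoord E t q y)
          (η.snd (ofCoord E t q y)) = 0
        rw [hη', h1]
        change fderiv ℝ (fun _ : Fin k → F => t A) y _ = 0
        simp
      · exact ((EuclideanSpace.proj A : EuclideanSpace ℝ (Fin k) →L[ℝ] ℝ).contMDiff.comp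
          contMDiff_fst _).mdifferentiableAt (n := ∞) (by simp)
    have hE : prolD (LA.energy L) (η.toFun (ofCoord E t q y)) =
        fderiv ℝ (fderiv ℝ l) y (Pi.single B x : Fin k → F) y := by
      change mvfderiv (phaseModel k n F) (LA.energy L) (ofCoord E t q y)
        (η.snd (ofCoord E t q y)) = _
      rw [hη', mvfderiv_vliftVec_ofCoord
        ((contMDiff_energy hL _).mdifferentiableAt (by simp))]
      simp only [henergy]
      -- Of the derivative of $Dl(y)\,y-l(y)$ only the Hessian term survives; the two first-order
      -- terms cancel.
      have hd : HasFDerivAt (fun y => fderiv ℝ l y y - l y) _ y :=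
        ((hl2 y).hasFDerivAt.clm_apply (hasFDerivAt_id y)).sub (hl1 y).hasFDerivAt
      rw [hd.fderiv]
      simp
    rw [hE] at h
    simp only [hdt, mul_zero, Finset.sum_const_zero, add_zero] at h
    rw [Finset.sum_congr rfl fun A _ => omega_vertical hL (ξ A) η A B t q y x hη0 hη',
      ← map_sum] at h
    have h' : ∑ A, (Pi.single A ((ξ A).coord (ofCoord E t q y) (ofCoord E t q y)) :
      Fin k → F) = c := hsingle c
    rw [h'] at h
    rw [map_sub, h, sub_self]
  have hA : (ξ A).coord (ofCoord E t q y) (ofCoord E t q y) = y A :=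
    congrFun (sub_eq_zero.1 key) A
  rw [← symmL_coord, hA]
  rfl

theorem IsGeometricSolution.isSOPDE {L : PhaseSpace k F E → ℝ}
    (hL : ContMDiff (phaseModel k n F) 𝓘(ℝ, ℝ) ∞ L) (hreg : PhaseSpace.IsRegular L)
    {ξ : Fin k → LA.LagSection k} (hξ : LA.IsGeometricSolution L ξ) : LA.IsSOPDE ξ :=
  ⟨fun A p => congrArg (LA.vlift p A) (hξ.fst_eq_comp hL hreg A p), hξ.dt_eq⟩

end SecondOrder

end LieAlgebroid

/-- A function which is smooth near `q` agrees near `q` with a globally smooth function. -/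
theorem exists_contMDiff_eventuallyEq {n : ℕ} {Q : Type*} [TopologicalSpace Q] [T2Space Q]
    [ChartedSpace (EuclideanSpace ℝ (Fin n)) Q] [IsManifold (𝓡 n) ∞ Q] {g : Q → ℝ} {u : Set Q}
    (hu : IsOpen u) (hg : ContMDiffOn (𝓡 n) 𝓘(ℝ, ℝ) ∞ g u) {q : Q} (hq : q ∈ u) :
    ∃ f : Q → ℝ, ContMDiff (𝓡 n) 𝓘(ℝ, ℝ) ∞ f ∧ f =ᶠ[𝓝 q] g := by
  obtain ⟨χ, -, hχ⟩ := (SmoothBumpFunction.nhds_basis_tsupport (I := 𝓡 n) q).mem_iff.1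
    (hu.mem_nhds hq)
  refine ⟨fun x => χ x * g x, contMDiff_of_tsupport fun x hx => ?_, ?_⟩
  · have hx' : x ∈ u := hχ (tsupport_mul_subset_left hx)
    exact (χ.contMDiff x).mul (hg.contMDiffAt (hu.mem_nhds hx'))
  · filter_upwards [χ.eventuallyEq_one] with x hx
    rw [hx, Pi.one_apply, one_mul]

/-! ### The bracket of $E$ in a trivialization -/

namespace LieAlgebroid

section Bracket

variable {n : ℕ} {Q : Type*} [TopologicalSpace Q]
    [ChartedSpace (EuclideanSpace ℝ (Fin n)) Q] [IsManifold (𝓡 n) ∞ Q]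
    {F : Type*} [NormedAddCommGroup F] [NormedSpace ℝ F]
    {E : Q → Type*} [TopologicalSpace (TotalSpace F E)]
    [∀ q, AddCommGroup (E q)] [∀ q, Module ℝ (E q)] [∀ q, TopologicalSpace (E q)]
    [FiberBundle F E] [VectorBundle ℝ F E]
    [ContMDiffVectorBundle ∞ F E (𝓡 n)] [T2Space Q]

variable (F) in
/-- The components near `q` of a section of `E` in the trivialization at `q`. -/
noncomputable def sectionCoord (T : ∀ q, E q) (q q' : Q) : F :=
  (trivializationAt F E q ⟨q', T q'⟩).2

theorem contMDiffOn_sectionCoord (T : Cₛ^∞⟮𝓡 n; F, E⟯) (q : Q) :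
    ContMDiffOn (𝓡 n) 𝓘(ℝ, F) ∞ (sectionCoord F T q) (trivializationAt F E q).baseSet :=
  ((trivializationAt F E q).contMDiffOn_section_baseSet_iff).1 T.contMDiff.contMDiffOn

theorem mdifferentiableAt_sectionCoord (T : Cₛ^∞⟮𝓡 n; F, E⟯) (q : Q) :
    MDifferentiableAt (𝓡 n) 𝓘(ℝ, F) (sectionCoord F T q) q :=
  ((contMDiffOn_sectionCoord T q).contMDiffAt ((trivializationAt F E q).open_baseSet.mem_nhds
    (mem_baseSet_trivializationAt F E q))).mdifferentiableAt (by simp)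

theorem constSection_sectionCoord (T : ∀ q, E q) {q q' : Q}
    (hq' : q' ∈ (trivializationAt F E q).baseSet) :
    constSection E q (sectionCoord F T q q') q' = T q' := by
  rw [constSection, (trivializationAt F E q).symmL_apply (R := ℝ) hq']
  exact (trivializationAt F E q).symm_apply_apply_mk hq' _

variable (LA : LieAlgebroid (n := n) Q F E)

theorem bracket_sum {ι : Type*} (s : Finset ι) (S : Cₛ^∞⟮𝓡 n; F, E⟯) (T : ι → Cₛ^∞⟮𝓡 n; F, E⟯) :
    LA.bracket S (∑ i ∈ s, T i) = ∑ i ∈ s, LA.bracket S (T i) :=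
  map_sum (AddMonoidHom.mk' (LA.bracket S) (LA.bracket_add S)) T s

theorem sum_section_apply {ι : Type*} (s : Finset ι) (T : ι → Cₛ^∞⟮𝓡 n; F, E⟯) (q : Q) :
    (∑ i ∈ s, T i) q = ∑ i ∈ s, T i q := by
  have := map_sum (ContMDiffSection.coeAddHom (𝓡 n) F ∞ E) T s
  exact (congrFun this q).trans (Finset.sum_apply q s _)

/-- Near $q$ write $T=\sum_a f_a c_a$ with $c_a$ constant in the trivialization; $T'$ has the frozen
coefficients $f_a(q)$. By the Leibniz rule the two brackets differ by $\sum_a\rho(S)(f_a)\,c_a$ at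
$q$. -/
theorem bracket_eq_add_of_eventually_const [FiniteDimensional ℝ F] (S T T' : Cₛ^∞⟮𝓡 n; F, E⟯)
    {q : Q} (hT' : ∀ᶠ q' in 𝓝 q, T' q' = constSection E q (sectionCoord F T q q) q') :
    LA.bracket S T q = LA.bracket S T' q + (trivializationAt F E q).symmL ℝ q
      (mvfderiv (𝓡 n) (sectionCoord F T q) q (LA.anchor q (S q))) := by
  set e := trivializationAt F E q with he
  have hq : q ∈ e.baseSet := mem_baseSet_trivializationAt F E q
  let b := Module.finBasis ℝ F
  have hbc : ∀ a, ContMDiff 𝓘(ℝ, F) 𝓘(ℝ, ℝ) ∞ (b.coord a) := fun a =>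
    (LinearMap.toContinuousLinearMap (b.coord a)).contMDiff
  -- Sections and coefficient functions must be global for the Leibniz rule, so both are replaced by
  -- global ones with the same germ at $q$.
  choose c hc using fun a => exists_section_eq (E := E) e.open_baseSet hq
    (contMDiffOn_constSection (n := n) q (b a))
  choose f hf hfT using fun a => exists_contMDiff_eventuallyEq e.open_baseSet
    ((hbc a).comp_contMDiffOn (contMDiffOn_sectionCoord T q)) hq
  have hconst : ∀ (x : F) (q' : Q),
      constSection E q x q' = ∑ a, b.coord a x • constSection E q (b a) q' := by
    intro x q'
    simp only [constSection]
    conv_lhs => rw [← b.sum_repr x, map_sum]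
    exact Finset.sum_congr rfl fun a _ => map_smul _ _ _
  have h1 : ∀ᶠ q' in 𝓝 q, T q' = (∑ a, fsmul (hf a) (c a)) q' := by
    filter_upwards [e.open_baseSet.mem_nhds hq, Filter.eventually_all.2 hc,
      Filter.eventually_all.2 hfT] with q' h1 h2 h3
    rw [sum_section_apply, ← constSection_sectionCoord (F := F) T h1, hconst]
    exact Finset.sum_congr rfl fun a _ => congrArg₂ (· • ·) (h3 a).symm (h2 a).symm
  have h2 : ∀ᶠ q' in 𝓝 q, T' q' = (∑ a, f a q • c a) q' := by
    filter_upwards [hT', Filter.eventually_all.2 hc] with q' h1 h2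
    rw [sum_section_apply, h1, hconst]
    exact Finset.sum_congr rfl fun a _ => congrArg₂ (· • ·) (hfT a).self_of_nhds.symm (h2 a).symm
  rw [LA.bracket_congr (Filter.Eventually.of_forall fun _ => rfl) h1,
    LA.bracket_congr (s := S) (s' := S) (Filter.Eventually.of_forall fun _ => rfl) h2,
    bracket_sum, bracket_sum, sum_section_apply, sum_section_apply]
  have h3 : e.symmL ℝ q (mvfderiv (𝓡 n) (sectionCoord F T q) q (LA.anchor q (S q))) =
      ∑ a, LA.lieDeriv S (f a) q • c a q := by
    refine (hconst _ q).trans (Finset.sum_congr rfl fun a _ => ?_)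
    refine congrArg₂ (· • ·) ?_ (hc a).self_of_nhds.symm
    have h4 := (hfT a).mfderiv_eq (I := 𝓡 n) (I' := 𝓘(ℝ, ℝ))
    have h5 := mfderiv_comp_apply (I := 𝓡 n) (I' := 𝓘(ℝ, F)) (I'' := 𝓘(ℝ, ℝ)) q
      (((hbc a) (sectionCoord F T q q)).mdifferentiableAt (by simp))
      (mdifferentiableAt_sectionCoord T q) (LA.anchor q (S q))
    change _ = mfderiv (𝓡 n) 𝓘(ℝ, ℝ) (f a) q (LA.anchor q (S q))
    rw [h4]
    refine Eq.trans ?_ h5.symm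
    have h6 : fderiv ℝ (b.coord a) (sectionCoord F T q q) =
      LinearMap.toContinuousLinearMap (b.coord a) :=
      (LinearMap.toContinuousLinearMap (b.coord a)).fderiv
    rw [mfderiv_eq_fderiv, h6]
    rfl
  rw [h3, ← Finset.sum_add_distrib]
  refine Finset.sum_congr rfl fun a _ => ?_
  rw [LA.bracket_smul]
  exact LA.leibniz (f a) (hf a) S (c a) q

/-- The bracket of two sections of `E` in the trivialization at `q`. -/
theorem bracket_eq [FiniteDimensional ℝ F] (S T : Cₛ^∞⟮𝓡 n; F, E⟯) (q : Q) :
    LA.bracket S T q =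
      LA.localBracket (constSection E q (sectionCoord F S q q))
        (constSection E q (sectionCoord F T q q)) q +
      (trivializationAt F E q).symmL ℝ q
        (mvfderiv (𝓡 n) (sectionCoord F T q) q (LA.anchor q (S q)) -
          mvfderiv (𝓡 n) (sectionCoord F S q) q (LA.anchor q (T q))) := by
  have hq := mem_baseSet_trivializationAt F E q
  obtain ⟨S', hS'⟩ := exists_section_eq (E := E) (trivializationAt F E q).open_baseSet hq
    (contMDiffOn_constSection (n := n) q (sectionCoord F S q q))
  obtain ⟨T', hT'⟩ := exists_section_eq (E := E) (trivializationAt F E q).open_baseSet hq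
    (contMDiffOn_constSection (n := n) q (sectionCoord F T q q))
  have hTq : T' q = T q := hT'.self_of_nhds.trans (constSection_sectionCoord T hq)
  have hneg : ∀ X Y : Cₛ^∞⟮𝓡 n; F, E⟯, LA.bracket X Y q = -LA.bracket Y X q := fun X Y => by
    rw [LA.bracket_antisymm, ContMDiffSection.coe_neg, Pi.neg_apply]
  -- The coefficients of $T$ are frozen first, then, after exchanging the arguments, those of $S$.
  -- The second correction uses $T'(q)=T(q)$ and receives its minus sign from antisymmetry.
  rw [LA.localBracket_eq hS' hT', LA.bracket_eq_add_of_eventually_const S T T' hT', hneg S T',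
    LA.bracket_eq_add_of_eventually_const T' S S' hS', hTq, hneg S' T', map_sub]
  abel

end Bracket

end LieAlgebroid

theorem mvfderiv_sum_apply {BM : Type*} [NormedAddCommGroup BM] [NormedSpace ℝ BM]
    {HM : Type*} [TopologicalSpace HM] {IM : ModelWithCorners ℝ BM HM}
    {M : Type*} [TopologicalSpace M] [ChartedSpace HM M] {ι : Type} (s : Finset ι)
    {f : ι → M → ℝ} {x : M} (hf : ∀ i ∈ s, MDifferentiableAt IM 𝓘(ℝ, ℝ) (f i) x)
    (v : TangentSpace IM x) :
    mvfderiv IM (fun x => ∑ i ∈ s, f i x) x v = ∑ i ∈ s, mvfderiv IM (f i) x v := by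
  classical
  induction s using Finset.induction_on with
  | empty => simp [mvfderiv_const]
  | insert a s ha ih =>
    have h1 : (fun x => ∑ i ∈ insert a s, f i x) = fun x => f a x + ∑ i ∈ s, f i x :=
      funext fun x => Finset.sum_insert ha
    have h2 : MDifferentiableAt IM 𝓘(ℝ, ℝ) (fun x => ∑ i ∈ s, f i x) x := by
      have hs : ∀ i ∈ s, MDifferentiableAt IM 𝓘(ℝ, ℝ) (f i) x := fun i hi =>
        hf i (Finset.mem_insert_of_mem hi)
      have := MDifferentiableAt.sum hs
      convert this using 1
      funext x
      simp
    rw [h1, mvfderiv_fun_add (hf a (Finset.mem_insert_self a s)) h2, Finset.sum_insert ha,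
      ← ih fun i hi => hf i (Finset.mem_insert_of_mem hi)]
    rfl

/-! ### Lifting tangent vectors of $Q$ along sections of $E$ -/

namespace PhaseSpace

section Derivatives

variable {n k : ℕ} {Q : Type*} [TopologicalSpace Q]
    [ChartedSpace (EuclideanSpace ℝ (Fin n)) Q] [IsManifold (𝓡 n) ∞ Q]
    {F : Type*} [NormedAddCommGroup F] [NormedSpace ℝ F]
    {E : Q → Type*} [TopologicalSpace (TotalSpace F E)]
    [∀ q, AddCommGroup (E q)] [∀ q, Module ℝ (E q)] [∀ q, TopologicalSpace (E q)]
    [FiberBundle F E] [VectorBundle ℝ F E]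

/-- The derivative in a fibre direction is linear in the direction. -/
theorem exists_linearMap_derivY {L : PhaseSpace k F E → ℝ}
    (hL : ContMDiff (phaseModel k n F) 𝓘(ℝ, ℝ) ∞ L) (A : Fin k) (p : PhaseSpace k F E) :
    ∃ l : E p.proj →ₗ[ℝ] ℝ, ∀ a, derivY L A p a = l a := by
  obtain ⟨t, q, y, rfl⟩ := exists_eq_ofCoord p
  have hq := mem_baseSet_trivializationAt F E q
  have hl1 := (contDiff_comp_ofCoord hL t q).differentiable (by simp) y
  refine ⟨((fderiv ℝ (fun y : Fin k → F => L (ofCoord E t q y)) y).comp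
    ((ContinuousLinearMap.single ℝ (fun _ : Fin k => F) A).comp
      ((trivializationAt F E q).continuousLinearMapAt ℝ q))).toLinearMap, fun a => ?_⟩
  conv_lhs => rw [← (trivializationAt F E q).symmL_continuousLinearMapAt (R := ℝ) hq a]
  exact derivY_ofCoord hl1 A _

/-- The map `q ↦ (t; q; Y₁(q), …, Y_k(q))` given by sections `Y_A` of `E`. -/
noncomputable def ofSections (t : EuclideanSpace ℝ (Fin k)) (Y : Fin k → Cₛ^∞⟮𝓡 n; F, E⟯) (q : Q) :
    PhaseSpace k F E :=
  point t q (fun A => Y A q)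

theorem contMDiff_ofSections (t : EuclideanSpace ℝ (Fin k)) (Y : Fin k → Cₛ^∞⟮𝓡 n; F, E⟯) :
    ContMDiff (𝓡 n) (phaseModel k n F) ∞ (ofSections t Y) := fun q =>
  contMDiffAt_const.prodMk (WhitneySum.contMDiffAt_iff.2 ⟨contMDiffAt_id, fun A => (Y A).contMDiff q⟩)

theorem ofSections_proj {p : PhaseSpace k F E} {Y : Fin k → Cₛ^∞⟮𝓡 n; F, E⟯}
    (hY : ∀ A, Y A p.proj = p.comp A) : ofSections p.1 Y p.proj = p :=
  congrArg (point p.1 p.proj) (funext hY)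

/-- The lift of a tangent vector of `Q` along the map given by sections. -/
noncomputable def lift (p : PhaseSpace k F E) (Y : Fin k → Cₛ^∞⟮𝓡 n; F, E⟯)
    (w : TangentSpace (𝓡 n) p.proj) : TangentSpace (phaseModel k n F) p :=
  mfderiv (𝓡 n) (phaseModel k n F) (ofSections p.1 Y) p.proj w

section Lift

variable {p : PhaseSpace k F E} {Y : Fin k → Cₛ^∞⟮𝓡 n; F, E⟯}

/-- The map `ofSections` is a right inverse of the projection. Consequently the lift of $\rho(a)$ is
an admissible second component for $a$. -/
theorem mfderiv_proj_lift (hY : ∀ A, Y A p.proj = p.comp A)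
    (w : TangentSpace (𝓡 n) p.proj) :
    mfderiv (phaseModel k n F) (𝓡 n) (proj : PhaseSpace k F E → Q) p (lift p Y w) = w := by
  have h := mfderiv_comp_apply_of_eq (I := 𝓡 n) (I' := phaseModel k n F) (I'' := 𝓡 n) p.proj
    ((contMDiff_proj (n := n) (E := E) (F := F) p).mdifferentiableAt (by simp))
    ((contMDiff_ofSections p.1 Y p.proj).mdifferentiableAt (by simp)) (ofSections_proj hY) w
  refine h.symm.trans ?_
  change mfderiv (𝓡 n) (𝓡 n) id p.proj w = w
  rw [mfderiv_id]
  rfl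

theorem mvfderiv_lift (hY : ∀ A, Y A p.proj = p.comp A)
    {G : Type*} [NormedAddCommGroup G] [NormedSpace ℝ G]
    {f : PhaseSpace k F E → G} (hf : MDifferentiableAt (phaseModel k n F) 𝓘(ℝ, G) f p)
    (w : TangentSpace (𝓡 n) p.proj) :
    mvfderiv (phaseModel k n F) f p (lift p Y w) =
      mvfderiv (𝓡 n) (fun q => f (ofSections p.1 Y q)) p.proj w :=
  (mfderiv_comp_apply_of_eq (I := 𝓡 n) (I' := phaseModel k n F) (I'' := 𝓘(ℝ, G)) p.proj hf
    ((contMDiff_ofSections p.1 Y p.proj).mdifferentiableAt (by simp)) (ofSections_proj hY) w).symm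

end Lift

end Derivatives

end PhaseSpace

/-! ### The field equation on lifted test sections -/

namespace LieAlgebroid

open PhaseSpace

section FieldEquation

variable {n k : ℕ} {Q : Type*} [TopologicalSpace Q]
    [ChartedSpace (EuclideanSpace ℝ (Fin n)) Q] [IsManifold (𝓡 n) ∞ Q]
    {F : Type*} [NormedAddCommGroup F] [NormedSpace ℝ F]
    {E : Q → Type*} [TopologicalSpace (TotalSpace F E)]
    [∀ q, AddCommGroup (E q)] [∀ q, Module ℝ (E q)] [∀ q, TopologicalSpace (E q)]
    [FiberBundle F E] [VectorBundle ℝ F E]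
    [ContMDiffVectorBundle ∞ F E (𝓡 n)] [T2Space Q] [FiniteDimensional ℝ F]
    {LA : LieAlgebroid (n := n) Q F E}

/-- Near $p$ the components of $\eta$ are pulled back from $Q$, so $\xi$ differentiates them along
$\rho(e_A)=\rho(Y_A)$ at $q$. Those of $\xi$ are tautological and restrict to those of $Y_A$ on the
image of `ofSections`, to which $\eta$ is tangent at $p$. Every term then matches the formula
`bracket_eq`. -/
theorem bracketFst_lift {ξ η : LA.LagSection k} {A : Fin k} (hξ : ∀ p, ξ.fst p = p.comp A)
    {p : PhaseSpace k F E} {T : Cₛ^∞⟮𝓡 n; F, E⟯} {Y : Fin k → Cₛ^∞⟮𝓡 n; F, E⟯}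
    (hY : ∀ A, Y A p.proj = p.comp A)
    (hη : ∀ᶠ q in 𝓝 p.proj, ∀ p' : PhaseSpace k F E, p'.proj = q → η.fst p' = T p'.proj)
    (hη' : η.snd p = lift p Y (LA.anchor p.proj (T p.proj))) :
    bracketFst ξ η p = LA.bracket (Y A) T p.proj := by
  have h1 : ξ.coord p p = sectionCoord F (Y A) p.proj p.proj := by
    rw [ProlongationSection.coord, hξ, sectionCoord, hY]
  have h2 : η.coord p p = sectionCoord F T p.proj p.proj := by
    rw [ProlongationSection.coord, hη.self_of_nhds p rfl, sectionCoord]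
  have h3 : η.coord p =ᶠ[𝓝 p] sectionCoord F T p.proj ∘ proj := by
    filter_upwards [(PhaseSpace.contMDiff_proj (n := n) (k := k) (F := F) (E := E)
      ).continuous.continuousAt.eventually hη] with p' hp'
    rw [ProlongationSection.coord, hp' p' rfl]
    rfl
  have h4 : mvfderiv (phaseModel k n F) (η.coord p) p (ξ.snd p) =
      mvfderiv (𝓡 n) (sectionCoord F T p.proj) p.proj (LA.anchor p.proj (Y A p.proj)) := by
    change mfderiv (phaseModel k n F) 𝓘(ℝ, F) (η.coord p) p (ξ.snd p) = _
    rw [h3.mfderiv_eq]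
    refine (mfderiv_comp_apply (I := phaseModel k n F) (I' := 𝓡 n) (I'' := 𝓘(ℝ, F)) p
      (mdifferentiableAt_sectionCoord T p.proj)
      ((PhaseSpace.contMDiff_proj p).mdifferentiableAt (by simp)) _).trans ?_
    rw [← ξ.anchor_fst, hξ, hY]
    rfl
  have h5 : mvfderiv (phaseModel k n F) (ξ.coord p) p (η.snd p) =
      mvfderiv (𝓡 n) (sectionCoord F (Y A) p.proj) p.proj (LA.anchor p.proj (T p.proj)) := by
    rw [hη', mvfderiv_lift hY ((contMDiffAt_coord ξ p).mdifferentiableAt (by simp))]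
    have h6 : (fun q => ξ.coord p (ofSections p.1 Y q)) = sectionCoord F (Y A) p.proj := by
      funext q
      rw [ProlongationSection.coord, hξ]
      rfl
    rw [h6]
  rw [bracketFst, LA.bracket_eq, h1, h2, h4, h5]

/-- The Euler-Lagrange equations along sections of `E`. -/
theorem IsGeometricSolution.sum_mvfderiv_eq {L : PhaseSpace k F E → ℝ}
    (hL : ContMDiff (phaseModel k n F) 𝓘(ℝ, ℝ) ∞ L)
    {ξ : Fin k → LA.LagSection k} (hξ : LA.IsGeometricSolution L ξ)
    (hfst : ∀ A p, (ξ A).fst p = p.comp A) {η : LA.LagSection k}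
    {p : PhaseSpace k F E} {T : Cₛ^∞⟮𝓡 n; F, E⟯} {Y : Fin k → Cₛ^∞⟮𝓡 n; F, E⟯}
    (hY : ∀ A, Y A p.proj = p.comp A)
    (hη : ∀ᶠ q in 𝓝 p.proj, ∀ p' : PhaseSpace k F E, p'.proj = q → η.fst p' = T p'.proj)
    (hη' : η.snd p = lift p Y (LA.anchor p.proj (T p.proj))) :
    ∑ A, mvfderiv (phaseModel k n F) (fun p' => derivY L A p' (η.fst p')) p ((ξ A).snd p) =
      mvfderiv (𝓡 n) (fun q => L (ofSections p.1 Y q)) p.proj (LA.anchor p.proj (T p.proj)) +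
        ∑ A, derivY L A p (LA.bracket (Y A) T p.proj) := by
  have h := hξ.field_eq η p
  have hdt : ∀ A, dt A (η.toFun p) = 0 := by
    intro A
    change mvfderiv (phaseModel k n F) (fun p' : PhaseSpace k F E => p'.1 A) p (η.snd p) = 0
    rw [hη', mvfderiv_lift hY]
    · change mvfderiv (𝓡 n) (fun _ => p.1 A) p.proj _ = 0
      rw [mvfderiv_const]
      rfl
    · exact ((EuclideanSpace.proj A : EuclideanSpace ℝ (Fin k) →L[ℝ] ℝ).contMDiff.comp
        contMDiff_fst _).mdifferentiableAt (n := ∞) (by simp)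
  -- This is $\sum_A\Theta_L^A(\xi_A)=E_L+L$ differentiated along $\eta$. The part with $E_L$ will
  -- cancel the right-hand side of the field equation.
  have hsum : ∑ A, mvfderiv (phaseModel k n F) (fun p' => derivY L A p' (p'.comp A)) p (η.snd p) =
      mvfderiv (phaseModel k n F) (LA.energy L) p (η.snd p) +
        mvfderiv (phaseModel k n F) L p (η.snd p) := by
    rw [← mvfderiv_sum_apply _ fun A _ =>
      ((contMDiff_derivY_comp hL A) p).mdifferentiableAt (by simp)]
    have h1 : (fun p' : PhaseSpace k F E => ∑ A, derivY L A p' (p'.comp A)) =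
        fun p' => LA.energy L p' + L p' := by
      funext p'
      rw [energy_eq LA hL]
      simp
    rw [h1, mvfderiv_fun_add ((contMDiff_energy hL p).mdifferentiableAt (by simp))
      ((hL p).mdifferentiableAt (by simp))]
    rfl
  have hL' : mvfderiv (phaseModel k n F) L p (η.snd p) =
      mvfderiv (𝓡 n) (fun q => L (ofSections p.1 Y q)) p.proj (LA.anchor p.proj (T p.proj)) := by
    rw [hη', mvfderiv_lift hY ((hL p).mdifferentiableAt (by simp))]
  have hom : ∀ A, LA.omega L A (ξ A) η p =
      -(mvfderiv (phaseModel k n F) (fun p' => derivY L A p' (η.fst p')) p ((ξ A).snd p)) +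
        mvfderiv (phaseModel k n F) (fun p' => derivY L A p' (p'.comp A)) p (η.snd p) +
        derivY L A p (LA.bracket (Y A) T p.proj) := by
    intro A
    have hA : (fun p' => derivY L A p' ((ξ A).fst p')) = fun p' => derivY L A p' (p'.comp A) := by
      funext p'
      rw [hfst]
    rw [omega_eq hL, hA, bracketFst_lift (hfst A) hY hη hη']
    ring
  simp only [hom, hdt, mul_zero, Finset.sum_const_zero, add_zero, Finset.sum_add_distrib,
    Finset.sum_neg_distrib, hsum] at h
  change _ = mvfderiv (phaseModel k n F) (LA.energy L) p (η.snd p) at h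
  rw [← hL']
  linarith

end FieldEquation

end LieAlgebroid

/-! ### Coefficients in a local frame -/

section FrameCoefficients

variable {n : ℕ} {Q : Type*} [TopologicalSpace Q]
    [ChartedSpace (EuclideanSpace ℝ (Fin n)) Q] [IsManifold (𝓡 n) ∞ Q]
    {F : Type*} [NormedAddCommGroup F] [NormedSpace ℝ F]
    {E : Q → Type*} [TopologicalSpace (TotalSpace F E)]
    [∀ q, AddCommGroup (E q)] [∀ q, Module ℝ (E q)] [∀ q, TopologicalSpace (E q)]
    [FiberBundle F E] [VectorBundle ℝ F E]
    [ContMDiffVectorBundle ∞ F E (𝓡 n)] [FiniteDimensional ℝ F]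
    {BM : Type*} [NormedAddCommGroup BM] [NormedSpace ℝ BM]
    {HM : Type*} [TopologicalSpace HM] {IM : ModelWithCorners ℝ BM HM}
    {M : Type*} [TopologicalSpace M] [ChartedSpace HM M]
    {m : ℕ} {e : Fin m → ∀ q, E q} {U : Set Q}

/-- The coefficients in a smooth local frame of a smooth section along a map are smooth. -/
theorem IsLocalFrameOn.contMDiffAt_coeff (he : IsLocalFrameOn (𝓡 n) F ∞ e U) (hU : IsOpen U)
    {g : M → Q} {v : ∀ x, E (g x)} {x : M} (hx : g x ∈ U)
    (hv : ContMDiffAt IM ((𝓡 n).prod 𝓘(ℝ, F)) ∞ (fun x => (⟨g x, v x⟩ : TotalSpace F E)) x)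
    (α : Fin m) : ContMDiffAt IM 𝓘(ℝ, ℝ) ∞ (fun x => he.coeff α (g x) (v x)) x := by
  have : CompleteSpace F := FiniteDimensional.complete ℝ F
  set τ := trivializationAt F E (g x) with hτ
  rw [contMDiffAt_totalSpace] at hv
  have hxτ : g x ∈ τ.baseSet := mem_baseSet_trivializationAt F E (g x)
  -- The frame read in the trivialization is a smooth family of linear maps, invertible where frame
  -- and trivialization are both defined. The coefficients of `v` come from its inverse, and
  -- inversion is smooth at invertible operators.
  let c : Q → (Fin m → ℝ) →L[ℝ] F := fun q =>
    ∑ β, (ContinuousLinearMap.proj (R := ℝ) (φ := fun _ : Fin m => ℝ) β).smulRight (τ ⟨q, e β q⟩).2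
  let c' : ∀ q, q ∈ U → q ∈ τ.baseSet → (Fin m → ℝ) ≃L[ℝ] F := fun q h h' =>
    ((he.toBasisAt h).equivFun.symm.trans (τ.linearEquivAt ℝ q h')).toContinuousLinearEquiv
  have hcc' : ∀ q (h : q ∈ U) (h' : q ∈ τ.baseSet), c q = c' q h h' := by
    intro q h h'
    ext1 y
    have h1 : c' q h h' y = τ.linearEquivAt ℝ q h' (∑ β, y β • e β q) := by
      change τ.linearEquivAt ℝ q h' ((he.toBasisAt h).equivFun.symm y) = _
      rw [Module.Basis.equivFun_symm_apply]
      simp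
    refine Eq.trans ?_ h1.symm
    rw [map_sum]
    simp [c]
  have hc : ContMDiffAt (𝓡 n) 𝓘(ℝ, (Fin m → ℝ) →L[ℝ] F) ∞ c (g x) := by
    refine contMDiffAt_finsetSum fun β _ => ?_
    have h1 : ContMDiffAt (𝓡 n) 𝓘(ℝ, F) ∞ (fun q => (τ ⟨q, e β q⟩).2) (g x) :=
      (contMDiffAt_totalSpace.1 (he.contMDiffAt hU hx β)).2
    exact (ContinuousLinearMap.smulRightL ℝ (Fin m → ℝ) F (ContinuousLinearMap.proj β)).contMDiff.contMDiffAt.comp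
      _ h1
  have hinv : ContMDiffAt IM 𝓘(ℝ, F →L[ℝ] (Fin m → ℝ)) ∞
      (fun x => ContinuousLinearMap.inverse (c (g x))) x := by
    have h1 : ContDiffAt ℝ ∞ ContinuousLinearMap.inverse (c (g x)) := by
      rw [hcc' (g x) hx hxτ]
      exact contDiffAt_map_inverse _
    exact h1.contMDiffAt.comp x (hc.comp x hv.1)
  have h2 := (ContinuousLinearMap.proj (R := ℝ) (φ := fun _ : Fin m => ℝ) α).contMDiff.contMDiffAt.comp
    x (hinv.clm_apply hv.2)
  refine h2.congr_of_eventuallyEq ?_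
  filter_upwards [hv.1.continuousAt.preimage_mem_nhds (hU.mem_nhds hx),
    hv.1.continuousAt.preimage_mem_nhds (τ.open_baseSet.mem_nhds hxτ)] with x' h h'
  have h : g x' ∈ U := h
  have h' : g x' ∈ τ.baseSet := h'
  simp only [Function.comp_apply]
  rw [hcc' (g x') h h', ContinuousLinearMap.inverse_equiv]
  have h3 : (c' (g x') h h').symm (τ ⟨g x', v x'⟩).2 = (he.toBasisAt h).equivFun (v x') := by
    rw [ContinuousLinearEquiv.symm_apply_eq]
    change _ = τ.linearEquivAt ℝ (g x') h'
      ((he.toBasisAt h).equivFun.symm ((he.toBasisAt h).equivFun (v x')))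
    rw [LinearEquiv.symm_apply_apply]
    rfl
  change _ = (c' (g x') h h').symm (τ ⟨g x', v x'⟩).2 α
  rw [h3]
  simp [IsLocalFrameOn.coeff, h]

theorem IsLocalFrameOn.coeff_sum_smul (he : IsLocalFrameOn (𝓡 n) F ∞ e U) {q : Q} (hq : q ∈ U)
    (v : E q) : ∑ α, he.coeff α q v • e α q = v := by
  have := (he.toBasisAt hq).sum_repr v
  simpa [IsLocalFrameOn.coeff, hq] using this

theorem IsLocalFrameOn.coeff_apply_sum_smul (he : IsLocalFrameOn (𝓡 n) F ∞ e U) {q : Q}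
    (hq : q ∈ U) (y : Fin m → ℝ) (α : Fin m) : he.coeff α q (∑ β, y β • e β q) = y α := by
  have := congrFun ((he.toBasisAt hq).repr_sum_self y) α
  simpa [IsLocalFrameOn.coeff, hq] using this

end FrameCoefficients

/-! ### The associated map and derivatives in coordinates -/

namespace LieAlgebroid

open PhaseSpace

section AssociatedMap

variable {n k : ℕ} {Q : Type*} [TopologicalSpace Q]
    [ChartedSpace (EuclideanSpace ℝ (Fin n)) Q] [IsManifold (𝓡 n) ∞ Q]
    {F : Type*} [NormedAddCommGroup F] [NormedSpace ℝ F]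
    {E : Q → Type*} [TopologicalSpace (TotalSpace F E)]
    [∀ q, AddCommGroup (E q)] [∀ q, Module ℝ (E q)] [∀ q, TopologicalSpace (E q)]
    [FiberBundle F E] [VectorBundle ℝ F E]
    {LA : LieAlgebroid (n := n) Q F E} {φ : EuclideanSpace ℝ (Fin k) → Q}
    {Φ : ∀ t, TangentSpace (𝓡 k) t →ₗ[ℝ] E (φ t)}

/-- A constant vector field on `ℝᵏ`. -/
noncomputable def constField (v : EuclideanSpace ℝ (Fin k)) :
    Cₛ^∞⟮𝓡 k; EuclideanSpace ℝ (Fin k),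
      (TangentSpace (𝓡 k) : EuclideanSpace ℝ (Fin k) → Type)⟯ :=
  ⟨fun _ => v, contMDiff_vectorSpace_iff_contDiff.2 contDiff_const⟩

theorem IsMorphism.contMDiff_apply
    (h : (tangentLieAlgebroid (EuclideanSpace ℝ (Fin k))).IsMorphism LA φ Φ)
    (v : EuclideanSpace ℝ (Fin k)) :
    ContMDiff (𝓡 k) ((𝓡 n).prod 𝓘(ℝ, F)) ∞ (fun t => (⟨φ t, Φ t v⟩ : TotalSpace F E)) :=
  h.contMDiff.comp (constField v).contMDiff

theorem IsMorphism.contMDiff_base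
    (h : (tangentLieAlgebroid (EuclideanSpace ℝ (Fin k))).IsMorphism LA φ Φ) :
    ContMDiff (𝓡 k) (𝓡 n) ∞ φ :=
  (Bundle.contMDiff_proj E).comp (h.contMDiff_apply 0)

theorem IsMorphism.contMDiff_assocMap
    (h : (tangentLieAlgebroid (EuclideanSpace ℝ (Fin k))).IsMorphism LA φ Φ) :
    ContMDiff (𝓡 k) (phaseModel k n F) ∞
      (assocMap φ Φ : EuclideanSpace ℝ (Fin k) → PhaseSpace k F E) := fun t =>
  contMDiffAt_id.prodMk (WhitneySum.contMDiffAt_iff.2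
    ⟨h.contMDiff_base t, fun A => h.contMDiff_apply (EuclideanSpace.single A 1) t⟩)

theorem partialT_eq_mvfderiv {G : EuclideanSpace ℝ (Fin k) → ℝ} {t : EuclideanSpace ℝ (Fin k)}
    (hG : MDifferentiableAt (𝓡 k) 𝓘(ℝ, ℝ) G t) (A : Fin k) :
    partialT A G t = mvfderiv (𝓡 k) G t (EuclideanSpace.single A (1 : ℝ)) := by
  rw [partialT, (mdifferentiableAt_iff_differentiableAt.1 hG).lineDeriv_eq_fderiv,
    ← mfderiv_eq_fderiv]
  rfl

theorem partialT_congr {G G' : EuclideanSpace ℝ (Fin k) → ℝ} {t : EuclideanSpace ℝ (Fin k)}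
    (h : G =ᶠ[𝓝 t] G') (A : Fin k) : partialT A G t = partialT A G' t :=
  h.lineDeriv_eq

end AssociatedMap

section Coordinates

variable {n k : ℕ} {Q : Type*} [TopologicalSpace Q]
    [ChartedSpace (EuclideanSpace ℝ (Fin n)) Q] [IsManifold (𝓡 n) ∞ Q]
    {F : Type*} [NormedAddCommGroup F] [NormedSpace ℝ F]
    {E : Q → Type*} [TopologicalSpace (TotalSpace F E)]
    [∀ q, AddCommGroup (E q)] [∀ q, Module ℝ (E q)] [∀ q, TopologicalSpace (E q)]
    [FiberBundle F E] [VectorBundle ℝ F E]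
    {LA : LieAlgebroid (n := n) Q F E}

/-- The chain rule through $\chi$, with the partial derivatives written along coordinate lines so
that they have the form of `derivQ`. -/
theorem mvfderiv_eq_sum_chart {g : Q → ℝ} {q : Q} (hg : MDifferentiableAt (𝓡 n) 𝓘(ℝ, ℝ) g q)
    {χ : OpenPartialHomeomorph Q (EuclideanSpace ℝ (Fin n))}
    (hχ : χ ∈ IsManifold.maximalAtlas (𝓡 n) ∞ Q) (hq : q ∈ χ.source) (s : ∀ q, E q) :
    mvfderiv (𝓡 n) g q (LA.anchor q (s q)) = ∑ i, LA.anchorCoeff χ s i q *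
      deriv (fun x : ℝ => g (χ.symm (χ q + x • EuclideanSpace.single i 1))) 0 := by
  have hχ1 : MDifferentiableAt (𝓡 n) 𝓘(ℝ, EuclideanSpace ℝ (Fin n)) χ q :=
    ((contMDiffOn_of_mem_maximalAtlas hχ).contMDiffAt (χ.open_source.mem_nhds hq)).mdifferentiableAt
      (by simp)
  have hχ2 : MDifferentiableAt 𝓘(ℝ, EuclideanSpace ℝ (Fin n)) (𝓡 n) χ.symm (χ q) :=
    ((contMDiffOn_symm_of_mem_maximalAtlas hχ).contMDiffAt
      (χ.open_target.mem_nhds (χ.map_source hq))).mdifferentiableAt (by simp)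
  have hG : DifferentiableAt ℝ (g ∘ χ.symm) (χ q) :=
    mdifferentiableAt_iff_differentiableAt.1
      (hg.comp_of_eq _ hχ2 (χ.left_inv hq))
  have hev : g =ᶠ[𝓝 q] (g ∘ χ.symm) ∘ χ := by
    filter_upwards [χ.open_source.mem_nhds hq] with q' hq'
    simp [χ.left_inv hq']
  set w : EuclideanSpace ℝ (Fin n) :=
    mfderiv (𝓡 n) 𝓘(ℝ, EuclideanSpace ℝ (Fin n)) χ q (LA.anchor q (s q)) with hw
  have h1 : mvfderiv (𝓡 n) g q (LA.anchor q (s q)) = fderiv ℝ (g ∘ χ.symm) (χ q) w := by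
    change mfderiv (𝓡 n) 𝓘(ℝ, ℝ) g q (LA.anchor q (s q)) = _
    rw [hev.mfderiv_eq]
    refine (mfderiv_comp_apply (I := 𝓡 n) (I' := 𝓘(ℝ, EuclideanSpace ℝ (Fin n)))
      (I'' := 𝓘(ℝ, ℝ)) q hG.mdifferentiableAt hχ1 _).trans ?_
    rw [mfderiv_eq_fderiv]
    rfl
  have h2 : w = ∑ i, w i • EuclideanSpace.single i (1 : ℝ) := by
    ext j
    simp [Finset.sum_apply, Pi.single_apply]
  rw [h1]
  conv_lhs => rw [h2, map_sum]
  refine Finset.sum_congr rfl fun i _ => ?_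
  rw [map_smul, smul_eq_mul, ← hG.lineDeriv_eq_fderiv]
  rfl

end Coordinates

end LieAlgebroid

/-! ### Brackets of frame sections -/

namespace LieAlgebroid

open PhaseSpace

section FrameSections

variable {n k : ℕ} {Q : Type*} [TopologicalSpace Q]
    [ChartedSpace (EuclideanSpace ℝ (Fin n)) Q] [IsManifold (𝓡 n) ∞ Q]
    {F : Type*} [NormedAddCommGroup F] [NormedSpace ℝ F]
    {E : Q → Type*} [TopologicalSpace (TotalSpace F E)]
    [∀ q, AddCommGroup (E q)] [∀ q, Module ℝ (E q)] [∀ q, TopologicalSpace (E q)]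
    [FiberBundle F E] [VectorBundle ℝ F E]
    [ContMDiffVectorBundle ∞ F E (𝓡 n)] [T2Space Q] [FiniteDimensional ℝ F]
    {LA : LieAlgebroid (n := n) Q F E}
    {m : ℕ} {e : Fin m → ∀ q, E q} {U : Set Q}

/-- A local frame extends near each point to global sections. -/
theorem exists_sections_eq_frame (he : IsLocalFrameOn (𝓡 n) F ∞ e U) (hU : IsOpen U) {q : Q}
    (hq : q ∈ U) : ∃ S : Fin m → Cₛ^∞⟮𝓡 n; F, E⟯, ∀ᶠ q' in 𝓝 q, ∀ β, S β q' = e β q' := by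
  choose S hS using fun β => exists_section_eq (E := E) hU hq (he.contMDiffOn β)
  exact ⟨S, Filter.eventually_all.2 hS⟩

variable {S : Fin m → Cₛ^∞⟮𝓡 n; F, E⟯} {q : Q}

theorem bracket_frame (he : IsLocalFrameOn (𝓡 n) F ∞ e U) (hq : q ∈ U)
    (hS : ∀ᶠ q' in 𝓝 q, ∀ β, S β q' = e β q') (α β : Fin m) :
    LA.bracket (S α) (S β) q = ∑ γ, LA.structCoeff he α β γ q • e γ q := by
  rw [← LA.localBracket_eq (hS.mono fun _ h => h α) (hS.mono fun _ h => h β)]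
  exact (he.coeff_sum_smul hq _).symm

/-- The coefficients are real constants, so no derivative terms arise. This is the gain from
extending a vector of $E$ with constant frame coefficients. -/
theorem bracket_sum_frame (he : IsLocalFrameOn (𝓡 n) F ∞ e U) (hq : q ∈ U)
    (hS : ∀ᶠ q' in 𝓝 q, ∀ β, S β q' = e β q') (α : Fin m) (y : Fin m → ℝ) :
    LA.bracket (S α) (∑ β, y β • S β) q =
      ∑ β, ∑ γ, (y β * LA.structCoeff he α β γ q) • e γ q := by
  rw [bracket_sum, sum_section_apply]
  refine Finset.sum_congr rfl fun β _ => ?_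
  rw [LA.bracket_smul, ContMDiffSection.coe_smul, Pi.smul_apply, bracket_frame he hq hS,
    Finset.smul_sum]
  exact Finset.sum_congr rfl fun γ _ => smul_smul _ _ _

theorem bracket_sum_sum_frame (he : IsLocalFrameOn (𝓡 n) F ∞ e U) (hq : q ∈ U)
    (hS : ∀ᶠ q' in 𝓝 q, ∀ β, S β q' = e β q') (y z : Fin m → ℝ) :
    LA.bracket (∑ β, y β • S β) (∑ γ, z γ • S γ) q =
      ∑ β, ∑ γ, ∑ α, (y β * z γ * LA.structCoeff he β γ α q) • e α q := by
  -- Additivity in the first argument is obtained from the second by antisymmetry.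
  rw [LA.bracket_antisymm, bracket_sum, ContMDiffSection.coe_neg, Pi.neg_apply, sum_section_apply,
    ← Finset.sum_neg_distrib]
  refine Finset.sum_congr rfl fun β _ => ?_
  rw [LA.bracket_smul, ContMDiffSection.coe_smul, Pi.smul_apply, ← smul_neg, ← Pi.neg_apply,
    ← ContMDiffSection.coe_neg, ← LA.bracket_antisymm, bracket_sum_frame he hq hS,
    Finset.smul_sum]
  refine Finset.sum_congr rfl fun γ _ => ?_
  rw [Finset.smul_sum]
  exact Finset.sum_congr rfl fun α _ => by rw [smul_smul, mul_assoc]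

end FrameSections

/-! ### Integral sections and the Euler-Lagrange equations -/

section EulerLagrange

variable {n k : ℕ} {Q : Type*} [TopologicalSpace Q]
    [ChartedSpace (EuclideanSpace ℝ (Fin n)) Q] [IsManifold (𝓡 n) ∞ Q]
    {F : Type*} [NormedAddCommGroup F] [NormedSpace ℝ F]
    {E : Q → Type*} [TopologicalSpace (TotalSpace F E)]
    [∀ q, AddCommGroup (E q)] [∀ q, Module ℝ (E q)] [∀ q, TopologicalSpace (E q)]
    [FiberBundle F E] [VectorBundle ℝ F E]
    [ContMDiffVectorBundle ∞ F E (𝓡 n)] [T2Space Q] [FiniteDimensional ℝ F]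
    {LA : LieAlgebroid (n := n) Q F E} {L : PhaseSpace k F E → ℝ} {ξ : Fin k → LA.LagSection k}

theorem IsIntegralSection.mvfderiv_comp {η : EuclideanSpace ℝ (Fin k) → PhaseSpace k F E}
    (hη : LA.IsIntegralSection ξ η) {f : PhaseSpace k F E → ℝ}
    {t : EuclideanSpace ℝ (Fin k)}
    (hf : MDifferentiableAt (phaseModel k n F) 𝓘(ℝ, ℝ) f (η t)) (A : Fin k) :
    partialT A (fun t' => f (η t')) t = mvfderiv (phaseModel k n F) f (η t) ((ξ A).snd (η t)) := by
  rw [partialT_eq_mvfderiv (G := fun t' => f (η t')) (hf.comp t (hη.1 t)), ← hη.2]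
  exact mfderiv_comp_apply (I := 𝓡 k) (I' := phaseModel k n F) (I'' := 𝓘(ℝ, ℝ)) t hf (hη.1 t) _

/-- The prolongation condition says that $\rho(\xi_A)$ projects to $\rho$ of the first component of
$\xi_A$, which is $e_A$ by the second order property. -/
theorem IsIntegralSection.mvfderiv_comp_proj {η : EuclideanSpace ℝ (Fin k) → PhaseSpace k F E}
    (hη : LA.IsIntegralSection ξ η) (hfst : ∀ A p, (ξ A).fst p = p.comp A) {g : Q → ℝ}
    {t : EuclideanSpace ℝ (Fin k)}
    (hg : MDifferentiableAt (𝓡 n) 𝓘(ℝ, ℝ) g (η t).proj) (A : Fin k) :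
    partialT A (fun t' => g (η t').proj) t =
      mvfderiv (𝓡 n) g (η t).proj (LA.anchor _ ((η t).comp A)) := by
  have hpr := ((PhaseSpace.contMDiff_proj (n := n) (η t)).mdifferentiableAt (by simp))
  rw [hη.mvfderiv_comp (f := fun p => g p.proj) (MDifferentiableAt.comp (η t) hg hpr), ← hfst,
    (ξ A).anchor_fst]
  exact mfderiv_comp_apply (I := phaseModel k n F) (I' := 𝓡 n) (I'' := 𝓘(ℝ, ℝ)) (η t) hg hpr _

theorem IsIntegralSection.partialT_chart {η : EuclideanSpace ℝ (Fin k) → PhaseSpace k F E}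
    (hη : LA.IsIntegralSection ξ η) (hfst : ∀ A p, (ξ A).fst p = p.comp A)
    {χ : OpenPartialHomeomorph Q (EuclideanSpace ℝ (Fin n))}
    (hχ : χ ∈ IsManifold.maximalAtlas (𝓡 n) ∞ Q) {U : Set Q} (hUχ : U ⊆ χ.source) {m : ℕ}
    {e : Fin m → ∀ q, E q} (he : IsLocalFrameOn (𝓡 n) F ∞ e U) {t : EuclideanSpace ℝ (Fin k)}
    (ht : (η t).proj ∈ U) (i : Fin n) (A : Fin k) :
    partialT A (fun t' => χ (η t').proj i) t =
      ∑ α, coordY he α A (η t) * LA.anchorCoeff χ (e α) i (η t).proj := by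
  have hχ1 : MDifferentiableAt (𝓡 n) 𝓘(ℝ, EuclideanSpace ℝ (Fin n)) χ (η t).proj :=
    ((contMDiffOn_of_mem_maximalAtlas hχ).contMDiffAt
      (χ.open_source.mem_nhds (hUχ ht))).mdifferentiableAt (by simp)
  have hpi := (EuclideanSpace.proj i : EuclideanSpace ℝ (Fin n) →L[ℝ] ℝ).mdifferentiableAt
    (x := χ (η t).proj)
  have hcoord : ∀ w : TangentSpace (𝓡 n) (η t).proj,
      mvfderiv (𝓡 n) (fun q => χ q i) (η t).proj w = (EuclideanSpace.proj i :
        EuclideanSpace ℝ (Fin n) →L[ℝ] ℝ) (mfderiv (𝓡 n) 𝓘(ℝ, EuclideanSpace ℝ (Fin n)) χ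
          (η t).proj w) := by
    intro w
    refine (mfderiv_comp_apply (I := 𝓡 n) (I' := 𝓘(ℝ, EuclideanSpace ℝ (Fin n)))
      (I'' := 𝓘(ℝ, ℝ)) (η t).proj hpi hχ1 w).trans ?_
    rw [ContinuousLinearMap.mfderiv_eq]
    rfl
  rw [hη.mvfderiv_comp_proj hfst (g := fun q => χ q i) (MDifferentiableAt.comp _ hpi hχ1) A,
    ← he.coeff_sum_smul ht ((η t).comp A), map_sum, map_sum]
  refine Finset.sum_congr rfl fun α _ => ?_
  rw [map_smul, map_smul, smul_eq_mul, hcoord]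
  rfl

/-- The Euler-Lagrange equations for integral sections of a geometric solution. -/
theorem IsGeometricSolution.eulerLagrange (hξ : LA.IsGeometricSolution L ξ)
    (hL : ContMDiff (phaseModel k n F) 𝓘(ℝ, ℝ) ∞ L) (hfst : ∀ A p, (ξ A).fst p = p.comp A)
    {η : EuclideanSpace ℝ (Fin k) → PhaseSpace k F E} (hη : LA.IsIntegralSection ξ η)
    {χ : OpenPartialHomeomorph Q (EuclideanSpace ℝ (Fin n))}
    (hχ : χ ∈ IsManifold.maximalAtlas (𝓡 n) ∞ Q) {U : Set Q} (hU : IsOpen U)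
    (hUχ : U ⊆ χ.source) {m : ℕ} {e : Fin m → ∀ q, E q} (he : IsLocalFrameOn (𝓡 n) F ∞ e U)
    {t : EuclideanSpace ℝ (Fin k)} (ht : (η t).proj ∈ U) (α : Fin m) :
    ∑ A, partialT A (fun t' => derivY L A (η t') (e α (η t').proj)) t =
      ∑ i, LA.anchorCoeff χ (e α) i (η t).proj * derivQ he χ L i (η t) -
        ∑ A, ∑ β, ∑ γ, coordY he β A (η t) * LA.structCoeff he α β γ (η t).proj *
          derivY L A (η t) (e γ (η t).proj) := by
  set p := η t with hp
  obtain ⟨S, hS⟩ := exists_sections_eq_frame he hU ht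
  have hSq := hS.self_of_nhds
  -- Constant coefficients serve twice: moving $q$ along $Y$ keeps all $y^\alpha_A$ fixed, as
  -- $\partial L/\partial q^i$ requires, and brackets with the frame involve structure functions
  -- only.
  let Y : Fin k → Cₛ^∞⟮𝓡 n; F, E⟯ := fun A => ∑ β, coordY he β A p • S β
  have hYev : ∀ᶠ q in 𝓝 p.proj, ∀ A, Y A q = ∑ β, coordY he β A p • e β q := by
    filter_upwards [hS] with q hq A
    rw [sum_section_apply]
    exact Finset.sum_congr rfl fun β _ => congrArg (coordY he β A p • ·) (hq β)
  have hY : ∀ A, Y A p.proj = p.comp A := fun A =>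
    (hYev.self_of_nhds A).trans (he.coeff_sum_smul ht (p.comp A))
  obtain ⟨ζ, f, hf, hζ, hζ'⟩ := LA.exists_lagSection (S α) p
    (lift p Y (LA.anchor p.proj (S α p.proj))) (mfderiv_proj_lift hY _).symm
  have hζS : ∀ᶠ q in 𝓝 p.proj, ∀ p' : PhaseSpace k F E, p'.proj = q →
      ζ.fst p' = S α p'.proj := by
    filter_upwards [hf] with q hq p' hp'
    rw [hζ, hp', hq, one_smul]
  have hmain := hξ.sum_mvfderiv_eq hL hfst hY hζS hζ'
  have hleft : ∀ A, partialT A (fun t' => derivY L A (η t') (e α (η t').proj)) t =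
      mvfderiv (phaseModel k n F) (fun p' => derivY L A p' (ζ.fst p')) p ((ξ A).snd p) := by
    intro A
    rw [hp, ← hη.mvfderiv_comp ((contMDiff_derivY_fst hL A ζ _).mdifferentiableAt (by simp))]
    -- The test section has first component $e_\alpha$ only near the base point, which is enough for
    -- a derivative at `t`.
    refine partialT_congr ?_ A
    have hcont : ContinuousAt (fun t' => (η t').proj) t :=
      ((PhaseSpace.contMDiff_proj (n := n)).continuous.continuousAt).comp (hη.1 t).continuousAt
    filter_upwards [hcont.eventually hζS, hcont.eventually hS] with t' h1 h2
    rw [h1 _ rfl, h2]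
  have hright : mvfderiv (𝓡 n) (fun q => L (ofSections p.1 Y q)) p.proj
      (LA.anchor p.proj (S α p.proj)) =
      ∑ i, LA.anchorCoeff χ (e α) i p.proj * derivQ he χ L i p := by
    rw [hSq α, mvfderiv_eq_sum_chart (g := fun q => L (ofSections p.1 Y q))
      ((hL.comp (contMDiff_ofSections p.1 Y) p.proj).mdifferentiableAt (by simp)) hχ (hUχ ht) (e α)]
    refine Finset.sum_congr rfl fun i _ => congrArg (LA.anchorCoeff χ (e α) i p.proj * ·) ?_
    refine Filter.EventuallyEq.deriv_eq ?_
    have hcont : ContinuousAt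
        (fun s : ℝ => χ.symm (χ p.proj + s • EuclideanSpace.single i (1 : ℝ))) 0 := by
      have h1 : ContinuousAt (fun s : ℝ => χ p.proj + s • EuclideanSpace.single i (1 : ℝ)) 0 := by
        fun_prop
      refine ContinuousAt.comp_of_eq (χ.continuousAt_symm (χ.map_source (hUχ ht))) h1 (by simp)
    have h0 : χ.symm (χ p.proj + (0 : ℝ) • EuclideanSpace.single i (1 : ℝ)) = p.proj := by
      simp [χ.left_inv (hUχ ht)]
    rw [ContinuousAt, h0] at hcont
    -- For small $s$ the coordinate line stays where $Y_A$ is given by the frame, so both functions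
    -- of $s$ agree near $0$.
    filter_upwards [hcont.eventually hYev] with s hs
    exact congrArg (fun u => L (point p.1 _ u)) (funext hs)
  have hbr : ∀ A, derivY L A p (LA.bracket (Y A) (S α) p.proj) =
      -∑ β, ∑ γ, coordY he β A p * LA.structCoeff he α β γ p.proj * derivY L A p (e γ p.proj) := by
    intro A
    obtain ⟨l, hl⟩ := exists_linearMap_derivY hL A p
    -- The exchange $[\![Y_A,e_\alpha]\!]=-[\![e_\alpha,Y_A]\!]$ gives the sign in front of the
    -- structure functions.
    rw [LA.bracket_antisymm, ContMDiffSection.coe_neg, Pi.neg_apply, bracket_sum_frame he ht hS,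
      hl, map_neg, map_sum]
    simp only [map_sum, map_smul, smul_eq_mul, hl]
  simp only [hleft, hmain, hright, hbr, Finset.sum_neg_distrib]
  ring

end EulerLagrange

/-! ### The zero curvature equation -/

section ZeroCurvature

variable {n k : ℕ} {Q : Type*} [TopologicalSpace Q]
    [ChartedSpace (EuclideanSpace ℝ (Fin n)) Q] [IsManifold (𝓡 n) ∞ Q]
    {F : Type*} [NormedAddCommGroup F] [NormedSpace ℝ F]
    {E : Q → Type*} [TopologicalSpace (TotalSpace F E)]
    [∀ q, AddCommGroup (E q)] [∀ q, Module ℝ (E q)] [∀ q, TopologicalSpace (E q)]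
    [FiberBundle F E] [VectorBundle ℝ F E]
    {LA : LieAlgebroid (n := n) Q F E}

/-- The exterior derivative of a `1`-form. -/
theorem extDeriv_one_apply (θ : ∀ q, E q →ₗ[ℝ] ℝ) (σ : Fin 2 → Cₛ^∞⟮𝓡 n; F, E⟯) (q : Q) :
    LA.extDeriv (fun q => AlternatingMap.ofSubsingleton ℝ (E q) ℝ (0 : Fin 1) (θ q)) σ q =
      LA.lieDeriv (σ 0) (fun q => θ q (σ 1 q)) q - LA.lieDeriv (σ 1) (fun q => θ q (σ 0 q)) q -
        θ q (LA.bracket (σ 0) (σ 1) q) := by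
  simp [extDeriv, Fin.sum_univ_two]
  ring

theorem bracket_constField (v w : EuclideanSpace ℝ (Fin k)) (t : EuclideanSpace ℝ (Fin k)) :
    (tangentLieAlgebroid (EuclideanSpace ℝ (Fin k))).bracket (constField v) (constField w) t = 0 := by
  have h : ∀ V W : ∀ x : EuclideanSpace ℝ (Fin k), TangentSpace (𝓡 k) x,
      VectorField.mlieBracket (𝓡 k) V W t =
        VectorField.lieBracketWithin (E := EuclideanSpace ℝ (Fin k)) ℝ V W Set.univ t := by
    intro V W
    rw [← VectorField.mlieBracketWithin_univ, VectorField.mlieBracketWithin_eq_lieBracketWithin]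
  refine (h (fun _ => v) fun _ => w).trans ?_
  rw [VectorField.lieBracketWithin_univ]
  simp [VectorField.lieBracket]
  rfl

end ZeroCurvature

end LieAlgebroid

namespace LieAlgebroid

open PhaseSpace

section ZeroCurvatureEquation

variable {n k : ℕ} {Q : Type*} [TopologicalSpace Q]
    [ChartedSpace (EuclideanSpace ℝ (Fin n)) Q] [IsManifold (𝓡 n) ∞ Q]
    {F : Type*} [NormedAddCommGroup F] [NormedSpace ℝ F]
    {E : Q → Type*} [TopologicalSpace (TotalSpace F E)]
    [∀ q, AddCommGroup (E q)] [∀ q, Module ℝ (E q)] [∀ q, TopologicalSpace (E q)]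
    [FiberBundle F E] [VectorBundle ℝ F E]
    {LA : LieAlgebroid (n := n) Q F E}

theorem lieDeriv_eq_zero_of_eventually_const {s : ∀ q, E q} {f : Q → ℝ} {c : ℝ} {q : Q}
    (hf : ∀ᶠ q' in 𝓝 q, f q' = c) : LA.lieDeriv s f q = 0 := by
  have h : f =ᶠ[𝓝 q] fun _ => c := hf
  have h1 := h.mfderiv_eq (I := 𝓡 n) (I' := 𝓘(ℝ, ℝ))
  rw [mfderiv_const] at h1
  change mfderiv (𝓡 n) 𝓘(ℝ, ℝ) f q (LA.anchor q (s q)) = 0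
  rw [h1]
  rfl

theorem lieDeriv_constField {f G : EuclideanSpace ℝ (Fin k) → ℝ} {t : EuclideanSpace ℝ (Fin k)}
    (hfG : f =ᶠ[𝓝 t] G) (hG : MDifferentiableAt (𝓡 k) 𝓘(ℝ, ℝ) G t) (A : Fin k) :
    (tangentLieAlgebroid (EuclideanSpace ℝ (Fin k))).lieDeriv
      (constField (EuclideanSpace.single A (1 : ℝ))) f t = partialT A G t := by
  rw [← partialT_congr hfG A, partialT_eq_mvfderiv (hG.congr_of_eventuallyEq hfG)]
  rfl

variable [ContMDiffVectorBundle ∞ F E (𝓡 n)] [T2Space Q] [FiniteDimensional ℝ F]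

/-- The components of the dual frame extend near each point to global smooth `1`-forms. -/
theorem exists_smoothForm_eq_coeff {m : ℕ} {e : Fin m → ∀ q, E q} {U : Set Q}
    (he : IsLocalFrameOn (𝓡 n) F ∞ e U) (hU : IsOpen U) {q : Q} (hq : q ∈ U) (α : Fin m) :
    ∃ θ : ∀ q, E q →ₗ[ℝ] ℝ, (∀ᶠ q' in 𝓝 q, ∀ v, θ q' v = he.coeff α q' v) ∧
      ∀ s : Cₛ^∞⟮𝓡 n; F, E⟯, ContMDiff (𝓡 n) 𝓘(ℝ, ℝ) ∞ (fun q' => θ q' (s q')) := by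
  obtain ⟨χ, -, hχ⟩ := (SmoothBumpFunction.nhds_basis_tsupport (I := 𝓡 n) q).mem_iff.1
    (hU.mem_nhds hq)
  -- Outside `U` the coefficients carry a default value; the support of the bump function lies
  -- inside `U`.
  refine ⟨fun q' => χ q' • he.coeff α q', ?_, fun s => contMDiff_of_tsupport fun x hx => ?_⟩
  · filter_upwards [χ.eventuallyEq_one] with x hx v
    rw [hx, Pi.one_apply, one_smul]
  · have hx' : x ∈ U := hχ (tsupport_mul_subset_left (g := fun x => he.coeff α x (s x)) hx)
    exact (χ.contMDiff x).mul (he.contMDiffAt_coeff hU (g := id) hx' (s.contMDiff x) α)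

/-- The zero curvature equation for morphisms `Tℝᵏ → E`. -/
theorem IsMorphism.zeroCurvature {φ : EuclideanSpace ℝ (Fin k) → Q}
    {Φ : ∀ t, TangentSpace (𝓡 k) t →ₗ[ℝ] E (φ t)}
    (h : (tangentLieAlgebroid (EuclideanSpace ℝ (Fin k))).IsMorphism LA φ Φ) {U : Set Q}
    (hU : IsOpen U) {m : ℕ} {e : Fin m → ∀ q, E q} (he : IsLocalFrameOn (𝓡 n) F ∞ e U)
    {t : EuclideanSpace ℝ (Fin k)} (ht : φ t ∈ U) (α : Fin m) (A B : Fin k) :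
    0 = partialT B (fun t' => coordY he α A (assocMap φ Φ t')) t -
      partialT A (fun t' => coordY he α B (assocMap φ Φ t')) t +
      ∑ β, ∑ γ, LA.structCoeff he β γ α (φ t) * coordY he β B (assocMap φ Φ t) *
        coordY he γ A (assocMap φ Φ t) := by
  obtain ⟨θ, hθ, hθs⟩ := exists_smoothForm_eq_coeff he hU ht α
  obtain ⟨S, hS⟩ := exists_sections_eq_frame he hU ht
  set y : Fin k → Fin m → ℝ := fun D β => coordY he β D (assocMap φ Φ t) with hy
  -- The vectors $\Phi(\partial/\partial t^D)$ at `t` are extended with constant coefficients, so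
  -- their pairings with $\theta$ are constant near $\phi(t)$ and the derivative terms of $d\theta$
  -- vanish.
  let Y : Fin k → Cₛ^∞⟮𝓡 n; F, E⟯ := fun D => ∑ β, y D β • S β
  have hYev : ∀ᶠ q in 𝓝 (φ t), ∀ D, Y D q = ∑ β, y D β • e β q := by
    filter_upwards [hS] with q hq D
    rw [sum_section_apply]
    exact Finset.sum_congr rfl fun β _ => congrArg (y D β • ·) (hq β)
  have hY : ∀ D, Y D (φ t) = Φ t (EuclideanSpace.single D (1 : ℝ)) := fun D =>
    (hYev.self_of_nhds D).trans (he.coeff_sum_smul ht _)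
  -- Only degree one is needed. On $(\partial/\partial t^B,\partial/\partial t^A)$ the left-hand
  -- side reduces to the two partial derivatives, because these fields commute; the right-hand side
  -- is $-\theta([\![Y_B,Y_A]\!])$.
  have hmain := h.extDeriv_pullback 1
    (fun q => AlternatingMap.ofSubsingleton ℝ (E q) ℝ (0 : Fin 1) (θ q))
    (fun σ => hθs (σ 0)) t
    ![constField (EuclideanSpace.single B 1), constField (EuclideanSpace.single A 1)]
    ![Y B, Y A] (by
      intro i
      fin_cases i
      exacts [hY B, hY A])
  have hpull : (fun t' => (AlternatingMap.ofSubsingleton ℝ (E (φ t')) ℝ (0 : Fin 1)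
      (θ (φ t'))).compLinearMap (Φ t')) = fun t' => AlternatingMap.ofSubsingleton ℝ
        (TangentSpace (𝓡 k) t') ℝ (0 : Fin 1) (θ (φ t') ∘ₗ Φ t') := rfl
  have hconst : ∀ D, ∀ᶠ q in 𝓝 (φ t), θ q (Y D q) = y D α := by
    intro D
    filter_upwards [hθ, hYev, hU.mem_nhds ht] with q h1 h2 h3
    rw [h1, h2, he.coeff_apply_sum_smul h3]
  have hpart : ∀ C D : Fin k, (tangentLieAlgebroid (EuclideanSpace ℝ (Fin k))).lieDeriv
      (constField (EuclideanSpace.single C (1 : ℝ)))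
      (fun t' => (θ (φ t') ∘ₗ Φ t') (constField (EuclideanSpace.single D (1 : ℝ)) t')) t =
        partialT C (fun t' => coordY he α D (assocMap φ Φ t')) t := by
    intro C D
    refine lieDeriv_constField ?_ ((he.contMDiffAt_coeff hU (g := φ) ht
      (h.contMDiff_apply (EuclideanSpace.single D (1 : ℝ)) t) α).mdifferentiableAt (by simp)) C
    -- The form $\theta$ is the dual frame element only near $\phi(t)$; continuity of $\phi$ carries
    -- this to a neighbourhood of `t`.
    filter_upwards [(h.contMDiff_base t).continuousAt.eventually hθ] with t' ht'
    exact ht' _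
  rw [hpull, extDeriv_one_apply, extDeriv_one_apply] at hmain
  simp only [Matrix.cons_val_zero, Matrix.cons_val_one, bracket_constField, map_zero, sub_zero,
    hpart, lieDeriv_eq_zero_of_eventually_const (hconst _)] at hmain
  have hbr : θ (φ t) (LA.bracket (Y B) (Y A) (φ t)) =
      ∑ β, ∑ γ, LA.structCoeff he β γ α (φ t) * y B β * y A γ := by
    rw [bracket_sum_sum_frame he ht hS, map_sum]
    refine Finset.sum_congr rfl fun β _ => ?_
    rw [map_sum]
    refine Finset.sum_congr rfl fun γ _ => ?_
    rw [hθ.self_of_nhds, he.coeff_apply_sum_smul ht]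
    ring
  rw [hmain, hbr]
  ring

end ZeroCurvatureEquation

end LieAlgebroid

theorem theorem5 {n k : ℕ}
    {Q : Type*} [TopologicalSpace Q] [T2Space Q]
    [ChartedSpace (EuclideanSpace ℝ (Fin n)) Q] [IsManifold (𝓡 n) ∞ Q]
    {F : Type*} [NormedAddCommGroup F] [NormedSpace ℝ F] [FiniteDimensional ℝ F]
    {E : Q → Type*} [TopologicalSpace (TotalSpace F E)]
    [∀ q, AddCommGroup (E q)] [∀ q, Module ℝ (E q)] [∀ q, TopologicalSpace (E q)]
    [FiberBundle F E] [VectorBundle ℝ F E] [ContMDiffVectorBundle ∞ F E (𝓡 n)]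
    (LA : LieAlgebroid (n := n) Q F E)
    (L : PhaseSpace k F E → ℝ) (hL : ContMDiff (phaseModel k n F) 𝓘(ℝ, ℝ) ∞ L)
    (hreg : PhaseSpace.IsRegular L)
    (ξ : Fin k → LA.LagSection k) (hξ : LA.IsGeometricSolution L ξ) :
    LA.IsSOPDE ξ ∧
      ∀ (φ : EuclideanSpace ℝ (Fin k) → Q) (Φ : ∀ t, TangentSpace (𝓡 k) t →ₗ[ℝ] E (φ t)),
        (tangentLieAlgebroid (EuclideanSpace ℝ (Fin k))).IsMorphism LA φ Φ →
        LA.IsIntegralSection ξ (LieAlgebroid.assocMap φ Φ) →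
        LA.IsEulerLagrangeSolution L (LieAlgebroid.assocMap φ Φ) := by
  have hfst := hξ.fst_eq_comp hL hreg
  refine ⟨hξ.isSOPDE hL hreg, fun φ Φ hΦ hint => ?_⟩
  exact
    { contMDiff := hΦ.contMDiff_assocMap
      fst_eq := fun _ => rfl
      eulerLagrange := fun χ hχ U hU hUχ m e he t ht α =>
        hξ.eulerLagrange hL hfst hint hχ hU hUχ he ht α
      anchor := fun χ hχ U hU hUχ m e he t ht i A => hint.partialT_chart hfst hχ hUχ he ht i A
      zeroCurvature := fun U hU m e he t ht α A B => hΦ.zeroCurvature hU he ht α A B }
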